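/- Let $G=(V,E)$ be a finite simple graph on $n=|V|$ vertices with edge weights $w(e)\ge 0$, and let $\mathcal M$ be a matroid on the ground set $V$ of rank $k$. For $S\subseteq V$ let $E_G(S)$ be the total weight of the edges having at least one endpoint in $S$. For $\varepsilon>0$, a $(1-\varepsilon)$-approximate solution is an independent set $S$ of $\mathcal M$ with $E_G(S)\ge(1-\varepsilon)\,E_G(O)$ for every independent set $O$. The matroid is given by sets $V_1,\dots,V_r\subseteq V$ and, in cases (i) and (ii), by bounds $k_1,\dots,k_r\in\mathbb N$, in one of the following ways. - Partition matroid: $V_1,\dots,V_r$ are the (nonempty) parts of a partition of $V$, and $S$ is independent iff $|S\cap V_i|\le k_i$ for all $i$. - Laminar matroid: $V_1,\dots,V_r$ are distinct and any two of them are disjoint or nested, and $S$ is independent iff $|S\cap V_i|\le k_i$ for all $i$. - Transversal matroid: $S$ is independent iff there is an injective map $\varphi:S\to\{1,\dots,r\}$ with $v\in V_{\varphi(v)}$ for all $v\in S$. Running times count the steps of a random access machine that has unit-cost addition, subtraction and comparison on natural numbers and on real numbers (the weights and $\varepsilon$ are real inputs). Put $N=n+1$ for partition and laminar matroids and $N=n+r+1$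 for transversal matroids (so $N=O(n)$ if $r\leq n$, in particular if $r=k$). For each of the three types of matroids there are two algorithms, each of which receives the graph, the weights, the sets $V_i$, the bounds $k_i$ and $\varepsilon$, such that for every instance of that type and every $\varepsilon>0$ the following holds, where all constants hidden in $O(\cdot)$ are absolute. The first algorithm computes, in time $N^{O(1)}$, a set $V'\subseteq V$ that contains a $(1-\varepsilon)$-approximate solution and satisfies (i) $|V'|\le \dfrac{k}{\varepsilon}$ if $\mathcal M$ is a partition matroid; (ii) $|V'|\le \dfrac{2k}{\varepsilon}$ if $\mathcal M$ is a laminar matroid; (iii) $|V'|\le \dfrac{k}{\varepsilon}+k(k-1)$ if $\mathcal M$ is a transversal matroid. The second algorithm computes a $(1-\varepsilon)$-approximate solution $S\subseteq V'$, in time $\left(\max\{1,\tfrac1\varepsilon\}\right)^{O(k)}N^{O(1)}$ for partition and laminar matroids, and in time $\left(\tfrac1\varepsilon+k\right)^{O(k)}N^{O(1)}$ for transversal matroids. -/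

import Mathlib

/-! ### A machine model with a step count

A random access machine with arrays, programmed in a structured language. Natural numbers serve as
indices and counters (addition, truncated subtraction, comparison; no multiplication); real numbers
can only be copied, added, subtracted and compared, and never be turned into natural numbers. Every
node of an expression that is evaluated and every executed statement costs one step. -/

/-- The memory: natural and real variables, and natural and real two-dimensional arrays
(array name, row, column). -/
structure RamState where
  nvar : ℕ → ℕ
  narr : ℕ → ℕ → ℕ → ℕ
  rvar : ℕ → ℝ
  rarr : ℕ → ℕ → ℕ → ℝ

/-- Natural-number expressions. -/
inductive NExp : Type
  | const (c : ℕ) : NExp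
  | var (x : ℕ) : NExp
  | get (a : ℕ) (i j : NExp) : NExp
  | add (e f : NExp) : NExp
  | sub (e f : NExp) : NExp

/-- Real-number expressions. -/
inductive RExp : Type
  | zero : RExp
  | one : RExp
  | var (x : ℕ) : RExp
  | get (a : ℕ) (i j : NExp) : RExp
  | add (e f : RExp) : RExp
  | sub (e f : RExp) : RExp

/-- Conditions. -/
inductive BExp : Type
  | nle (e f : NExp) : BExp
  | rle (e f : RExp) : BExp
  | neg (b : BExp) : BExp
  | conj (b c : BExp) : BExp

/-- Programs. -/
inductive Prog : Type
  | skip : Prog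
  | setN (x : ℕ) (e : NExp) : Prog
  | setNA (a : ℕ) (i j e : NExp) : Prog
  | setR (x : ℕ) (e : RExp) : Prog
  | setRA (a : ℕ) (i j : NExp) (e : RExp) : Prog
  | seq (p q : Prog) : Prog
  | ite (b : BExp) (p q : Prog) : Prog
  | loop (b : BExp) (p : Prog) : Prog

/-- The value of a natural-number expression. -/
def NExp.eval (s : RamState) : NExp → ℕ
  | .const c => c
  | .var x => s.nvar x
  | .get a i j => s.narr a (i.eval s) (j.eval s)
  | .add e f => e.eval s + f.eval s
  | .sub e f => e.eval s - f.eval s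

/-- The number of steps needed to evaluate a natural-number expression. -/
def NExp.cost : NExp → ℕ
  | .const _ => 1
  | .var _ => 1
  | .get _ i j => 1 + i.cost + j.cost
  | .add e f => 1 + e.cost + f.cost
  | .sub e f => 1 + e.cost + f.cost

/-- The value of a real-number expression. -/
noncomputable def RExp.eval (s : RamState) : RExp → ℝ
  | .zero => 0
  | .one => 1
  | .var x => s.rvar x
  | .get a i j => s.rarr a (i.eval s) (j.eval s)
  | .add e f => e.eval s + f.eval s
  | .sub e f => e.eval s - f.eval s

/-- The number of steps needed to evaluate a real-number expression. -/
def RExp.cost : RExp → ℕ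
  | .zero => 1
  | .one => 1
  | .var _ => 1
  | .get _ i j => 1 + i.cost + j.cost
  | .add e f => 1 + e.cost + f.cost
  | .sub e f => 1 + e.cost + f.cost

/-- The truth of a condition. -/
def BExp.holds (s : RamState) : BExp → Prop
  | .nle e f => e.eval s ≤ f.eval s
  | .rle e f => e.eval s ≤ f.eval s
  | .neg b => ¬ b.holds s
  | .conj b c => b.holds s ∧ c.holds s

/-- The number of steps needed to evaluate a condition. -/
def BExp.cost : BExp → ℕ
  | .nle e f => 1 + e.cost + f.cost
  | .rle e f => 1 + e.cost + f.cost
  | .neg b => 1 + b.cost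
  | .conj b c => 1 + b.cost + c.cost

/-- Assignment to a natural variable. -/
def RamState.setNVar (s : RamState) (x v : ℕ) : RamState :=
  { s with nvar := fun y => if y = x then v else s.nvar y }

/-- Assignment to a cell of a natural array. -/
def RamState.setNArr (s : RamState) (a i j v : ℕ) : RamState :=
  { s with narr := fun a' i' j' => if a' = a ∧ i' = i ∧ j' = j then v else s.narr a' i' j' }

/-- Assignment to a real variable. -/
def RamState.setRVar (s : RamState) (x : ℕ) (v : ℝ) : RamState :=
  { s with rvar := fun y => if y = x then v else s.rvar y }

/-- Assignment to a cell of a real array. -/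
def RamState.setRArr (s : RamState) (a i j : ℕ) (v : ℝ) : RamState :=
  { s with rarr := fun a' i' j' => if a' = a ∧ i' = i ∧ j' = j then v else s.rarr a' i' j' }

/-- `Exec p s s' t`: started in memory `s`, the program `p` halts after exactly `t` steps in
memory `s'`. -/
inductive Exec : Prog → RamState → RamState → ℕ → Prop
  | skip (s : RamState) : Exec .skip s s 1
  | setN (s : RamState) (x : ℕ) (e : NExp) :
      Exec (.setN x e) s (s.setNVar x (e.eval s)) (1 + e.cost)
  | setNA (s : RamState) (a : ℕ) (i j e : NExp) :
      Exec (.setNA a i j e) s (s.setNArr a (i.eval s) (j.eval s) (e.eval s))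
        (1 + i.cost + j.cost + e.cost)
  | setR (s : RamState) (x : ℕ) (e : RExp) :
      Exec (.setR x e) s (s.setRVar x (e.eval s)) (1 + e.cost)
  | setRA (s : RamState) (a : ℕ) (i j : NExp) (e : RExp) :
      Exec (.setRA a i j e) s (s.setRArr a (i.eval s) (j.eval s) (e.eval s))
        (1 + i.cost + j.cost + e.cost)
  | seq {p q : Prog} {s s' s'' : RamState} {t t' : ℕ} :
      Exec p s s' t → Exec q s' s'' t' → Exec (.seq p q) s s'' (t + t')
  | iteTrue {b : BExp} {p q : Prog} {s s' : RamState} {t : ℕ} :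
      b.holds s → Exec p s s' t → Exec (.ite b p q) s s' (1 + b.cost + t)
  | iteFalse {b : BExp} {p q : Prog} {s s' : RamState} {t : ℕ} :
      ¬ b.holds s → Exec q s s' t → Exec (.ite b p q) s s' (1 + b.cost + t)
  | loopTrue {b : BExp} {p : Prog} {s s' s'' : RamState} {t t' : ℕ} :
      b.holds s → Exec p s s' t → Exec (.loop b p) s' s'' t' →
        Exec (.loop b p) s s'' (1 + b.cost + t + t')
  | loopFalse {b : BExp} {p : Prog} {s : RamState} :
      ¬ b.holds s → Exec (.loop b p) s s (1 + b.cost)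

/-! ### Matroid-constrained vertex cover -/

/-- An instance: a graph on the vertices `0, …, n - 1` with nonnegative edge weights, a matroid `M`
on the vertex set, and the data by which the matroid is given, namely sets of vertices
`F 0, …, F (r - 1)` and numbers `b 0, …, b (r - 1)`. How these data determine `M` is expressed by
the three predicates `IsPartition`, `IsLaminar` and `IsTransversal` below. -/
structure CoverInstance where
  n : ℕ
  graph : SimpleGraph (Fin n)
  weight : Sym2 (Fin n) → ℝ
  weight_nonneg : ∀ e ∈ graph.edgeSet, 0 ≤ weight e
  M : Matroid (Fin n)
  ground_eq : M.E = Set.univ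
  r : ℕ
  F : Fin r → Finset (Fin n)
  b : Fin r → ℕ

namespace CoverInstance

/-- The rank of the matroid. -/
noncomputable def rank (I : CoverInstance) : ℕ := I.M.eRank.toNat

/-- The independent sets are the sets that contain at most `b i` elements of each `F i`. -/
def GivenByBounds (I : CoverInstance) : Prop :=
  ∀ S : Finset (Fin I.n), I.M.Indep (S : Set (Fin I.n)) ↔ ∀ i, (S ∩ I.F i).card ≤ I.b i

/-- The matroid is a partition matroid, given by the partition `F` with bounds `b`. -/
def IsPartition (I : CoverInstance) : Prop :=
  (∀ i, (I.F i).Nonempty) ∧ (∀ i j, i ≠ j → Disjoint (I.F i) (I.F j)) ∧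
    (∀ v, ∃ i, v ∈ I.F i) ∧ I.GivenByBounds

/-- The matroid is a laminar matroid, given by the laminar family `F` with bounds `b`. -/
def IsLaminar (I : CoverInstance) : Prop :=
  Function.Injective I.F ∧
    (∀ i j, i ≠ j → Disjoint (I.F i) (I.F j) ∨ I.F i ⊆ I.F j ∨ I.F j ⊆ I.F i) ∧ I.GivenByBounds

/-- The matroid is a transversal matroid, given by the family `F` (the numbers `b` play no role):
the independent sets are the partial transversals of `F`. -/
def IsTransversal (I : CoverInstance) : Prop :=
  ∀ S : Finset (Fin I.n), I.M.Indep (S : Set (Fin I.n)) ↔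
    ∃ φ : {v // v ∈ S} → Fin I.r, Function.Injective φ ∧ ∀ v, (v : Fin I.n) ∈ I.F (φ v)

open Classical in
/-- The total weight of the edges covered by `S`. -/
noncomputable def cover (I : CoverInstance) (S : Finset (Fin I.n)) : ℝ :=
  ∑ e : Sym2 (Fin I.n) with e ∈ I.graph.edgeSet ∧ ∃ v ∈ S, v ∈ e, I.weight e

/-- `S` is a `(1 - ε)`-approximate solution: it is independent and covers at least `1 - ε` times
the weight that any independent set covers. -/
def IsApproxSolution (I : CoverInstance) (ε : ℝ) (S : Finset (Fin I.n)) : Prop :=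
  I.M.Indep (S : Set (Fin I.n)) ∧
    ∀ O : Finset (Fin I.n), I.M.Indep (O : Set (Fin I.n)) → (1 - ε) * I.cover O ≤ I.cover S

open Classical in
/-- The initial memory, holding the instance and `ε`: natural variables `0` and `1` hold `n` and
`r`, natural arrays `0`, `1`, `2` hold the adjacency matrix, the incidence matrix of the family `F`
(row `i`, column `v`) and the numbers `b` (row `i`, column `0`); real variable `0` holds `ε` and
real array `0` holds the weight matrix. Everything else is `0`. -/
noncomputable def input (I : CoverInstance) (ε : ℝ) : RamState where
  nvar x := if x = 0 then I.n else if x = 1 then I.r else 0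
  narr a i j :=
    match a with
    | 0 => if h : i < I.n ∧ j < I.n then
        if I.graph.Adj ⟨i, h.1⟩ ⟨j, h.2⟩ then 1 else 0 else 0
    | 1 => if h : i < I.r ∧ j < I.n then
        if (⟨j, h.2⟩ : Fin I.n) ∈ I.F ⟨i, h.1⟩ then 1 else 0 else 0
    | 2 => if h : i < I.r ∧ j = 0 then I.b ⟨i, h.1⟩ else 0
    | _ => 0
  rvar x := if x = 0 then ε else 0
  rarr a i j :=
    if h : a = 0 ∧ i < I.n ∧ j < I.n then
      if I.graph.Adj ⟨i, h.2.1⟩ ⟨j, h.2.2⟩ then I.weight s(⟨i, h.2.1⟩, ⟨j, h.2.2⟩) else 0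
    else 0

/-- The vertex set that a final memory represents: the vertices `v` for which row `v`, column `0`
of the natural array `3` is nonzero. -/
def output (I : CoverInstance) (s : RamState) : Finset (Fin I.n) :=
  Finset.univ.filter fun v => s.narr 3 v 0 ≠ 0

/-- On input `I` and `ε`, the program `p` halts after at most `T` steps with output `S`. -/
def Computes (p : Prog) (I : CoverInstance) (ε : ℝ) (S : Finset (Fin I.n)) (T : ℝ) : Prop :=
  ∃ (s : RamState) (t : ℕ), Exec p (I.input ε) s t ∧ I.output s = S ∧ (t : ℝ) ≤ T

end CoverInstance

/-! One kernel works for every matroid. Let t = min(n, ⌊1/ε⌋). Visit the vertices in order of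
nonincreasing weighted degree and put each, by first fit, into one of t buckets that are kept
independent. The union V' of the buckets has at most tk ≤ k/ε elements, which is within all three
bounds.

Why V' contains a good solution: let O be optimal, P = O ∩ V' and Q = O \ V'. A vertex of Q was
rejected by every bucket, so in each bucket it is spanned by members of at least its degree.
Exchanging one element at a time (`Matroid.exists_replacement`) gives a subset U_j of the j-th
bucket such that P ∪ U_j is independent and deg(U_j) ≥ deg(Q). A single U_j may waste its degree on
edges inside U_j. The average of the indicators of P ∪ U_j is 1_P + y, where y ≤ 1/t because the
buckets are disjoint, and in the quadratic extension `quadCover` of the coverage function the waste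
is then only a 1/t fraction. The average is rounded back to an independent set inside V' without
loss: W is nonnegative with zero diagonal, so `quadCover` is convex along every direction 1_f - 1_e,
and symmetric basis exchange merges two bases into one (`Matroid.exists_merge`). Since (t + 1)ε > 1
unless t = n, the loss is at most the factor 1 - ε (`Matroid.exists_approx`); t = 0 and t = n are
treated directly.

The second algorithm examines all independent subsets of V'. For t ≥ 2 there are at most t^(3k) of
them (`card_small_subsets_le`), and they are listed vertex by vertex, so that no intermediate list
is longer than the final one. For t ≤ 1 the set V' is itself independent.

Only the independence test depends on the type of matroid. Bounds are checked by counting, in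
polynomial time because a laminar family has at most (n + 1)² members. Partial transversals are
recognised by an auction for bipartite matching; when it gets stuck, a gap between the prices
exhibits a violation of Hall's condition. -/

/-! ### Frame reasoning and timed correctness rules for programs. -/

/-- A unit of memory that a program can leave untouched. -/
inductive Cell : Type
  | nvar (x : ℕ) : Cell
  | narr (a : ℕ) : Cell
  | rvar (x : ℕ) : Cell
  | rarr (a : ℕ) : Cell

/-- Two memories agree on a cell. -/
def Cell.Same (s s' : RamState) : Cell → Prop
  | .nvar x => s'.nvar x = s.nvar x
  | .narr a => s'.narr a = s.narr a
  | .rvar x => s'.rvar x = s.rvar x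
  | .rarr a => s'.rarr a = s.rarr a

/-- The program contains no assignment to the cell. -/
def Prog.Keeps (c : Cell) : Prog → Prop
  | .skip => True
  | .setN x _ => c ≠ .nvar x
  | .setNA a _ _ _ => c ≠ .narr a
  | .setR x _ => c ≠ .rvar x
  | .setRA a _ _ _ => c ≠ .rarr a
  | .seq p q => p.Keeps c ∧ q.Keeps c
  | .ite _ p q => p.Keeps c ∧ q.Keeps c
  | .loop _ p => p.Keeps c

attribute [simp] Prog.Keeps

theorem Cell.same_refl (s : RamState) (c : Cell) : c.Same s s := by
  cases c <;> rfl

theorem Cell.Same.trans {s s' s'' : RamState} {c : Cell} (h : c.Same s s') (h' : c.Same s' s'') :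
    c.Same s s'' := by
  cases c <;> exact Eq.trans h' h

/-- The memory `s'` differs from `s` only where `p` writes. -/
def Framed (p : Prog) (s s' : RamState) : Prop := ∀ c : Cell, p.Keeps c → c.Same s s'

theorem Framed.nvar {p : Prog} {s s' : RamState} (h : Framed p s s') (x : ℕ)
    (hx : p.Keeps (.nvar x)) : s'.nvar x = s.nvar x := h _ hx

theorem Framed.narr {p : Prog} {s s' : RamState} (h : Framed p s s') (x : ℕ)
    (hx : p.Keeps (.narr x)) : s'.narr x = s.narr x := h _ hx

theorem Framed.rvar {p : Prog} {s s' : RamState} (h : Framed p s s') (x : ℕ)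
    (hx : p.Keeps (.rvar x)) : s'.rvar x = s.rvar x := h _ hx

theorem Framed.rarr {p : Prog} {s s' : RamState} (h : Framed p s s') (x : ℕ)
    (hx : p.Keeps (.rarr x)) : s'.rarr x = s.rarr x := h _ hx

theorem Exec.framed {p : Prog} {s s' : RamState} {t : ℕ} (h : Exec p s s' t) : Framed p s s' := by
  induction h with
  | skip s => intro c _; exact c.same_refl _
  | setN s x e =>
    intro c hc
    cases c with
    | nvar y =>
      have : y ≠ x := fun h => hc (h ▸ rfl)
      simp [Cell.Same, RamState.setNVar, this]
    | _ => rfl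
  | setNA s x i j e =>
    intro c hc
    cases c with
    | narr y =>
      have : y ≠ x := fun h => hc (h ▸ rfl)
      simp [Cell.Same, RamState.setNArr, this]
    | _ => rfl
  | setR s x e =>
    intro c hc
    cases c with
    | rvar y =>
      have : y ≠ x := fun h => hc (h ▸ rfl)
      simp [Cell.Same, RamState.setRVar, this]
    | _ => rfl
  | setRA s x i j e =>
    intro c hc
    cases c with
    | rarr y =>
      have : y ≠ x := fun h => hc (h ▸ rfl)
      simp [Cell.Same, RamState.setRArr, this]
    | _ => rfl
  | seq _ _ ih ih' => intro c hc; exact (ih c hc.1).trans (ih' c hc.2)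
  | iteTrue _ _ ih => intro c hc; exact ih c hc.1
  | iteFalse _ _ ih => intro c hc; exact ih c hc.2
  | loopTrue _ _ _ ih ih' => intro c hc; exact (ih c hc).trans (ih' c hc)
  | loopFalse _ => intro c _; exact c.same_refl _

/-- Started in `s`, the program halts after at most `T` steps in a memory that satisfies `Q`. -/
def Ends (p : Prog) (s : RamState) (T : ℕ) (Q : RamState → Prop) : Prop :=
  ∃ s' t, Exec p s s' t ∧ t ≤ T ∧ Q s'

namespace Ends

variable {p q : Prog} {s : RamState} {T T' : ℕ} {Q R : RamState → Prop}

/-- The weaker postcondition may use the frame, so that specifications of subprograms need only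
mention what these write. -/
theorem mono (h : Ends p s T Q) (hT : T ≤ T') (hQ : ∀ s', Framed p s s' → Q s' → R s') :
    Ends p s T' R := by
  obtain ⟨s', t, h1, h2, h3⟩ := h
  exact ⟨s', t, h1, h2.trans hT, hQ s' h1.framed h3⟩

theorem time (h : Ends p s T Q) (hT : T ≤ T') : Ends p s T' Q := h.mono hT fun _ _ h => h

theorem skip (hT : 1 ≤ T) (h : Q s) : Ends .skip s T Q := ⟨s, 1, .skip s, hT, h⟩

theorem setN {x : ℕ} {e : NExp} (hT : 1 + e.cost ≤ T) (h : Q (s.setNVar x (e.eval s))) :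
    Ends (.setN x e) s T Q := ⟨_, _, .setN s x e, hT, h⟩

theorem setNA {a : ℕ} {i j e : NExp} (hT : 1 + i.cost + j.cost + e.cost ≤ T)
    (h : Q (s.setNArr a (i.eval s) (j.eval s) (e.eval s))) :
    Ends (.setNA a i j e) s T Q := ⟨_, _, .setNA s a i j e, hT, h⟩

theorem setR {x : ℕ} {e : RExp} (hT : 1 + e.cost ≤ T) (h : Q (s.setRVar x (e.eval s))) :
    Ends (.setR x e) s T Q := ⟨_, _, .setR s x e, hT, h⟩

theorem setRA {a : ℕ} {i j : NExp} {e : RExp} (hT : 1 + i.cost + j.cost + e.cost ≤ T)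
    (h : Q (s.setRArr a (i.eval s) (j.eval s) (e.eval s))) :
    Ends (.setRA a i j e) s T Q := ⟨_, _, .setRA s a i j e, hT, h⟩

theorem seq (T₁ : ℕ) (hT : T₁ ≤ T) (h : Ends p s T₁ fun s' => Ends q s' (T - T₁) Q) :
    Ends (.seq p q) s T Q := by
  obtain ⟨s', t, h1, h2, s'', t', h3, h4, h5⟩ := h
  exact ⟨s'', _, .seq h1 h3, by omega, h5⟩

theorem setN_seq {x : ℕ} {e : NExp} (hT : 1 + e.cost ≤ T)
    (h : Ends q (s.setNVar x (e.eval s)) (T - (1 + e.cost)) Q) : Ends (.seq (.setN x e) q) s T Q :=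
  seq _ hT (setN le_rfl h)

theorem setNA_seq {a : ℕ} {i j e : NExp} (hT : 1 + i.cost + j.cost + e.cost ≤ T)
    (h : Ends q (s.setNArr a (i.eval s) (j.eval s) (e.eval s))
      (T - (1 + i.cost + j.cost + e.cost)) Q) : Ends (.seq (.setNA a i j e) q) s T Q :=
  seq _ hT (setNA le_rfl h)

theorem setR_seq {x : ℕ} {e : RExp} (hT : 1 + e.cost ≤ T)
    (h : Ends q (s.setRVar x (e.eval s)) (T - (1 + e.cost)) Q) : Ends (.seq (.setR x e) q) s T Q :=
  seq _ hT (setR le_rfl h)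

theorem setRA_seq {a : ℕ} {i j : NExp} {e : RExp} (hT : 1 + i.cost + j.cost + e.cost ≤ T)
    (h : Ends q (s.setRArr a (i.eval s) (j.eval s) (e.eval s))
      (T - (1 + i.cost + j.cost + e.cost)) Q) : Ends (.seq (.setRA a i j e) q) s T Q :=
  seq _ hT (setRA le_rfl h)

theorem ite {b : BExp} (hT : 1 + b.cost ≤ T) (h : b.holds s → Ends p s (T - (1 + b.cost)) Q)
    (h' : ¬ b.holds s → Ends q s (T - (1 + b.cost)) Q) : Ends (.ite b p q) s T Q := by
  by_cases hb : b.holds s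
  · obtain ⟨s', t, h1, h2, h3⟩ := h hb
    exact ⟨s', _, .iteTrue hb h1, by omega, h3⟩
  · obtain ⟨s', t, h1, h2, h3⟩ := h' hb
    exact ⟨s', _, .iteFalse hb h1, by omega, h3⟩

end Ends

/-- `e < f`. -/
def BExp.nlt (e f : NExp) : BExp := .neg (.nle f e)

/-- `e = f`. -/
def BExp.neq (e f : NExp) : BExp := .conj (.nle e f) (.nle f e)

/-- The disjunction. -/
def BExp.disj (b c : BExp) : BExp := .neg (.conj (.neg b) (.neg c))

@[simp] theorem BExp.holds_nlt {s : RamState} {e f : NExp} :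
    (BExp.nlt e f).holds s ↔ e.eval s < f.eval s := by simp [nlt, holds]

@[simp] theorem BExp.holds_neq {s : RamState} {e f : NExp} :
    (BExp.neq e f).holds s ↔ e.eval s = f.eval s := by simp [neq, holds, le_antisymm_iff]

@[simp] theorem BExp.holds_disj {s : RamState} {b c : BExp} :
    (BExp.disj b c).holds s ↔ b.holds s ∨ c.holds s := by
  simp only [disj, holds]; tauto

@[simp] theorem BExp.cost_nlt {e f : NExp} : (BExp.nlt e f).cost = 2 + e.cost + f.cost := by
  simp only [nlt, cost]; omega

@[simp] theorem BExp.cost_neq {e f : NExp} :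
    (BExp.neq e f).cost = 3 + 2 * e.cost + 2 * f.cost := by
  simp only [neq, cost]; omega

@[simp] theorem BExp.cost_disj {b c : BExp} : (BExp.disj b c).cost = 4 + b.cost + c.cost := by
  simp only [disj, cost]; omega

attribute [simp] BExp.holds NExp.eval RExp.eval NExp.cost RExp.cost BExp.cost RamState.setNVar
  RamState.setNArr RamState.setRVar RamState.setRArr

/-- `for x = 0, …, y - 1 do p`. -/
def Prog.upTo (x y : ℕ) (p : Prog) : Prog :=
  .seq (.setN x (.const 0)) (.loop (.nlt (.var x) (.var y))
    (.seq p (.setN x (.add (.var x) (.const 1)))))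

@[simp] theorem Prog.keeps_upTo {c : Cell} {x y : ℕ} {p : Prog} :
    (Prog.upTo x y p).Keeps c ↔ c ≠ .nvar x ∧ p.Keeps c := by
  simp only [upTo, Keeps]; tauto

/-- Induction on the number `d` of remaining rounds. Each round has an overhead of nine steps, five
for the test and four for the increment; the last, failing test accounts for the 5. The frame refers
to the fixed memory `s₀`, so that in every round all cells the loop does not write are known. -/
theorem Ends.upTo_aux {x y m T : ℕ} {p : Prog} (hxy : x ≠ y) (hx : p.Keeps (.nvar x))
    (hy : p.Keeps (.nvar y)) (s₀ : RamState) (Inv : ℕ → RamState → Prop)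
    (hinv : ∀ i s v, Inv i s → Inv i (s.setNVar x v))
    (hstep : ∀ i s, i < m → Framed (Prog.upTo x y p) s₀ s → s.nvar x = i → Inv i s →
      Ends p s T (Inv (i + 1))) (d : ℕ) :
    ∀ (i : ℕ) (s : RamState), i + d = m → s.nvar x = i → s.nvar y = m →
      Framed (Prog.upTo x y p) s₀ s → Inv i s →
      Ends (.loop (.nlt (.var x) (.var y)) (.seq p (.setN x (.add (.var x) (.const 1))))) s
        (d * (T + 9) + 5) (Inv m) := by
  induction d with
  | zero =>
    intro i s hi hsx hsy _ hI
    have hb : ¬ (BExp.nlt (.var x) (.var y)).holds s := by simp; omega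
    have : i = m := by omega
    exact ⟨s, _, .loopFalse hb, by simp, this ▸ hI⟩
  | succ d ih =>
    intro i s hi hsx hsy hF hI
    have hb : (BExp.nlt (.var x) (.var y)).holds s := by simp; omega
    obtain ⟨s', t, h1, h2, h3⟩ := hstep i s (by omega) hF hsx hI
    have hF' : Framed (Prog.upTo x y p) s₀ (s'.setNVar x (s'.nvar x + 1)) := by
      intro c hc
      refine ((hF c hc).trans (h1.framed c (Prog.keeps_upTo.1 hc).2)).trans ?_
      have hx' := (Prog.keeps_upTo.1 hc).1
      cases c with
      | nvar z =>
        have : z ≠ x := fun h => hx' (h ▸ rfl)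
        simp [Cell.Same, this]
      | _ => rfl
    have hx1 : s'.nvar x = i := (h1.framed.nvar x hx).trans hsx
    have hy1 : s'.nvar y = m := (h1.framed.nvar y hy).trans hsy
    obtain ⟨s'', t', g1, g2, g3⟩ := ih (i + 1) (s'.setNVar x (s'.nvar x + 1)) (by omega)
      (by simp [hx1]) (by simp [hy1, hxy.symm]) hF' (hinv _ _ _ h3)
    refine ⟨s'', _, .loopTrue hb (.seq h1 (.setN _ _ _)) g1, ?_, g3⟩
    simp only [BExp.cost_nlt, NExp.cost]
    rw [Nat.succ_mul]
    omega

/-- The time is expressed through an upper bound `M` of the number of rounds, so that all running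
times can be written in one parameter. -/
theorem Ends.upTo {x y m M T T' : ℕ} {p : Prog} {s : RamState} {Q : RamState → Prop}
    (Inv : ℕ → RamState → Prop) (hm : s.nvar y = m) (hM : m ≤ M) (hxy : x ≠ y)
    (hx : p.Keeps (.nvar x)) (hy : p.Keeps (.nvar y))
    (hinv : ∀ i s v, Inv i s → Inv i (s.setNVar x v)) (h0 : Inv 0 s)
    (hstep : ∀ i s', i < m → Framed (Prog.upTo x y p) s s' → s'.nvar x = i → Inv i s' →
      Ends p s' T (Inv (i + 1)))
    (hT : M * (T + 9) + 7 ≤ T')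
    (hQ : ∀ s', Framed (Prog.upTo x y p) s s' → Inv m s' → Q s') :
    Ends (Prog.upTo x y p) s T' Q := by
  have hF : Framed (Prog.upTo x y p) s (s.setNVar x 0) := by
    intro c hc
    have hx' := (Prog.keeps_upTo.1 hc).1
    cases c with
    | nvar z =>
      have : z ≠ x := fun h => hx' (h ▸ rfl)
      simp [Cell.Same, this]
    | _ => rfl
  have hmM := Nat.mul_le_mul_right (T + 9) hM
  refine Ends.mono (T := 2 + (m * (T + 9) + 5)) (Ends.setN_seq (by simp) ?_) (by omega) hQ
  refine Ends.time ?_ (show m * (T + 9) + 5 ≤ _ by simp)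
  exact Ends.upTo_aux hxy hx hy s Inv hinv hstep m 0 _ (by omega) (by simp)
    (by simp [hxy.symm, hm]) hF (hinv _ _ _ h0)

/-! ### Quadratic extension of the coverage function and its rounding. -/

/-- The quadratic extension of the (doubled) coverage function to real vectors. -/
def quadCover {V : Type*} [Fintype V] (W : V → V → ℝ) (x : V → ℝ) : ℝ :=
  ∑ u, ∑ v, W u v * (x u + x v - x u * x v)

open Classical in
/-- Twice the total weight of the pairs that meet `S`. -/
noncomputable def pairCover {V : Type*} [Fintype V] (W : V → V → ℝ) (S : Set V) : ℝ :=
  ∑ u, ∑ v, if u ∈ S ∨ v ∈ S then W u v else 0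

open Classical in
/-- The indicator vector. -/
noncomputable def ind {V : Type*} (S : Set V) (v : V) : ℝ := if v ∈ S then 1 else 0

theorem ind_of_mem {α : Type*} {S : Set α} {v : α} (h : v ∈ S) : ind S v = 1 := if_pos h

theorem ind_of_notMem {α : Type*} {S : Set α} {v : α} (h : v ∉ S) : ind S v = 0 := if_neg h

theorem ind_exchange {V : Type*} {B : Set V} {e f : V} (he : e ∈ B) (hf : f ∉ B) :
    ind (insert f (B \ {e})) = ind B + (ind {f} - ind {e}) := by
  funext v
  have hfe : f ≠ e := fun h => hf (h ▸ he)
  rw [Pi.add_apply, Pi.sub_apply]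
  by_cases h1 : v = f
  · subst h1
    rw [ind_of_mem (Set.mem_insert _ _), ind_of_notMem hf, ind_of_mem (Set.mem_singleton v),
      ind_of_notMem (by simpa using hfe)]
    norm_num
  rw [ind_of_notMem (S := {f}) (by simpa using h1)]
  by_cases h2 : v = e
  · subst h2
    rw [ind_of_notMem (by simp [h1]), ind_of_mem he, ind_of_mem (Set.mem_singleton v)]
    norm_num
  rw [ind_of_notMem (S := {e}) (by simpa using h2)]
  by_cases h3 : v ∈ B
  · rw [ind_of_mem h3, ind_of_mem (by simp [h2, h3])]; norm_num
  · rw [ind_of_notMem h3, ind_of_notMem (by simp [h1, h3])]; norm_num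

section Rounding

variable {V : Type*} [Fintype V] {W : V → V → ℝ}

theorem quadCover_ind (S : Set V) : quadCover W (ind S) = pairCover W S := by
  unfold quadCover pairCover ind
  refine Finset.sum_congr rfl fun u _ => Finset.sum_congr rfl fun v _ => ?_
  by_cases h1 : u ∈ S <;> by_cases h2 : v ∈ S <;> simp [h1, h2]

theorem quadCover_add_smul (x d : V → ℝ) (s : ℝ) :
    quadCover W (x + s • d) = quadCover W x
      + s * (∑ u, ∑ v, W u v * (d u + d v - x u * d v - d u * x v))
      - s ^ 2 * ∑ u, ∑ v, W u v * (d u * d v) := by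
  unfold quadCover
  simp only [Finset.mul_sum, ← Finset.sum_add_distrib, ← Finset.sum_sub_distrib]
  refine Finset.sum_congr rfl fun u _ => Finset.sum_congr rfl fun v _ => ?_
  simp only [Pi.add_apply, Pi.smul_apply, smul_eq_mul]
  ring

/-- Along `d` the extension is a quadratic polynomial with leading coefficient minus the sum in
`hd`, hence convex; the sign of its linear coefficient tells which of the two moves loses nothing.
-/
theorem quadCover_direction (x d : V → ℝ) (hd : ∑ u, ∑ v, W u v * (d u * d v) ≤ 0) {a b : ℝ}
    (ha : 0 ≤ a) (hb : 0 ≤ b) :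
    quadCover W x ≤ quadCover W (x + a • d) ∨ quadCover W x ≤ quadCover W (x + (-b) • d) := by
  rw [quadCover_add_smul, quadCover_add_smul]
  set L := ∑ u, ∑ v, W u v * (d u + d v - x u * d v - d u * x v)
  rcases le_total 0 L with h | h
  · left; nlinarith [mul_nonneg ha h, mul_nonneg (sq_nonneg a) (neg_nonneg.2 hd)]
  · right
    nlinarith [mul_nonneg hb (neg_nonneg.2 h), mul_nonneg (sq_nonneg b) (neg_nonneg.2 hd)]

/-- The bracket in `quadCover` is 1 - (1 - x u)(1 - x v), which is monotone as long as no coordinate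
exceeds 1. -/
theorem quadCover_mono (hW : ∀ u v, 0 ≤ W u v) {x y : V → ℝ} (hxy : ∀ v, x v ≤ y v)
    (hy : ∀ v, y v ≤ 1) : quadCover W x ≤ quadCover W y := by
  unfold quadCover
  refine Finset.sum_le_sum fun u _ => Finset.sum_le_sum fun v _ =>
    mul_le_mul_of_nonneg_left ?_ (hW u v)
  nlinarith [mul_nonneg (sub_nonneg.2 (hxy u)) (sub_nonneg.2 (hy v)),
    mul_nonneg (sub_nonneg.2 (hxy v)) (sub_nonneg.2 ((hxy u).trans (hy u)))]

/-- Symmetric basis exchange. -/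
theorem Matroid.IsBase.symm_exchange {α : Type*} {M : Matroid α} {B₁ B₂ : Set α}
    (h₁ : M.IsBase B₁) (h₂ : M.IsBase B₂) {e : α} (he : e ∈ B₁ \ B₂) :
    ∃ f ∈ B₂ \ B₁, M.IsBase (insert f (B₁ \ {e})) ∧ M.IsBase (insert e (B₂ \ {f})) := by
  have heE : e ∈ M.E := h₁.subset_ground he.1
  have hcl : e ∈ M.closure B₂ := by rw [h₂.closure_eq]; exact heE
  have hC : M.IsCircuit (M.fundCircuit e B₂) := h₂.indep.fundCircuit_isCircuit hcl he.2
  have heC : e ∈ M.fundCircuit e B₂ := M.mem_fundCircuit e B₂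
  have hsub : M.fundCircuit e B₂ ⊆ insert e B₂ := M.fundCircuit_subset_insert e B₂
  -- Otherwise `B₁ \ {e}` would span the rest of the circuit, and with it `e`. Any element `f` of
  -- the circuit outside that span can be exchanged with `e` in both bases.
  have hnot : ¬ M.fundCircuit e B₂ \ {e} ⊆ M.closure (B₁ \ {e}) := by
    intro h
    have h1 : e ∈ M.closure (M.fundCircuit e B₂ \ {e}) :=
      hC.mem_closure_sdiff_singleton_of_mem heC
    have h2 := M.closure_subset_closure_of_subset_closure h h1
    exact h₁.indep.notMem_closure_sdiff_of_mem he.1 h2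
  obtain ⟨f, hf, hfn⟩ := Set.not_subset.1 hnot
  have hfe : f ≠ e := hf.2
  have hfB₂ : f ∈ B₂ := (hsub hf.1).resolve_left hfe
  have hfB₁ : f ∉ B₁ := fun h => hfn (M.mem_closure_of_mem' ⟨h, hfe⟩ (h₁.subset_ground h))
  refine ⟨f, ⟨hfB₂, hfB₁⟩,
    h₁.exchange_base_of_notMem_closure he.1 hfn (h₂.subset_ground hfB₂), ?_⟩
  have h3 : f ∈ M.closure (insert e B₂ \ {f}) :=
    M.closure_subset_closure (Set.sdiff_subset_sdiff_left hsub)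
      (hC.mem_closure_sdiff_singleton_of_mem hf.1)
  have h4 := h₂.isBase_insert_sdiff_of_mem_closure h3 (Set.mem_insert_of_mem _ hfB₂)
  rwa [Set.insert_sdiff_singleton_comm hfe.symm]

/-- Unless it is zero, the direction has one entry 1 and one entry -1, so products of distinct
coordinates are nonpositive, and the diagonal of `W` vanishes. -/
theorem sum_exchange_direction (hW : ∀ u v, 0 ≤ W u v) (hd : ∀ u, W u u = 0) (e f : V) :
    ∑ u, ∑ v, W u v * ((ind {f} - ind {e} : V → ℝ) u * (ind {f} - ind {e} : V → ℝ) v) ≤ 0 := by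
  refine Finset.sum_nonpos fun u _ => Finset.sum_nonpos fun v _ => ?_
  by_cases huv : u = v
  · simp [huv, hd]
  refine mul_nonpos_of_nonneg_of_nonpos (hW u v) ?_
  simp only [ind, Pi.sub_apply, Set.mem_singleton_iff]
  split_ifs <;> simp_all

/-- Induction on the size of `B₁ \ B₂`. For a symmetric exchange of `e` and `f`, changing `B₁` moves
the point by `a` times 1_f - 1_e, and changing `B₂` moves it by `-b` times the same direction. By
`quadCover_direction` one of the two loses nothing, and both bring the bases closer. -/
theorem Matroid.exists_merge (hW : ∀ u v, 0 ≤ W u v) (hd : ∀ u, W u u = 0) (M : Matroid V)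
    {a b : ℝ} (ha : 0 ≤ a) (hb : 0 ≤ b) (y : V → ℝ) (N : ℕ) :
    ∀ B₁ B₂ : Set V, M.IsBase B₁ → M.IsBase B₂ → (B₁ \ B₂).ncard = N →
      ∃ B, M.IsBase B ∧
        quadCover W (y + a • ind B₁ + b • ind B₂) ≤ quadCover W (y + (a + b) • ind B) := by
  induction N with
  | zero =>
    intro B₁ B₂ h₁ h₂ hN
    have : B₁ \ B₂ = ∅ := (Set.ncard_eq_zero (Set.toFinite _)).1 hN
    have heq : B₁ = B₂ := h₁.eq_of_subset_isBase h₂ (Set.sdiff_eq_empty.1 this)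
    subst heq
    exact ⟨B₁, h₁, by rw [add_smul, add_assoc]⟩
  | succ N ih =>
    intro B₁ B₂ h₁ h₂ hN
    obtain ⟨e, he⟩ : (B₁ \ B₂).Nonempty := by
      by_contra h
      rw [Set.not_nonempty_iff_eq_empty.1 h] at hN
      simp at hN
    obtain ⟨f, hf, hb₁, hb₂⟩ := h₁.symm_exchange h₂ he
    have hfe : f ≠ e := fun h => hf.2 (h ▸ he.1)
    have hcard : ((B₁ \ B₂) \ {e}).ncard = N := by
      rw [Set.ncard_sdiff_singleton_of_mem he, hN]; rfl
    have e1 : (insert f (B₁ \ {e})) \ B₂ = (B₁ \ B₂) \ {e} := by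
      ext v; simp only [Set.mem_sdiff, Set.mem_insert_iff, Set.mem_singleton_iff]
      constructor
      · rintro ⟨rfl | h, h'⟩
        · exact absurd hf.1 h'
        · exact ⟨⟨h.1, h'⟩, h.2⟩
      · rintro ⟨⟨h, h'⟩, h''⟩; exact ⟨Or.inr ⟨h, h''⟩, h'⟩
    have e2 : B₁ \ (insert e (B₂ \ {f})) = (B₁ \ B₂) \ {e} := by
      ext v; simp only [Set.mem_sdiff, Set.mem_insert_iff, Set.mem_singleton_iff]
      constructor
      · rintro ⟨h, h'⟩
        push Not at h'
        refine ⟨⟨h, fun h2 => ?_⟩, h'.1⟩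
        have := h'.2 h2
        exact hf.2 (this ▸ h)
      · rintro ⟨⟨h, h'⟩, h''⟩; exact ⟨h, fun h3 => h3.elim h'' fun h4 => h' h4.1⟩
    rcases quadCover_direction (W := W) (y + a • ind B₁ + b • ind B₂) (ind {f} - ind {e})
      (sum_exchange_direction hW hd e f) ha hb with h | h
    · obtain ⟨B, hB, hle⟩ := ih _ _ hb₁ h₂ (e1 ▸ hcard)
      refine ⟨B, hB, h.trans (le_trans (le_of_eq ?_) hle)⟩
      rw [ind_exchange he.1 hf.2]; congr 1; module
    · obtain ⟨B, hB, hle⟩ := ih _ _ h₁ hb₂ (e2 ▸ hcard)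
      refine ⟨B, hB, h.trans (le_trans (le_of_eq ?_) hle)⟩
      rw [ind_exchange hf.1 he.2]; congr 1; module

/-- The bases are merged one after another. The base whose turn has not come is parked in `y`, hence
the induction over all `y`. -/
theorem Matroid.exists_base_quadCover (hW : ∀ u v, 0 ≤ W u v) (hd : ∀ u, W u u = 0)
    (M : Matroid V) {a : ℝ} (ha : 0 ≤ a) (B : ℕ → Set V) (t : ℕ) :
    ∀ y : V → ℝ, (∀ j < t, M.IsBase (B j)) → ∃ C, M.IsBase C ∧
      quadCover W (y + ∑ j ∈ Finset.range t, a • ind (B j)) ≤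
        quadCover W (y + (t * a) • ind C) := by
  induction t with
  | zero =>
    intro y _
    obtain ⟨C, hC⟩ := M.exists_isBase
    exact ⟨C, hC, by simp⟩
  | succ t ih =>
    intro y hB
    obtain ⟨C, hC, h1⟩ := ih (y + a • ind (B t)) fun j hj => hB j (by omega)
    obtain ⟨D, hD, h2⟩ := M.exists_merge hW hd (mul_nonneg t.cast_nonneg ha) ha y _ C (B t) hC
      (hB t (by omega)) rfl
    refine ⟨D, hD, le_trans (le_of_eq ?_) ((h1.trans (le_of_eq ?_)).trans (h2.trans (le_of_eq ?_)))⟩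
    · rw [Finset.sum_range_succ]; congr 1; abel
    · congr 1; abel
    · push_cast; congr 2; ring_nf

/-- A uniform average of independent sets can be rounded to an independent set without decreasing
the coverage. -/
theorem Matroid.exists_indep_quadCover_le (hW : ∀ u v, 0 ≤ W u v) (hd : ∀ u, W u u = 0)
    (M : Matroid V) (R : Set V) {t : ℕ} (ht : 1 ≤ t) (S : ℕ → Set V)
    (hS : ∀ j < t, M.Indep (S j)) (hSR : ∀ j < t, S j ⊆ R) :
    ∃ C ⊆ R, M.Indep C ∧
      quadCover W (∑ j ∈ Finset.range t, (t : ℝ)⁻¹ • ind (S j)) ≤ pairCover W C := by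
  -- Bases of the restriction to `R` are used, so that the rounded set stays inside `R`. Enlarging
  -- the `S j` to bases does no harm by `quadCover_mono`.
  have hex : ∀ j, ∃ B, j < t → (M.restrict R).IsBase B ∧ S j ⊆ B := by
    intro j
    by_cases hj : j < t
    · have : (M.restrict R).Indep (S j) := Matroid.restrict_indep_iff.2 ⟨hS j hj, hSR j hj⟩
      obtain ⟨B, hB, h⟩ := this.exists_isBase_superset
      exact ⟨B, fun _ => ⟨hB, h⟩⟩
    · exact ⟨∅, fun h => absurd h hj⟩
  choose B hB using hex
  have ht0 : (0 : ℝ) < t := by exact_mod_cast ht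
  obtain ⟨C, hC, hle⟩ := (M.restrict R).exists_base_quadCover hW hd (inv_nonneg.2 ht0.le) B t 0
    fun j hj => (hB j hj).1
  obtain ⟨h1, h2⟩ := Matroid.restrict_indep_iff.1 hC.indep
  refine ⟨C, h2, h1, le_trans (quadCover_mono hW ?_ ?_) (hle.trans (le_of_eq ?_))⟩
  · intro v
    simp only [zero_add, Finset.sum_apply, Pi.smul_apply, smul_eq_mul]
    refine Finset.sum_le_sum fun j hj => mul_le_mul_of_nonneg_left ?_ (inv_nonneg.2 ht0.le)
    have := (hB j (Finset.mem_range.1 hj)).2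
    unfold ind
    split_ifs with h3 h4
    · exact le_rfl
    · exact absurd (this h3) h4
    · exact zero_le_one
    · exact le_rfl
  · intro v
    simp only [zero_add, Finset.sum_apply, Pi.smul_apply, smul_eq_mul]
    calc _ ≤ ∑ j ∈ Finset.range t, (t : ℝ)⁻¹ * 1 :=
          Finset.sum_le_sum fun j _ => mul_le_mul_of_nonneg_left
            (by unfold ind; split_ifs <;> simp) (inv_nonneg.2 ht0.le)
      _ = 1 := by simp [ht0.ne']
  · rw [zero_add, mul_inv_cancel₀ ht0.ne', one_smul, quadCover_ind]

end Rounding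

/-! ### Why the union of the buckets contains a nearly optimal set. -/

section Analysis

variable {V : Type*}

/-- Replacing the elements of an independent set one at a time by elements of `B` of at least the
same weight. -/
theorem Matroid.exists_replacement [DecidableEq V] (M : Matroid V) (deg : V → ℝ) (B : Finset V)
    (hB : M.Indep (B : Set V)) (Q : Finset V)
    (hQ : ∀ v ∈ Q, ¬ M.Indep (insert v {u | u ∈ B ∧ deg v ≤ deg u})) :
    ∀ P : Finset V, Disjoint P Q → M.Indep (↑(P ∪ Q) : Set V) →
      ∃ U ⊆ B, Disjoint U P ∧ M.Indep (↑(P ∪ U) : Set V) ∧ ∑ v ∈ Q, deg v ≤ ∑ v ∈ U, deg v := by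
  induction Q using Finset.induction_on with
  | empty =>
    intro P _ h
    exact ⟨∅, by simp, by simp, by simpa using h, le_rfl⟩
  | insert o Q ho ih =>
    intro P hPQ hI
    have hoP : o ∉ P := fun h => (Finset.disjoint_left.1 hPQ h) (Finset.mem_insert_self _ _)
    set D : Set V := {u | u ∈ B ∧ deg o ≤ deg u}
    have hD : M.Indep D := hB.subset fun u hu => hu.1
    have hoE : o ∈ M.E := hI.subset_ground (by simp)
    have hoD : o ∈ M.closure D := by
      by_contra h
      exact hQ o (Finset.mem_insert_self _ _) ((hD.notMem_closure_iff hoE).1 h).1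
    -- `D` spans `o`, but the independent set deprived of `o` does not; so some `b` in `D` lies
    -- outside its span and can replace `o`. It joins `P` for the rest of the induction.
    have hnot : ¬ D ⊆ M.closure ((↑(P ∪ insert o Q) : Set V) \ {o}) := fun h =>
      hI.notMem_closure_sdiff_of_mem (by simp) (M.closure_subset_closure_of_subset_closure h hoD)
    obtain ⟨b, hb, hbn⟩ := Set.not_subset.1 hnot
    have heq : (↑(P ∪ insert o Q) : Set V) \ {o} = ↑(P ∪ Q) := by
      ext v
      simp only [Finset.coe_union, Finset.coe_insert, Set.mem_sdiff, Set.mem_union,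
        Set.mem_insert_iff, Finset.mem_coe, Set.mem_singleton_iff]
      constructor
      · rintro ⟨h | h | h, h'⟩
        exacts [Or.inl h, absurd h h', Or.inr h]
      · rintro (h | h)
        · exact ⟨Or.inl h, fun h' => hoP (h' ▸ h)⟩
        · exact ⟨Or.inr (Or.inr h), fun h' => ho (h' ▸ h)⟩
    rw [heq] at hbn
    have hI' : M.Indep (↑(P ∪ Q) : Set V) := heq ▸ hI.subset Set.sdiff_subset
    have hbE : b ∈ M.E := hD.subset_ground hb
    obtain ⟨h1, h2⟩ := (hI'.notMem_closure_iff hbE).1 hbn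
    have hbP : b ∉ P := fun h => h2 (by simp [h])
    have hbQ : b ∉ Q := fun h => h2 (by simp [h])
    obtain ⟨U, hU, hUP, hUI, hle⟩ := ih (fun v hv => hQ v (Finset.mem_insert_of_mem hv))
      (insert b P) (by
        rw [Finset.disjoint_insert_left]
        exact ⟨hbQ, hPQ.mono_right (Finset.subset_insert _ _)⟩) (by
        rw [Finset.insert_union, Finset.coe_insert]; exact h1)
    rw [Finset.disjoint_insert_right] at hUP
    refine ⟨insert b U, Finset.insert_subset hb.1 hU, ?_, ?_, ?_⟩
    · rw [Finset.disjoint_insert_left]; exact ⟨hbP, hUP.2⟩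
    · rwa [Finset.union_insert, ← Finset.insert_union]
    · rw [Finset.sum_insert ho, Finset.sum_insert hUP.1]
      exact add_le_add hb.2 hle

variable [Fintype V] {W : V → V → ℝ}

/-- The quadratic extension at a set plus a small vector on its complement. -/
theorem le_quadCover_ind_add (hsymm : ∀ u v, W u v = W v u) (hW : ∀ u v, 0 ≤ W u v)
    (P : Set V) (y : V → ℝ) (p : ℝ) (hy0 : ∀ v, 0 ≤ y v) (hyp : ∀ v, y v ≤ p)
    (hyP : ∀ v ∈ P, y v = 0) :
    pairCover W P + (2 - p) * (∑ u, ∑ v, W u v * (y u * (1 - ind P v))) ≤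
      quadCover W (ind P + y) := by
  have hsw : ∑ u, ∑ v, W u v * (y v * (1 - ind P u)) = ∑ u, ∑ v, W u v * (y u * (1 - ind P v)) := by
    rw [Finset.sum_comm]
    exact Finset.sum_congr rfl fun u _ => Finset.sum_congr rfl fun v _ => by rw [hsymm]
  have h2 : (2 - p) * (∑ u, ∑ v, W u v * (y u * (1 - ind P v))) =
      ∑ u, ∑ v, (W u v * (y v * (1 - ind P u)) + (1 - p) * (W u v * (y u * (1 - ind P v)))) := by
    simp only [Finset.sum_add_distrib, ← Finset.mul_sum]
    rw [hsw]; ring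
  rw [← quadCover_ind, h2]
  unfold quadCover
  simp only [← Finset.sum_add_distrib]
  refine Finset.sum_le_sum fun u _ => Finset.sum_le_sum fun v _ => ?_
  simp only [Pi.add_apply]
  -- Expanding gives the coverage of `P`, a cross term `y u * (1 - ind P v)`, its mirror image, and
  -- minus `y u * y v`. As `y` vanishes on `P`, this product costs at most a fraction `p` of one
  -- cross term.
  have key : y u * y v ≤ p * (y u * (1 - ind P v)) := by
    by_cases hv : v ∈ P
    · rw [hyP v hv, ind_of_mem hv]; simp
    · rw [ind_of_notMem hv]
      nlinarith [mul_nonneg (hy0 u) (sub_nonneg.2 (hyp v))]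
  nlinarith [mul_nonneg (hW u v) (sub_nonneg.2 key)]

/-- Since `y` vanishes on `P`, only pairs joining `P` to its complement contribute on the left; `P`
covers them, and they carry a factor of at most `p`. -/
theorem two_mul_sum_le_pairCover (hsymm : ∀ u v, W u v = W v u) (hW : ∀ u v, 0 ≤ W u v)
    (P : Set V) (y : V → ℝ) (p : ℝ) (hp : 0 ≤ p) (hyp : ∀ v, y v ≤ p)
    (hyP : ∀ v ∈ P, y v = 0) :
    2 * (∑ u, ∑ v, W u v * (y u * ind P v)) ≤ p * pairCover W P := by
  have hsw : ∑ u, ∑ v, W u v * (y v * ind P u) = ∑ u, ∑ v, W u v * (y u * ind P v) := by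
    rw [Finset.sum_comm]
    exact Finset.sum_congr rfl fun u _ => Finset.sum_congr rfl fun v _ => by rw [hsymm]
  rw [two_mul]
  nth_rewrite 1 [← hsw]
  rw [← quadCover_ind]
  unfold quadCover
  simp only [← Finset.sum_add_distrib, Finset.mul_sum]
  refine Finset.sum_le_sum fun u _ => Finset.sum_le_sum fun v _ => ?_
  have key : y v * ind P u + y u * ind P v ≤ p * (ind P u + ind P v - ind P u * ind P v) := by
    by_cases hu : u ∈ P <;> by_cases hv : v ∈ P
    · rw [hyP u hu, hyP v hv, ind_of_mem hu, ind_of_mem hv]; linarith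
    · rw [ind_of_mem hu, ind_of_notMem hv]; linarith [hyp v]
    · rw [ind_of_mem hv, ind_of_notMem hu]; linarith [hyp u]
    · rw [ind_of_notMem hu, ind_of_notMem hv]; linarith
  nlinarith [mul_nonneg (hW u v) (sub_nonneg.2 key)]

/-- A covered pair that misses `P` has an end in `Q`. The factor 2 is due to ordered pairs: either
the first or the second entry may be that end. -/
theorem pairCover_union_le [DecidableEq V] (hsymm : ∀ u v, W u v = W v u)
    (hW : ∀ u v, 0 ≤ W u v) (P Q : Finset V) :
    pairCover W (↑(P ∪ Q) : Set V) ≤ pairCover W (P : Set V) + 2 * ∑ v ∈ Q, ∑ u, W v u := by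
  have h1 : ∑ v ∈ Q, ∑ u, W v u = ∑ u, ∑ v, W u v * ind (Q : Set V) u := by
    rw [← Finset.sum_subset (Finset.subset_univ Q)]
    · refine Finset.sum_congr rfl fun u hu => Finset.sum_congr rfl fun v _ => ?_
      rw [ind_of_mem (Finset.mem_coe.2 hu), mul_one]
    · intro u _ hu
      exact Finset.sum_eq_zero fun v _ => by rw [ind_of_notMem (by simpa using hu), mul_zero]
  have h2 : ∑ v ∈ Q, ∑ u, W v u = ∑ u, ∑ v, W u v * ind (Q : Set V) v := by
    rw [h1, Finset.sum_comm]
    exact Finset.sum_congr rfl fun u _ => Finset.sum_congr rfl fun v _ => by rw [hsymm]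
  rw [two_mul]
  nth_rewrite 1 [h1]
  rw [h2]
  unfold pairCover
  simp only [← Finset.sum_add_distrib]
  refine Finset.sum_le_sum fun u _ => Finset.sum_le_sum fun v _ => ?_
  have := hW u v
  simp only [ind, Finset.coe_union, Set.mem_union, Finset.mem_coe]
  by_cases h1 : u ∈ P <;> by_cases h2 : v ∈ P <;> by_cases h3 : u ∈ Q <;> by_cases h4 : v ∈ Q <;>
    simp [h1, h2, h3, h4] <;> linarith

/-- If `V'` is made of `t` disjoint independent sets that span, by elements of large degree, all
other elements, then it contains a nearly optimal independent set. -/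
theorem Matroid.exists_approx [DecidableEq V] (M : Matroid V)
    (hsymm : ∀ u v, W u v = W v u) (hW : ∀ u v, 0 ≤ W u v) (hd : ∀ u, W u u = 0)
    {t : ℕ} (ht : 1 ≤ t) {ε : ℝ} (hε1 : t * ε ≤ 1) (hε2 : 1 < (t + 1) * ε) (B : ℕ → Finset V)
    (V' : Finset V) (hBV : ∀ j < t, B j ⊆ V') (hB : ∀ j < t, M.Indep (B j : Set V))
    (hdisj : ∀ i < t, ∀ j < t, i ≠ j → Disjoint (B i) (B j))
    (hgreedy : ∀ v ∉ V', ∀ j < t,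
      ¬ M.Indep (insert v {u | u ∈ B j ∧ ∑ x, W v x ≤ ∑ x, W u x}))
    (O : Finset V) (hO : M.Indep (O : Set V)) :
    ∃ S ⊆ V', M.Indep (S : Set V) ∧
      (1 - ε) * pairCover W (O : Set V) ≤ pairCover W (S : Set V) := by
  set deg : V → ℝ := fun v => ∑ x, W v x with hdeg
  set P := O ∩ V' with hP
  set Q := O \ V' with hQ
  have hPQ : P ∪ Q = O := by rw [hP, hQ]; ext v; simp; tauto
  have hdPQ : Disjoint P Q := by
    rw [Finset.disjoint_left]; intro v h1 h2; simp [hP, hQ] at h1 h2; exact h2.2 h1.2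
  -- Each bucket rejected all of `Q`, so each supplies its own substitute for `Q`, of no smaller
  -- total degree.
  have hex : ∀ j, ∃ U, j < t → U ⊆ B j ∧ Disjoint U P ∧ M.Indep (↑(P ∪ U) : Set V) ∧
      ∑ v ∈ Q, deg v ≤ ∑ v ∈ U, deg v := by
    intro j
    by_cases hj : j < t
    · obtain ⟨U, h⟩ := M.exists_replacement deg (B j) (hB j hj) Q
        (fun v hv => hgreedy v (by simp [hQ] at hv; exact hv.2) j hj) P hdPQ (hPQ ▸ hO)
      exact ⟨U, fun _ => h⟩
    · exact ⟨∅, fun h => absurd h hj⟩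
  choose U hU using hex
  have ht0 : (0 : ℝ) < t := by exact_mod_cast ht
  set p : ℝ := (t : ℝ)⁻¹ with hp
  have hp0 : 0 < p := inv_pos.2 ht0
  have hpt : t * p = 1 := mul_inv_cancel₀ ht0.ne'
  set y : V → ℝ := ∑ j ∈ Finset.range t, p • ind (U j : Set V) with hy
  have hyv : ∀ v, y v = ∑ j ∈ Finset.range t, p * ind (U j : Set V) v := by
    intro v; simp [hy]
  have hind0 : ∀ (S : Set V) v, 0 ≤ ind S v := by
    intro S v; unfold ind; split_ifs <;> simp
  have hy0 : ∀ v, 0 ≤ y v := fun v => by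
    rw [hyv]; exact Finset.sum_nonneg fun j _ => mul_nonneg hp0.le (hind0 _ _)
  -- This is where the disjointness of the buckets matters: a vertex belongs to at most one `U j`.
  have hyp : ∀ v, y v ≤ p := by
    intro v
    rw [hyv]
    by_cases hv : ∃ j < t, v ∈ U j
    · obtain ⟨j, hj, hvj⟩ := hv
      rw [Finset.sum_eq_single j]
      · rw [ind_of_mem (Finset.mem_coe.2 hvj), mul_one]
      · intro i hi hij
        rw [ind_of_notMem, mul_zero]
        intro hvi
        exact Finset.disjoint_left.1 (hdisj i (Finset.mem_range.1 hi) j hj hij)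
          ((hU i (Finset.mem_range.1 hi)).1 hvi) ((hU j hj).1 hvj)
      · intro h; exact absurd (Finset.mem_range.2 hj) h
    · push Not at hv
      rw [Finset.sum_eq_zero]
      · exact hp0.le
      · intro j hj
        rw [ind_of_notMem (by simpa using hv j (Finset.mem_range.1 hj)), mul_zero]
  have hyP : ∀ v ∈ (P : Set V), y v = 0 := by
    intro v hv
    rw [hyv]
    refine Finset.sum_eq_zero fun j hj => ?_
    rw [ind_of_notMem, mul_zero]
    exact fun h => Finset.disjoint_left.1 (hU j (Finset.mem_range.1 hj)).2.1 h hv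
  obtain ⟨C, hCV, hC, hle⟩ := M.exists_indep_quadCover_le hW hd (V' : Set V) ht
    (fun j => (↑(P ∪ U j) : Set V)) (fun j hj => (hU j hj).2.2.1) (by
      intro j hj
      refine Finset.coe_subset.2 (Finset.union_subset Finset.inter_subset_right ?_)
      exact (hU j hj).1.trans (hBV j hj))
  have hx : ∑ j ∈ Finset.range t, (t : ℝ)⁻¹ • ind (↑(P ∪ U j) : Set V) = ind (P : Set V) + y := by
    have : ∀ j ∈ Finset.range t, (t : ℝ)⁻¹ • ind (↑(P ∪ U j) : Set V) =
        p • ind (P : Set V) + p • ind (U j : Set V) := by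
      intro j hj
      rw [← smul_add]
      congr 1
      funext v
      have hdis := (hU j (Finset.mem_range.1 hj)).2.1
      rw [Pi.add_apply]
      by_cases h1 : v ∈ P
      · have h2 : v ∉ U j := fun h => Finset.disjoint_left.1 hdis h h1
        rw [ind_of_mem (by simp [h1]), ind_of_mem (by simpa using h1),
          ind_of_notMem (by simpa using h2), add_zero]
      · rw [ind_of_notMem (S := (P : Set V)) (by simpa using h1), zero_add]
        by_cases h2 : v ∈ U j
        · rw [ind_of_mem (by simp [h2]), ind_of_mem (by simpa using h2)]
        · rw [ind_of_notMem (by simp [h1, h2]), ind_of_notMem (by simpa using h2)]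
    rw [Finset.sum_congr rfl this, Finset.sum_add_distrib, Finset.sum_const, Finset.card_range,
      ← Nat.cast_smul_eq_nsmul ℝ, smul_smul, hpt, one_smul, hy]
  rw [hx] at hle
  set Y := ∑ u, ∑ v, W u v * (y u * (1 - ind (P : Set V) v)) with hY
  set X := ∑ u, ∑ v, W u v * (y u * ind (P : Set V) v) with hX
  -- The degree sum weighted by `y` is the average of the degree sums of the `U j`; `X` and `Y`
  -- split it according to whether the other end lies in `P`.
  have hXY : ∑ v ∈ Q, deg v ≤ X + Y := by
    have e1 : X + Y = ∑ u, y u * deg u := by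
      rw [hX, hY, ← Finset.sum_add_distrib]
      refine Finset.sum_congr rfl fun u _ => ?_
      rw [← Finset.sum_add_distrib, hdeg, Finset.mul_sum]
      exact Finset.sum_congr rfl fun v _ => by ring
    have e2 : ∑ u, y u * deg u = ∑ j ∈ Finset.range t, p * ∑ u ∈ U j, deg u := by
      simp only [hyv, Finset.sum_mul]
      rw [Finset.sum_comm]
      refine Finset.sum_congr rfl fun j _ => ?_
      rw [Finset.mul_sum, ← Finset.sum_subset (Finset.subset_univ (U j))]
      · exact Finset.sum_congr rfl fun u hu => by
          rw [ind_of_mem (Finset.mem_coe.2 hu), mul_one]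
      · intro u _ hu
        rw [ind_of_notMem (by simpa using hu)]; ring
    rw [e1, e2]
    calc ∑ v ∈ Q, deg v = ∑ j ∈ Finset.range t, p * ∑ v ∈ Q, deg v := by
          rw [Finset.sum_const, Finset.card_range, nsmul_eq_mul, ← mul_assoc, hpt, one_mul]
      _ ≤ _ := Finset.sum_le_sum fun j hj =>
          mul_le_mul_of_nonneg_left (hU j (Finset.mem_range.1 hj)).2.2.2 hp0.le
  have h1 := le_quadCover_ind_add hsymm hW (P : Set V) y p hy0 hyp hyP
  have h2 := two_mul_sum_le_pairCover hsymm hW (P : Set V) y p hp0.le hyp hyP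
  have h3 := pairCover_union_le hsymm hW P Q
  rw [hPQ] at h3
  have hY0 : 0 ≤ Y := Finset.sum_nonneg fun u _ => Finset.sum_nonneg fun v _ =>
    mul_nonneg (hW u v) (mul_nonneg (hy0 u) (by unfold ind; split_ifs <;> simp))
  have hG : 0 ≤ pairCover W (P : Set V) := Finset.sum_nonneg fun u _ => Finset.sum_nonneg fun v _ =>
    by split_ifs <;> simp [hW u v]
  refine ⟨(Set.toFinite C).toFinset, ?_, by simpa using hC, ?_⟩
  · intro v hv; exact hCV (by simpa using hv)
  rw [Set.Finite.coe_toFinset]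
  refine le_trans ?_ (h1.trans hle)
  have ht1 : (1 : ℝ) ≤ t := by exact_mod_cast ht
  have hε0 : 0 < ε := by
    by_contra h
    nlinarith
  have hεle : ε ≤ 1 := by nlinarith
  -- Multiplied by `t`, this reads (1 - ε)(t + 1) ≤ t, which is (t + 1)ε ≥ 1.
  have hA : (1 - ε) * (1 + p) ≤ 1 := by
    have : t * ((1 - ε) * (1 + p)) ≤ t * 1 := by
      have : t * ((1 - ε) * (1 + p)) = (1 - ε) * (t + t * p) := by ring
      rw [this, hpt]; nlinarith
    exact le_of_mul_le_mul_left this ht0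
  -- From 1 < (t + 1)ε ≤ 2tε. It makes the coefficient 2(1 - ε) of `Y` at most 2 - p.
  have hBp : p ≤ 2 * ε := by
    have : t * p ≤ t * (2 * ε) := by rw [hpt]; nlinarith
    exact le_of_mul_le_mul_left this ht0
  have h4 : pairCover W (O : Set V) ≤ (1 + p) * pairCover W (P : Set V) + 2 * Y := by
    have : ∑ v ∈ Q, ∑ u, W v u = ∑ v ∈ Q, deg v := rfl
    linarith
  change pairCover W (P : Set V) + (2 - p) * Y ≥ _
  nlinarith [mul_le_mul_of_nonneg_left h4 (sub_nonneg.2 hεle),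
    mul_nonneg hG (sub_nonneg.2 hA), mul_nonneg hY0 (sub_nonneg.2 hBp)]

end Analysis

/-! ### Counting small subsets. -/

/-- Give every subset `S` the weight t^(k - |S|), which is at least 1 if |S| ≤ k. Over all subsets
of `A` the weights sum to t^k (1 + 1/t)^|A| ≤ t^k e^k, and e < 4 ≤ t². For t = 1 the right side
would be 1, hence the restriction on `t`. -/
theorem card_small_subsets_le {α : Type*} [DecidableEq α] (A : Finset α) {t k : ℕ} (ht : 2 ≤ t)
    (hA : A.card ≤ t * k) :
    ((A.powerset.filter fun S => S.card ≤ k).card : ℝ) ≤ (t : ℝ) ^ (3 * k) := by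
  have ht0 : (0 : ℝ) < t := by exact_mod_cast (by omega : 0 < t)
  have ht2 : (2 : ℝ) ≤ t := by exact_mod_cast ht
  have h1 : ((A.powerset.filter fun S => S.card ≤ k).card : ℝ) ≤
      ∑ S ∈ A.powerset, (t : ℝ) ^ k * ((t : ℝ)⁻¹) ^ S.card := by
    rw [Finset.card_eq_sum_ones, Nat.cast_sum, Finset.sum_filter]
    refine Finset.sum_le_sum fun S _ => ?_
    split_ifs with h
    · rw [Nat.cast_one, inv_pow, ← div_eq_mul_inv, le_div_iff₀ (pow_pos ht0 _), one_mul]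
      exact pow_le_pow_right₀ (by linarith) h
    · positivity
  have h2 : ∑ S ∈ A.powerset, ((t : ℝ)⁻¹) ^ S.card = (1 + (t : ℝ)⁻¹) ^ A.card := by
    have := Finset.sum_pow_mul_eq_add_pow ((t : ℝ)⁻¹) 1 A
    simp only [one_pow, mul_one] at this
    rw [this, add_comm]
  rw [← Finset.mul_sum, h2] at h1
  have h3 : (1 + (t : ℝ)⁻¹) ^ A.card ≤ ((t : ℝ) ^ 2) ^ k := by
    calc (1 + (t : ℝ)⁻¹) ^ A.card ≤ (1 + (t : ℝ)⁻¹) ^ (t * k) :=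
          pow_le_pow_right₀ (by have := inv_pos.2 ht0; linarith) hA
      _ = ((1 + (t : ℝ)⁻¹) ^ t) ^ k := pow_mul _ _ _
      _ ≤ ((t : ℝ) ^ 2) ^ k := by
          refine pow_le_pow_left₀ (by positivity) ?_ _
          have h4 : 1 + (t : ℝ)⁻¹ ≤ Real.exp ((t : ℝ)⁻¹) := by
            have := Real.add_one_le_exp ((t : ℝ)⁻¹); linarith
          have h5 : (1 + (t : ℝ)⁻¹) ^ t ≤ Real.exp 1 := by
            calc (1 + (t : ℝ)⁻¹) ^ t ≤ Real.exp ((t : ℝ)⁻¹) ^ t :=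
                  pow_le_pow_left₀ (by positivity) h4 _
              _ = Real.exp 1 := by rw [← Real.exp_nat_mul, mul_inv_cancel₀ ht0.ne']
          have := Real.exp_one_lt_d9
          nlinarith
  calc _ ≤ (t : ℝ) ^ k * (1 + (t : ℝ)⁻¹) ^ A.card := h1
    _ ≤ (t : ℝ) ^ k * ((t : ℝ) ^ 2) ^ k := mul_le_mul_of_nonneg_left h3 (by positivity)
    _ = (t : ℝ) ^ (3 * k) := by rw [← pow_mul, ← pow_add]; congr 1; ring

/-! ### The weight matrix of an instance; the size of laminar families. -/

namespace CoverInstance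

open Classical in
/-- The weighted adjacency matrix. -/
noncomputable def wmat (I : CoverInstance) (u v : Fin I.n) : ℝ :=
  if I.graph.Adj u v then I.weight s(u, v) else 0

theorem wmat_symm (I : CoverInstance) (u v : Fin I.n) : I.wmat u v = I.wmat v u := by
  unfold wmat
  rw [Sym2.eq_swap, I.graph.adj_comm u v]

theorem wmat_nonneg (I : CoverInstance) (u v : Fin I.n) : 0 ≤ I.wmat u v := by
  unfold wmat
  split_ifs with h
  · exact I.weight_nonneg _ (I.graph.mem_edgeSet.2 h)
  · exact le_rfl

theorem wmat_self (I : CoverInstance) (u : Fin I.n) : I.wmat u u = 0 := by simp [wmat]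

/-- Every edge is counted as two ordered pairs, which the swap interchanges; the diagonal
contributes nothing. -/
theorem pairCover_eq (I : CoverInstance) (S : Finset (Fin I.n)) :
    pairCover I.wmat (S : Set (Fin I.n)) = 2 * I.cover S := by
  classical
  set p : Sym2 (Fin I.n) → ℝ := fun e =>
    if e ∈ I.graph.edgeSet ∧ ∃ v ∈ S, v ∈ e then I.weight e else 0 with hp
  have h0 : ∀ u v : Fin I.n, (if u ∈ (S : Set (Fin I.n)) ∨ v ∈ (S : Set (Fin I.n))
      then I.wmat u v else 0) = p s(u, v) := by
    intro u v
    have : (∃ x ∈ S, x ∈ s(u, v)) ↔ u ∈ S ∨ v ∈ S := by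
      simp only [Sym2.mem_iff]
      constructor
      · rintro ⟨x, h, rfl | rfl⟩ <;> simp [h]
      · rintro (h | h)
        exacts [⟨u, h, Or.inl rfl⟩, ⟨v, h, Or.inr rfl⟩]
    simp only [hp, wmat, SimpleGraph.mem_edgeSet, this, Finset.mem_coe]
    split_ifs <;> simp_all
  have hdiag : ∀ u, p s(u, u) = 0 := by intro u; simp [hp]
  have hcov : I.cover S = ∑ e : Sym2 (Fin I.n) with ¬ e.IsDiag, p e := by
    unfold cover
    rw [Finset.sum_filter, Finset.sum_filter]
    refine Finset.sum_congr rfl fun e _ => ?_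
    by_cases hd : e.IsDiag
    · have : e ∉ I.graph.edgeSet := fun h => I.graph.not_isDiag_of_mem_edgeSet h hd
      simp [hd, this]
    · simp [hd, hp]
  have hs := Finset.sum_sym2_filter_not_isDiag (Finset.univ : Finset (Fin I.n)) p
  rw [Finset.sym2_univ] at hs
  rw [hcov, hs]
  have hpc : pairCover I.wmat (S : Set (Fin I.n)) = ∑ u, ∑ v, p s(u, v) := by
    refine Finset.sum_congr rfl fun u _ => Finset.sum_congr rfl fun v _ => ?_
    rw [← h0]
    congr
  rw [hpc, ← Finset.sum_product']
  have hsplit : ∑ x ∈ (Finset.univ : Finset (Fin I.n)) ×ˢ Finset.univ, p s(x.1, x.2) =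
      ∑ x ∈ (Finset.univ : Finset (Fin I.n)).offDiag, p s(x.1, x.2) := by
    symm
    refine Finset.sum_subset (fun x _ => by simp) fun x _ hx => ?_
    have : x.1 = x.2 := by simpa using hx
    rw [this, hdiag]
  rw [hsplit, ← Finset.sum_filter_add_sum_filter_not _ (fun x : Fin I.n × Fin I.n => x.1 < x.2),
    two_mul]
  congr 1
  refine Finset.sum_nbij' (fun x => (x.2, x.1)) (fun x => (x.2, x.1)) ?_ ?_ ?_ ?_ ?_
  · intro x hx
    simp only [Finset.mem_filter, Finset.mem_offDiag, Finset.mem_univ, true_and] at hx ⊢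
    exact ⟨Ne.symm hx.1, lt_of_le_of_ne (not_lt.1 hx.2) (Ne.symm hx.1)⟩
  · intro x hx
    simp only [Finset.mem_filter, Finset.mem_offDiag, Finset.mem_univ, true_and] at hx ⊢
    exact ⟨Ne.symm hx.1, hx.2.le.not_gt⟩
  · intro x _; rfl
  · intro x _; rfl
  · intro x _; rw [Sym2.eq_swap]

theorem IsPartition.isLaminar {I : CoverInstance} (h : I.IsPartition) : I.IsLaminar := by
  refine ⟨fun i j hij => ?_, fun i j hij => Or.inl (h.2.1 i j hij), h.2.2.2⟩
  by_contra hne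
  have h1 := h.2.1 i j hne
  rw [← hij, disjoint_self] at h1
  exact (h.1 i).ne_empty h1

/-- A laminar family of distinct sets has at most quadratically many members. -/
theorem IsLaminar.r_le {I : CoverInstance} (h : I.IsLaminar) : I.r ≤ (I.n + 1) ^ 2 := by
  classical
  -- A member is encoded by its size and one of its elements. Members with a common element are
  -- nested, hence equal if their sizes agree; for the empty set the size alone decides.
  have hcode : ∀ i, ∃ c : Fin (I.n + 1) × Fin (I.n + 1), c.1.val = (I.F i).card ∧
      ((I.F i).Nonempty → ∃ v ∈ I.F i, c.2.val = v.val) := by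
    intro i
    have hc : (I.F i).card < I.n + 1 := by
      have := Finset.card_le_univ (I.F i)
      rw [Fintype.card_fin] at this; omega
    by_cases hne : (I.F i).Nonempty
    · obtain ⟨v, hv⟩ := hne
      exact ⟨(⟨_, hc⟩, ⟨v, by omega⟩), rfl, fun _ => ⟨v, hv, rfl⟩⟩
    · exact ⟨(⟨_, hc⟩, 0), rfl, fun h => absurd h hne⟩
  choose c hc1 hc2 using hcode
  have hinj : Function.Injective c := by
    intro i j hij
    by_contra hne
    have hcard : (I.F i).card = (I.F j).card := by rw [← hc1, ← hc1, hij]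
    refine hne (h.1 ?_)
    rcases (I.F i).eq_empty_or_nonempty with he | he
    · rw [he, Finset.card_empty] at hcard
      rw [he, Finset.card_eq_zero.1 hcard.symm]
    · obtain ⟨v, hv, hv'⟩ := hc2 i he
      obtain ⟨w, hw, hw'⟩ := hc2 j (Finset.card_pos.1 (hcard ▸ Finset.card_pos.2 he))
      have hvw : v = w := Fin.ext (by rw [← hv', ← hw', hij])
      rcases h.2.1 i j hne with hd | hs | hs
      · exact absurd (hvw ▸ hw) (Finset.disjoint_left.1 hd hv)
      · exact Finset.eq_of_subset_of_card_le hs hcard.ge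
      · exact (Finset.eq_of_subset_of_card_le hs hcard.le).symm
  have := Fintype.card_le_of_injective c hinj
  simp only [Fintype.card_prod, Fintype.card_fin] at this
  rw [sq]; exact this

end CoverInstance

/-! ### The interface between the algorithms and an independence test. -/

namespace CoverInstance

/-- The set of the vertices at which `f` is nonzero. -/
def ofFun (I : CoverInstance) (f : ℕ → ℕ) : Finset (Fin I.n) :=
  Finset.univ.filter fun v => f v ≠ 0

@[simp] theorem mem_ofFun {I : CoverInstance} {f : ℕ → ℕ} {v : Fin I.n} :
    v ∈ I.ofFun f ↔ f v ≠ 0 := by simp [ofFun]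

/-- The memory holds the description of the matroid. -/
structure Described (I : CoverInstance) (s : RamState) : Prop where
  n_eq : s.nvar 0 = I.n
  r_eq : s.nvar 1 = I.r
  fam_eq : s.narr 1 = (I.input 0).narr 1
  bound_eq : s.narr 2 = (I.input 0).narr 2

/-- A program that decides in at most `T` steps whether the set in the natural array `4` is
independent. -/
structure IsOracle (I : CoverInstance) (p : Prog) (T : ℕ) : Prop where
  -- The natural variables below 50 and the natural arrays below 20 are reserved for the calling
  -- programs; the verdict is left in the variable `50`.
  keeps_nvar : ∀ x < 50, p.Keeps (.nvar x)
  keeps_narr : ∀ a < 20, p.Keeps (.narr a)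
  keeps_rvar : ∀ x, p.Keeps (.rvar x)
  keeps_rarr : ∀ a, p.Keeps (.rarr a)
  spec : ∀ s, I.Described s →
    Ends p s T fun s' => s'.nvar 50 = 1 ↔ I.M.Indep (I.ofFun fun v => s.narr 4 v 0 : Set (Fin I.n))

theorem fam_ne_zero {I : CoverInstance} (i : Fin I.r) (v : Fin I.n) :
    (I.input 0).narr 1 i v ≠ 0 ↔ v ∈ I.F i := by
  simp [input]

theorem bound_eq' {I : CoverInstance} (i : Fin I.r) : (I.input 0).narr 2 i 0 = I.b i := by
  simp [input]

end CoverInstance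

open CoverInstance

/-! ### Independence test for matroids given by bounds. -/

/-- Does row `51` of the family contain at most as many elements of the set as its bound says? -/
def boundCount : Prog :=
  .seq (.setN 52 (.const 0)) (.upTo 53 0
    (.ite (.conj (.nlt (.const 0) (.get 4 (.var 53) (.const 0)))
        (.nlt (.const 0) (.get 1 (.var 51) (.var 53))))
      (.setN 52 (.add (.var 52) (.const 1))) .skip))

/-- Independence test for matroids given by bounds. -/
def boundsOracle : Prog :=
  .seq (.setN 50 (.const 1)) (.upTo 51 1 (.seq boundCount
    (.ite (.nle (.var 52) (.get 2 (.var 51) (.const 0))) .skip (.setN 50 (.const 0)))))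

theorem ends_boundCount {s : RamState} {n N : ℕ} (hn : s.nvar 0 = n) (hN : n ≤ N) :
    Ends boundCount s (N * 50 + 20) fun s' => s'.nvar 52 =
      ((Finset.range n).filter fun v => s.narr 4 v 0 ≠ 0 ∧ s.narr 1 (s.nvar 51) v ≠ 0).card := by
  refine Ends.setN_seq (by simp) (Ends.upTo (T := 40) (fun i s' => s'.nvar 52 =
    ((Finset.range i).filter fun v => s.narr 4 v 0 ≠ 0 ∧ s.narr 1 (s.nvar 51) v ≠ 0).card)
    (m := n) (by simpa using hn) hN (by simp) (by simp) (by simp) (fun i s v h => h) (by simp)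
    ?_ (by simp; omega) (fun s' _ h => h))
  intro i s' hi hF hx h
  have h4 : s'.narr 4 = s.narr 4 := hF.narr 4 (by simp)
  have h1 : s'.narr 1 = s.narr 1 := hF.narr 1 (by simp)
  have h51 : s'.nvar 51 = s.nvar 51 := hF.nvar 51 (by simp)
  refine Ends.ite (by simp) (fun hb => Ends.setN (by simp) ?_) (fun hb => Ends.skip (by simp) ?_)
  · simp [hx, h4, h1, h51] at hb
    simp [Finset.range_add_one, Finset.filter_insert, h, Nat.pos_iff_ne_zero.1 hb.1,
      Nat.pos_iff_ne_zero.1 hb.2]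
  · simp [hx, h4, h1, h51] at hb
    rw [h, Finset.range_add_one, Finset.filter_insert, if_neg]
    rintro ⟨h2, h3⟩
    exact h3 (hb (Nat.pos_of_ne_zero h2))

theorem card_filter_range_fin {n : ℕ} (p : ℕ → Prop) [DecidablePred p] :
    ((Finset.range n).filter p).card =
      (Finset.filter (fun v : Fin n => p v) Finset.univ).card := by
  rw [Finset.card_filter, Finset.card_filter, Finset.sum_range]

theorem isOracle_boundsOracle {I : CoverInstance} (hI : I.GivenByBounds) {N : ℕ} (hn : I.n ≤ N)
    (hr : I.r ≤ N) : I.IsOracle boundsOracle (N * (N * 50 + 60) + 20) where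
  keeps_nvar x hx := by simp [boundsOracle, boundCount]; omega
  keeps_narr a ha := by simp [boundsOracle, boundCount]
  keeps_rvar x := by simp [boundsOracle, boundCount]
  keeps_rarr a := by simp [boundsOracle, boundCount]
  spec s hs := by
    refine Ends.setN_seq (by simp) (Ends.upTo (T := N * 50 + 51) (fun i s' =>
      s'.nvar 50 = 1 ↔ ∀ j : Fin I.r, j.val < i →
        ((I.ofFun fun v => s.narr 4 v 0) ∩ I.F j).card ≤ I.b j)
      (m := I.r) (by simpa using hs.r_eq) hr (by simp) (by simp [boundCount])
      (by simp [boundCount])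
      (fun i s v h => h) (by simp) ?_ (by simp) (fun s' _ h => h.trans ?_))
    · intro i s' hi hF hx h
      have h4 : s'.narr 4 = s.narr 4 := hF.narr 4 (by simp [boundCount])
      have h1 : s'.narr 1 = (I.input 0).narr 1 :=
        (hF.narr 1 (by simp [boundCount])).trans hs.fam_eq
      have h2 : s'.narr 2 = (I.input 0).narr 2 :=
        (hF.narr 2 (by simp [boundCount])).trans hs.bound_eq
      have h0 : s'.nvar 0 = I.n := (hF.nvar 0 (by simp [boundCount])).trans hs.n_eq
      refine Ends.seq (N * 50 + 20) (by omega)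
        ((ends_boundCount h0 hn).mono le_rfl fun s'' hF' h52 => ?_)
      have e50 : s''.nvar 50 = s'.nvar 50 := hF'.nvar 50 (by simp [boundCount])
      have e51 : s''.nvar 51 = i := (hF'.nvar 51 (by simp [boundCount])).trans hx
      have e2 : s''.narr 2 = (I.input 0).narr 2 :=
        (hF'.narr 2 (by simp [boundCount])).trans h2
      have hcard : s''.nvar 52 = ((I.ofFun fun v => s.narr 4 v 0) ∩ I.F ⟨i, hi⟩).card := by
        rw [h52, card_filter_range_fin, h4, h1, hx]
        congr 1
        ext v
        have := fam_ne_zero ⟨i, hi⟩ v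
        simp only [] at this
        simp [this]
      have hb : (I.input 0).narr 2 i 0 = I.b ⟨i, hi⟩ := bound_eq' ⟨i, hi⟩
      refine Ends.ite (by simp) (fun hc => Ends.skip (by simp) ?_)
        (fun hc => Ends.setN (by simp) ?_)
      · simp only [BExp.holds, NExp.eval, e51, e2, hcard, hb] at hc
        rw [e50, h]
        refine ⟨fun g j hj => ?_, fun g j hj => g j (by omega)⟩
        rcases Nat.lt_succ_iff_lt_or_eq.1 hj with hj | hj
        · exact g j hj
        · have : j = ⟨i, hi⟩ := Fin.ext hj
          rw [this]; exact hc
      · simp only [BExp.holds, NExp.eval, e51, e2, hcard, hb] at hc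
        simp only [RamState.setNVar, NExp.eval, if_true]
        exact ⟨fun g => by omega, fun g => absurd (g ⟨i, hi⟩ (by simp)) hc⟩
    · rw [hI]
      exact ⟨fun g j => g j j.2, fun g j _ => g j⟩

/-! ### Independence test for transversal matroids: an auction for bipartite matching. -/

/-- The elements of `P` can be assigned injectively to indices below `r`, along `F`. -/
def Matchable (r : ℕ) (F : ℕ → ℕ → Prop) (P : ℕ → Prop) : Prop :=
  ∃ φ : ℕ → ℕ, (∀ u, P u → φ u < r ∧ F (φ u) u) ∧ ∀ u v, P u → P v → φ u = φ v → u = v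

theorem Matchable.mono {r : ℕ} {F : ℕ → ℕ → Prop} {P P' : ℕ → Prop} (h : Matchable r F P)
    (hP : ∀ u, P' u → P u) : Matchable r F P' := by
  obtain ⟨φ, h1, h2⟩ := h
  exact ⟨φ, fun u hu => h1 u (hP u hu), fun u v hu hv => h2 u v (hP u hu) (hP v hv)⟩

/-- A state of the auction algorithm for bipartite matching: index `i` has price `d i` and is owned
by the element `own i - 1` (by nobody if `own i = 0`); all elements of `P` own an index, except
`cur - 1` (if `cur ≠ 0`); prices are at most `L`. -/
structure Auction (r L : ℕ) (F : ℕ → ℕ → Prop) (P : ℕ → Prop) (d own : ℕ → ℕ) (cur : ℕ) :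
    Prop where
  -- The last inequality is the slackness condition of the auction: an owner holds an index that is,
  -- up to 1, the cheapest one open to it.
  own_spec : ∀ i < r, ∀ v, own i = v + 1 →
    P v ∧ F i v ∧ v + 1 ≠ cur ∧ 1 ≤ d i ∧ ∀ i' < r, F i' v → d i ≤ d i' + 1
  owned : ∀ i < r, 1 ≤ d i → own i ≠ 0
  inj : ∀ i < r, ∀ i' < r, own i = own i' → own i ≠ 0 → i = i'
  matched : ∀ v, P v → v + 1 = cur ∨ ∃ i < r, own i = v + 1
  bound : ∀ i < r, d i ≤ L
  cur_mem : ∀ v, cur = v + 1 → P v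

namespace Auction

variable {r L : ℕ} {F : ℕ → ℕ → Prop} {P : ℕ → Prop} {d own : ℕ → ℕ} {cur : ℕ}

theorem congr_set {P' : ℕ → Prop} (h : Auction r L F P d own cur) (hP : ∀ u, P u ↔ P' u) :
    Auction r L F P' d own cur := by
  have : P = P' := funext fun u => propext (hP u)
  exact this ▸ h

theorem init : Auction r L F (fun _ => False) (fun _ => 0) (fun _ => 0) 0 where
  own_spec i _ v h := by omega
  owned i _ h := by omega
  inj i _ i' _ _ h := absurd rfl h
  matched v h := h.elim
  bound i _ := by omega
  cur_mem v h := by omega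

theorem congr_fun {d' own' : ℕ → ℕ} (h : Auction r L F P d own cur) (hd : ∀ i < r, d' i = d i)
    (ho : ∀ i < r, own' i = own i) : Auction r L F P d' own' cur where
  own_spec i hi v hv := by
    rw [ho i hi] at hv
    obtain ⟨h1, h2, h3, h4, h5⟩ := h.own_spec i hi v hv
    refine ⟨h1, h2, h3, by rwa [hd i hi], fun i' hi' hF => ?_⟩
    rw [hd i hi, hd i' hi']
    exact h5 i' hi' hF
  owned i hi h' := by rw [hd i hi] at h'; rw [ho i hi]; exact h.owned i hi h'
  inj i hi i' hi' h1 h2 := by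
    rw [ho i hi] at h1 h2
    rw [ho i' hi'] at h1
    exact h.inj i hi i' hi' h1 h2
  matched v hv := (h.matched v hv).imp_right fun ⟨i, hi, h'⟩ => ⟨i, hi, by rw [ho i hi, h']⟩
  bound i hi := by rw [hd i hi]; exact h.bound i hi
  cur_mem := h.cur_mem

theorem start (h : Auction r L F P d own 0) {v : ℕ} (hv : ¬ P v) :
    Auction r L F (fun u => P u ∨ u = v) d own (v + 1) where
  own_spec i hi u hu := by
    obtain ⟨h1, h2, h3, h4, h5⟩ := h.own_spec i hi u hu
    exact ⟨Or.inl h1, h2, fun h => hv ((Nat.succ_injective h) ▸ h1), h4, h5⟩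
  owned := h.owned
  inj := h.inj
  matched u hu := by
    rcases hu with hu | rfl
    · rcases h.matched u hu with h' | h'
      · omega
      · exact Or.inr h'
    · exact Or.inl rfl
  bound := h.bound
  cur_mem u hu := Or.inr (by omega)

/-- The bidder takes a cheapest index open to it and raises the price by 1, so slackness holds for
it with error 1; other prices do not drop, so it survives for the other owners. The displaced owner
becomes the current element, and if there was none, `own i = 0` signals that everybody is served. -/
theorem step {v i : ℕ} (h : Auction r L F P d own (v + 1)) (hi : i < r) (hF : F i v)
    (hL : d i < L) (hmin : ∀ i' < r, F i' v → d i ≤ d i') :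
    Auction r L F P (fun j => if j = i then d j + 1 else d j)
      (fun j => if j = i then v + 1 else own j) (own i) where
  own_spec j hj u hu := by
    by_cases hji : j = i
    · subst hji
      simp only [if_true] at hu ⊢
      have huv : u = v := by omega
      subst huv
      refine ⟨h.cur_mem u rfl, hF, fun h' => (h.own_spec j hj u h'.symm).2.2.1 rfl, by omega, ?_⟩
      intro i' hi' hF'
      have := hmin i' hi' hF'
      split_ifs <;> omega
    · simp only [hji, if_false] at hu ⊢
      obtain ⟨h1, h2, h3, h4, h5⟩ := h.own_spec j hj u hu
      refine ⟨h1, h2, fun h' => hji (h.inj j hj i hi (hu.trans h') (by omega)), h4, ?_⟩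
      intro i' hi' hF'
      have := h5 i' hi' hF'
      split_ifs <;> omega
  owned j hj h' := by
    by_cases hji : j = i
    · simp [hji]
    · simp only [hji, if_false] at h' ⊢
      exact h.owned j hj h'
  inj j hj j' hj' h1 h2 := by
    by_cases hji : j = i <;> by_cases hji' : j' = i
    · omega
    · simp only [hji, hji', if_true, if_false] at h1
      exact absurd rfl (h.own_spec j' hj' v h1.symm).2.2.1
    · simp only [hji, hji', if_true, if_false] at h1
      exact absurd rfl (h.own_spec j hj v h1).2.2.1
    · simp only [hji, hji', if_false] at h1 h2
      exact h.inj j hj j' hj' h1 h2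
  matched u hu := by
    rcases h.matched u hu with h' | ⟨j, hj, h'⟩
    · exact Or.inr ⟨i, hi, by simp; omega⟩
    · by_cases hji : j = i
      · subst hji; exact Or.inl h'.symm
      · exact Or.inr ⟨j, hj, by simp [hji, h']⟩
  bound j hj := by
    have := h.bound j hj
    split_ifs with h'
    · subst h'; omega
    · exact this
  cur_mem u hu := (h.own_spec i hi u hu).1

theorem matchable (h : Auction r L F P d own 0) : Matchable r F P := by
  have : ∀ u, ∃ i, P u → i < r ∧ own i = u + 1 := by
    intro u
    by_cases hu : P u
    · rcases h.matched u hu with h' | ⟨i, hi, h'⟩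
      · omega
      · exact ⟨i, fun _ => ⟨hi, h'⟩⟩
    · exact ⟨0, fun h => absurd h hu⟩
  choose φ hφ using this
  refine ⟨φ, fun u hu => ⟨(hφ u hu).1, (h.own_spec _ (hφ u hu).1 u (hφ u hu).2).2.1⟩, ?_⟩
  intro u v hu hv huv
  have h1 := (hφ u hu).2
  have h2 := (hφ v hv).2
  rw [huv] at h1
  omega

/-- If all admissible prices of an element without an index exceed the number of indices, then Hall's
condition fails. -/
theorem not_matchable {v : ℕ} (h : Auction r (r + 2) F P d own (v + 1))
    (hv : ∀ i < r, F i v → r + 2 ≤ d i) : ¬ Matchable r F P := by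
  rintro ⟨φ, hφ, hinj⟩
  -- The `r` indices have at most `r` prices, so one of the `r + 1` levels 1, …, r + 1 is not a
  -- price. All indices priced above this gap are owned; their owners and `v` can be matched only to
  -- these indices, which are one too few.
  obtain ⟨l, hl, hl'⟩ : ∃ l ∈ Finset.Icc 1 (r + 1), l ∉ (Finset.range r).image d := by
    refine Finset.exists_mem_notMem_of_card_lt_card ?_
    have := Finset.card_image_le (s := Finset.range r) (f := d)
    rw [Finset.card_range] at this
    rw [Nat.card_Icc]; omega
  rw [Finset.mem_Icc] at hl
  have hne : ∀ i < r, d i ≠ l := fun i hi h' =>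
    hl' (Finset.mem_image.2 ⟨i, Finset.mem_range.2 hi, h'⟩)
  set Y := (Finset.range r).filter fun i => l < d i with hY
  have hYm : ∀ i, i ∈ Y ↔ i < r ∧ l < d i := by simp [hY]
  have hYo : ∀ i ∈ Y, own i = own i - 1 + 1 := by
    intro i hi
    have := h.owned i ((hYm i).1 hi).1 (by have := ((hYm i).1 hi).2; omega)
    omega
  set X := insert v (Y.image fun i => own i - 1) with hX
  have hcard : X.card = Y.card + 1 := by
    rw [hX, Finset.card_insert_of_notMem, Finset.card_image_of_injOn]
    · intro i hi i' hi' hii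
      have h1 := hYo i hi
      have h2 := hYo i' hi'
      simp only at hii
      exact h.inj i ((hYm i).1 hi).1 i' ((hYm i').1 hi').1 (by omega) (by omega)
    · intro hm
      obtain ⟨i, hi, hiv⟩ := Finset.mem_image.1 hm
      have h1 := hYo i hi
      rw [hiv] at h1
      exact (h.own_spec i ((hYm i).1 hi).1 v h1).2.2.1 rfl
  have hXP : ∀ u ∈ X, P u ∧ φ u ∈ Y := by
    intro u hu
    rw [hX, Finset.mem_insert, Finset.mem_image] at hu
    rcases hu with rfl | ⟨i, hi, rfl⟩
    · have hP := h.cur_mem u rfl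
      have h1 := hφ u hP
      refine ⟨hP, (hYm _).2 ⟨h1.1, ?_⟩⟩
      have := hv _ h1.1 h1.2
      omega
    · obtain ⟨g1, g2, g3, g4, g5⟩ := h.own_spec i ((hYm i).1 hi).1 _ (hYo i hi)
      have h1 := hφ _ g1
      refine ⟨g1, (hYm _).2 ⟨h1.1, ?_⟩⟩
      -- Slackness puts the price of `φ u` at `l` or more, and `l` itself is not a price.
      have h2 := g5 _ h1.1 h1.2
      have h3 := hne _ h1.1
      have h4 := ((hYm i).1 hi).2
      omega
  have := Finset.card_le_card_of_injOn φ (fun u hu => (hXP u hu).2)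
    (fun u hu w hw huw => hinj u w (hXP u hu).1 (hXP w hw).1 huw)
  omega

end Auction

/-- Finds the cheapest index for the element `cur - 1`. -/
def auctionPick : Prog :=
  .seq (.setN 57 (.const 0)) (.upTo 58 1
    (.ite (.conj (.nlt (.const 0) (.get 1 (.var 58) (.sub (.var 55) (.const 1))))
        (.disj (.neq (.var 57) (.const 0)) (.nlt (.get 20 (.var 58) (.const 0))
          (.get 20 (.sub (.var 57) (.const 1)) (.const 0)))))
      (.setN 57 (.add (.var 58) (.const 1))) .skip))

/-- One bid of the element `cur - 1`. -/
def auctionStep : Prog :=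
  .ite (.nlt (.const 0) (.var 55))
    (.seq auctionPick
      (.ite (.conj (.nlt (.const 0) (.var 57))
          (.nlt (.get 20 (.sub (.var 57) (.const 1)) (.const 0)) (.var 51)))
        (.seq (.setN 58 (.sub (.var 57) (.const 1)))
          (.seq (.setN 59 (.get 21 (.var 58) (.const 0)))
            (.seq (.setNA 21 (.var 58) (.const 0) (.var 55))
              (.seq (.setNA 20 (.var 58) (.const 0)
                  (.add (.get 20 (.var 58) (.const 0)) (.const 1)))
                (.setN 55 (.var 59))))))
        .skip))
    .skip

/-- Inserts the element `54` into the matching, if possible. -/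
def auctionInsert : Prog :=
  .ite (.conj (.nlt (.const 0) (.get 4 (.var 54) (.const 0))) (.neq (.var 50) (.const 1)))
    (.seq (.setN 55 (.add (.var 54) (.const 1)))
      (.seq (.upTo 56 52 auctionStep)
        (.ite (.nlt (.const 0) (.var 55)) (.setN 50 (.const 0)) .skip)))
    .skip

/-- Clears the auction and computes the price limit and the number of bids. -/
def auctionInit : Prog :=
  .seq (.upTo 58 1 (.seq (.setNA 20 (.var 58) (.const 0) (.const 0))
      (.setNA 21 (.var 58) (.const 0) (.const 0))))
    (.seq (.setN 51 (.add (.var 1) (.const 2)))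
      (.seq (.setN 52 (.const 1))
        (.seq (.upTo 53 1 (.setN 52 (.add (.var 52) (.var 51))))
          (.seq (.setN 55 (.const 0)) (.setN 50 (.const 1))))))

/-- Independence test for transversal matroids. -/
def transversalOracle : Prog := .seq auctionInit (.upTo 54 0 auctionInsert)

theorem ends_auctionPick {s : RamState} {r N v : ℕ} (hr : s.nvar 1 = r) (hN : r ≤ N)
    (hv : s.nvar 55 = v + 1) :
    Ends auctionPick s (N * 50 + 20) fun s' =>
      (s'.nvar 57 = 0 ∧ ∀ i < r, s.narr 1 i v = 0) ∨
      ∃ i < r, s'.nvar 57 = i + 1 ∧ s.narr 1 i v ≠ 0 ∧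
        ∀ i' < r, s.narr 1 i' v ≠ 0 → s.narr 20 i 0 ≤ s.narr 20 i' 0 := by
  refine Ends.setN_seq (by simp) (Ends.upTo (T := 40) (fun m s' =>
      (s'.nvar 57 = 0 ∧ ∀ i < m, s.narr 1 i v = 0) ∨
      ∃ i < m, s'.nvar 57 = i + 1 ∧ s.narr 1 i v ≠ 0 ∧
        ∀ i' < m, s.narr 1 i' v ≠ 0 → s.narr 20 i 0 ≤ s.narr 20 i' 0)
    (m := r) (by simpa using hr) hN (by simp) (by simp) (by simp) (fun i s v h => h) (by simp)
    ?_ (by simp; omega) (fun s' _ h => h))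
  intro i s' hi hF hx h
  have h1 : s'.narr 1 = s.narr 1 := hF.narr 1 (by simp)
  have h20 : s'.narr 20 = s.narr 20 := hF.narr 20 (by simp)
  have h55 : s'.nvar 55 = v + 1 := (hF.nvar 55 (by simp)).trans hv
  refine Ends.ite (by simp) (fun hb => Ends.setN (by simp) ?_) (fun hb => Ends.skip (by simp) ?_)
  · simp [hx, h1, h20, h55] at hb
    refine Or.inr ⟨i, by omega, by simp [hx], by omega, fun i' hi' hF' => ?_⟩
    rcases Nat.lt_succ_iff_lt_or_eq.1 hi' with hi' | rfl
    · rcases h with ⟨_, h⟩ | ⟨j, hj, hj57, hj1, hj2⟩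
      · exact absurd (h i' hi') hF'
      · have h3 := hj2 i' hi' hF'
        rcases hb.2 with h2 | h2
        · omega
        · rw [hj57, Nat.add_sub_cancel] at h2; omega
    · exact le_rfl
  · simp [hx, h1, h20, h55] at hb
    rcases h with ⟨h57, h⟩ | ⟨j, hj, hj57, hj1, hj2⟩
    · refine Or.inl ⟨h57, fun i' hi' => ?_⟩
      rcases Nat.lt_succ_iff_lt_or_eq.1 hi' with hi' | rfl
      · exact h i' hi'
      · by_contra hne
        exact (hb (Nat.pos_of_ne_zero hne)).1 h57
    · refine Or.inr ⟨j, by omega, hj57, hj1, fun i' hi' hF' => ?_⟩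
      rcases Nat.lt_succ_iff_lt_or_eq.1 hi' with hi' | rfl
      · exact hj2 i' hi' hF'
      · have := (hb (Nat.pos_of_ne_zero hF')).2
        rwa [hj57, Nat.add_sub_cancel] at this

/-- The memory holds a state of the auction. -/
def AuctionInv (fam : ℕ → ℕ → ℕ) (r : ℕ) (P : ℕ → Prop) (s : RamState) : Prop :=
  Auction r (r + 2) (fun i v => fam i v ≠ 0) P (fun i => s.narr 20 i 0) (fun i => s.narr 21 i 0)
    (s.nvar 55)

/-- The current element cannot bid within the price limit. -/
def AuctionStuck (fam : ℕ → ℕ → ℕ) (r : ℕ) (s : RamState) : Prop :=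
  s.nvar 55 ≠ 0 ∧ ∀ i < r, fam i (s.nvar 55 - 1) ≠ 0 → r + 2 ≤ s.narr 20 i 0

/-- The third alternative also records that the auction was neither finished nor stuck before. Hence
once finished or stuck it remains so, and until then every bid increases the sum of the prices by 1.
-/
theorem ends_auctionStep {s : RamState} {r N : ℕ} {fam : ℕ → ℕ → ℕ} {P : ℕ → Prop}
    (hr : s.nvar 1 = r) (hN : r ≤ N) (hfam : s.narr 1 = fam) (hL : s.nvar 51 = r + 2)
    (hA : AuctionInv fam r P s) :
    Ends auctionStep s (N * 50 + 90) fun s' => AuctionInv fam r P s' ∧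
      (s'.nvar 55 = 0 ∨ AuctionStuck fam r s' ∨ (s.nvar 55 ≠ 0 ∧ ¬ AuctionStuck fam r s ∧
        ∑ i ∈ Finset.range r, s'.narr 20 i 0 = ∑ i ∈ Finset.range r, s.narr 20 i 0 + 1)) := by
  refine Ends.ite (by simp) (fun hb => ?_) (fun hb => Ends.skip (by simp) ?_)
  · simp at hb
    obtain ⟨v, hv⟩ : ∃ v, s.nvar 55 = v + 1 := ⟨s.nvar 55 - 1, by omega⟩
    refine Ends.seq (N * 50 + 20) (by simp)
      ((ends_auctionPick hr hN hv).mono le_rfl fun s1 hF h => ?_)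
    have e1 : s1.narr 1 = fam := (hF.narr 1 (by simp [auctionPick])).trans hfam
    have e20 : s1.narr 20 = s.narr 20 := hF.narr 20 (by simp [auctionPick])
    have e21 : s1.narr 21 = s.narr 21 := hF.narr 21 (by simp [auctionPick])
    have e55 : s1.nvar 55 = s.nvar 55 := hF.nvar 55 (by simp [auctionPick])
    have e51 : s1.nvar 51 = r + 2 := (hF.nvar 51 (by simp [auctionPick])).trans hL
    refine Ends.ite (by simp) (fun hb => ?_)
      (fun hb => Ends.skip (by simp) ?_)
    · rcases h with ⟨h57, _⟩ | ⟨i, hi, h57, hi1, hi2⟩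
      · simp [h57] at hb
      simp [h57, e51, e20] at hb
      refine Ends.setN_seq (by simp) (Ends.setN_seq (by simp)
        (Ends.setNA_seq (by simp) (Ends.setNA_seq (by simp)
          (Ends.setN (by simp) ?_))))
      have hA' : Auction r (r + 2) (fun i v => fam i v ≠ 0) P (fun i => s.narr 20 i 0)
        (fun i => s.narr 21 i 0) (v + 1) := hv ▸ hA
      have hst := hA'.step hi (hfam ▸ hi1) hb (fun i' hi' hF' => hi2 i' hi' (hfam ▸ hF'))
      refine ⟨?_, Or.inr (Or.inr ⟨by omega, fun hs => ?_, ?_⟩)⟩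
      · unfold AuctionInv
        convert hst using 1
        · funext j
          simp [h57, e20]
          split_ifs with h <;> simp [h]
        · funext j
          simp [h57, e21, e55, hv]
        · simp [h57, e21]
      · have := hs.2 i hi (by rw [hv, ← hfam]; exact hi1)
        omega
      · simp [h57, e20]
        have : ∀ j ∈ Finset.range r, (if j = i then s.narr 20 i 0 + 1 else s.narr 20 j 0) =
            s.narr 20 j 0 + if j = i then 1 else 0 := by
          intro j _; split_ifs with h <;> simp [h]
        rw [Finset.sum_congr rfl this, Finset.sum_add_distrib]
        simp [hi]
    · refine ⟨?_, Or.inr (Or.inl ⟨by omega, fun i' hi' hF' => ?_⟩)⟩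
      · unfold AuctionInv at hA ⊢
        rwa [e20, e21, e55]
      · rw [e55, hv, Nat.add_sub_cancel, ← hfam] at hF'
        rcases h with ⟨_, h⟩ | ⟨i, hi, h57, hi1, hi2⟩
        · exact absurd (h i' hi') hF'
        · simp [h57, e51, e20] at hb
          rw [e20]
          exact hb.trans (hi2 i' hi' hF')
  · simp at hb
    exact ⟨hA, Or.inl hb⟩

/-- The prices never sum to more than r(r + 2), so after r(r + 2) + 1 rounds the auction is finished
or stuck, and in the latter case `Auction.not_matchable` applies. A set that cannot be matched stays
so when it grows, so a negative verdict is final. -/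
theorem ends_auctionInsert {s : RamState} {r N v : ℕ} {fam : ℕ → ℕ → ℕ} {c : ℕ → ℕ}
    (hr : s.nvar 1 = r) (hN : r ≤ N) (hfam : s.narr 1 = fam) (hL : s.nvar 51 = r + 2)
    (hR : s.nvar 52 = r * (r + 2) + 1) (hv : s.nvar 54 = v) (hc : ∀ u, s.narr 4 u 0 = c u)
    (h : (s.nvar 50 = 1 ∧ s.nvar 55 = 0 ∧ AuctionInv fam r (fun u => u < v ∧ c u ≠ 0) s) ∨
      (s.nvar 50 = 0 ∧ ¬ Matchable r (fun i v => fam i v ≠ 0) fun u => u < v ∧ c u ≠ 0)) :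
    Ends auctionInsert s ((N * (N + 2) + 1) * (N * 50 + 99) + 60) fun s' =>
      (s'.nvar 50 = 1 ∧ s'.nvar 55 = 0 ∧ AuctionInv fam r (fun u => u < v + 1 ∧ c u ≠ 0) s') ∨
      (s'.nvar 50 = 0 ∧
        ¬ Matchable r (fun i v => fam i v ≠ 0) fun u => u < v + 1 ∧ c u ≠ 0) := by
  refine Ends.ite (by simp) (fun hb => ?_) (fun hb => Ends.skip (by simp) ?_)
  · simp [hv, hc] at hb
    rcases h with ⟨h50, h55, hA⟩ | ⟨h50, _⟩
    swap
    · omega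
    have hA1 : Auction r (r + 2) (fun i v => fam i v ≠ 0) (fun u => u < v + 1 ∧ c u ≠ 0)
        (fun i => s.narr 20 i 0) (fun i => s.narr 21 i 0) (v + 1) := by
      unfold AuctionInv at hA
      rw [h55] at hA
      refine (hA.start (v := v) (by simp)).congr_set fun u => ?_
      constructor
      · rintro (h' | rfl)
        · exact ⟨by omega, h'.2⟩
        · exact ⟨by omega, by omega⟩
      · rintro ⟨h1, h2⟩
        rcases Nat.lt_succ_iff_lt_or_eq.1 h1 with h1 | h1
        exacts [Or.inl ⟨h1, h2⟩, Or.inr h1]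
    refine Ends.setN_seq (by simp) (Ends.seq ((N * (N + 2) + 1) * (N * 50 + 99) + 7)
      (by simp) (Ends.upTo (T := N * 50 + 90) (fun z s' =>
      AuctionInv fam r (fun u => u < v + 1 ∧ c u ≠ 0) s' ∧ (s'.nvar 55 = 0 ∨ AuctionStuck fam r s' ∨
        z ≤ ∑ i ∈ Finset.range r, s'.narr 20 i 0)) (M := N * (N + 2) + 1) (by simpa using hR)
      (by gcongr) (by simp) (by simp [auctionStep, auctionPick]) (by simp [auctionStep, auctionPick])
      (fun i s v h => h) ?_ ?_ (by simp) ?_))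
    · refine ⟨?_, Or.inr (Or.inr (Nat.zero_le _))⟩
      simpa [AuctionInv, hv] using hA1
    · intro z s' hz hF hx ⟨hA', hs'⟩
      refine (ends_auctionStep ((hF.nvar 1 (by simp [auctionStep, auctionPick])).trans
        (by simpa using hr)) hN ((hF.narr 1 (by simp [auctionStep, auctionPick])).trans
        (by simpa using hfam)) ((hF.nvar 51 (by simp [auctionStep, auctionPick])).trans
        (by simpa using hL)) hA').mono le_rfl fun s'' _ hs'' => ⟨hs''.1, ?_⟩
      rcases hs''.2 with h1 | h1 | ⟨h1, h2, h3⟩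
      · exact Or.inl h1
      · exact Or.inr (Or.inl h1)
      · rcases hs' with h4 | h4 | h4
        · exact absurd h4 h1
        · exact absurd h4 h2
        · exact Or.inr (Or.inr (by omega))
    · intro s' hF ⟨hA', hs'⟩
      have hsum : ∑ i ∈ Finset.range r, s'.narr 20 i 0 ≤ r * (r + 2) := by
        have := Finset.sum_le_card_nsmul (Finset.range r) (fun i => s'.narr 20 i 0) (r + 2)
          fun i hi => hA'.bound i (Finset.mem_range.1 hi)
        simpa using this
      have h50' : s'.nvar 50 = 1 := (hF.nvar 50 (by simp [auctionStep, auctionPick])).trans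
        (by simpa using h50)
      refine Ends.ite (by simp) (fun hb' => Ends.setN (by simp) ?_)
        (fun hb' => Ends.skip (by simp) ?_)
      · simp at hb'
        refine Or.inr ⟨by simp, ?_⟩
        rcases hs' with h1 | h1 | h1
        · omega
        · obtain ⟨w, hw⟩ : ∃ w, s'.nvar 55 = w + 1 := ⟨s'.nvar 55 - 1, by omega⟩
          unfold AuctionInv at hA'
          rw [hw] at hA'
          refine hA'.not_matchable fun i hi hFi => h1.2 i hi ?_
          rwa [hw]
        · omega
      · simp at hb'
        exact Or.inl ⟨h50', hb', hA'⟩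
  · simp [hv, hc] at hb
    rcases h with ⟨h50, h55, hA⟩ | ⟨h50, hM⟩
    · refine Or.inl ⟨h50, h55, ?_⟩
      have hcv : c v = 0 := by
        by_contra hne
        exact (hb (Nat.pos_of_ne_zero hne)) h50
      refine Auction.congr_set hA fun u => ⟨fun h' => ⟨by omega, h'.2⟩, fun h' => ⟨?_, h'.2⟩⟩
      rcases Nat.lt_succ_iff_lt_or_eq.1 h'.1 with h1 | rfl
      · exact h1
      · exact absurd hcv h'.2
    · exact Or.inr ⟨h50, fun h' => hM (h'.mono fun u hu => ⟨by omega, hu.2⟩)⟩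

/-- The number of rounds is built by repeated addition, the machine having no multiplication. Prices
and owners are cleared because the test is called many times. -/
theorem ends_auctionInit {s : RamState} {r N : ℕ} (hr : s.nvar 1 = r) (hN : r ≤ N) :
    Ends auctionInit s (N * 80 + 80) fun s' => s'.nvar 51 = r + 2 ∧
      s'.nvar 52 = r * (r + 2) + 1 ∧ s'.nvar 50 = 1 ∧ s'.nvar 55 = 0 ∧ ∀ i < r,
        s'.narr 20 i 0 = 0 ∧ s'.narr 21 i 0 = 0 := by
  refine Ends.seq (N * 40 + 10) (by omega) (Ends.upTo (T := 20) (fun m s' => ∀ i < m,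
    s'.narr 20 i 0 = 0 ∧ s'.narr 21 i 0 = 0) hr hN (by simp) (by simp) (by simp)
    (fun i s v h => h) (by simp) ?_ (by omega) ?_)
  · intro i s' hi hF hx h
    refine Ends.setNA_seq (by simp) (Ends.setNA (by simp) ?_)
    intro j hj
    by_cases hji : j = i
    · simp [hji, hx]
    · simp [hji, hx]
      exact h j (by omega)
  · intro s1 hF1 h1
    have hr1 : s1.nvar 1 = r := (hF1.nvar 1 (by simp)).trans hr
    refine Ends.setN_seq (by simp; omega) (Ends.setN_seq (by simp; omega)
      (Ends.seq (N * 30 + 10) (by simp; omega) (Ends.upTo (T := 10) (fun m s' =>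
        s'.nvar 52 = m * (r + 2) + 1) (m := r) (by simpa using hr1) hN (by simp) (by simp)
        (by simp) (fun i s v h => h) (by simp) ?_ (by omega) ?_)))
    · intro i s' hi hF hx h
      have e51 : s'.nvar 51 = r + 2 := by
        have := hF.nvar 51 (by simp)
        simp at this
        omega
      refine Ends.setN (by simp) ?_
      simp [h, e51]; ring
    · intro s2 hF2 h2
      have e51 : s2.nvar 51 = r + 2 := by
        have := hF2.nvar 51 (by simp)
        simp at this
        omega
      have e20 : s2.narr 20 = s1.narr 20 := (hF2.narr 20 (by simp))
      have e21 : s2.narr 21 = s1.narr 21 := (hF2.narr 21 (by simp))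
      refine Ends.setN_seq (by simp; omega) (Ends.setN (by simp; omega) ?_)
      refine ⟨by simp [e51], by simp [h2], by simp, by simp, fun i hi => ?_⟩
      simp [e20, e21, h1 i hi]

theorem matchable_iff_indep {I : CoverInstance} (hI : I.IsTransversal) (c : ℕ → ℕ) :
    Matchable I.r (fun i v => (I.input 0).narr 1 i v ≠ 0) (fun u => u < I.n ∧ c u ≠ 0) ↔
      I.M.Indep (I.ofFun c : Set (Fin I.n)) := by
  rw [hI]
  constructor
  · rintro ⟨φ, h1, h2⟩
    have hm : ∀ v : {v // v ∈ I.ofFun c}, v.1.val < I.n ∧ c v.1 ≠ 0 :=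
      fun v => ⟨v.1.2, mem_ofFun.1 v.2⟩
    refine ⟨fun v => ⟨φ v.1, (h1 _ (hm v)).1⟩, fun v w hvw => ?_, fun v => ?_⟩
    · exact Subtype.ext (Fin.ext (h2 _ _ (hm v) (hm w) (Fin.mk.inj hvw)))
    · exact (fam_ne_zero ⟨φ v.1, (h1 _ (hm v)).1⟩ v.1).1 (h1 _ (hm v)).2
  · rintro ⟨φ, h1, h2⟩
    refine ⟨fun u => if h : u < I.n ∧ c u ≠ 0 then φ ⟨⟨u, h.1⟩, mem_ofFun.2 h.2⟩ else 0,
      fun u hu => ?_, fun u v hu hv huv => ?_⟩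
    · simp only [dif_pos hu]
      exact ⟨Fin.is_lt _, (fam_ne_zero _ (⟨u, hu.1⟩ : Fin I.n)).2 (h2 _)⟩
    · simp only [dif_pos hu, dif_pos hv] at huv
      have := h1 (Fin.ext huv)
      simpa using this

theorem isOracle_transversalOracle {I : CoverInstance} (hI : I.IsTransversal) {N : ℕ}
    (hn : I.n ≤ N) (hr : I.r ≤ N) : I.IsOracle transversalOracle
      ((N * 80 + 80) + (N * ((N * (N + 2) + 1) * (N * 50 + 99) + 60 + 9) + 7)) where
  keeps_nvar x hx := by
    simp [transversalOracle, auctionInit, auctionInsert, auctionStep, auctionPick]; omega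
  keeps_narr a ha := by
    simp [transversalOracle, auctionInit, auctionInsert, auctionStep, auctionPick]; omega
  keeps_rvar x := by
    simp [transversalOracle, auctionInit, auctionInsert, auctionStep, auctionPick]
  keeps_rarr a := by
    simp [transversalOracle, auctionInit, auctionInsert, auctionStep, auctionPick]
  spec s hs := by
    set c : ℕ → ℕ := fun v => s.narr 4 v 0 with hc
    refine Ends.seq (N * 80 + 80) (by omega) ((ends_auctionInit hs.r_eq hr).mono le_rfl
      fun s1 hF1 ⟨h51, h52, h50, h55, h0⟩ => ?_)
    have hn1 : s1.nvar 0 = I.n := (hF1.nvar 0 (by simp [auctionInit])).trans hs.n_eq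
    have hr1 : s1.nvar 1 = I.r := (hF1.nvar 1 (by simp [auctionInit])).trans hs.r_eq
    have hf1 : s1.narr 1 = (I.input 0).narr 1 :=
      (hF1.narr 1 (by simp [auctionInit])).trans hs.fam_eq
    have hc1 : s1.narr 4 = s.narr 4 := hF1.narr 4 (by simp [auctionInit])
    refine Ends.upTo (T := (N * (N + 2) + 1) * (N * 50 + 99) + 60) (fun v s' =>
      (s'.nvar 50 = 1 ∧ s'.nvar 55 = 0 ∧
        AuctionInv ((I.input 0).narr 1) I.r (fun u => u < v ∧ c u ≠ 0) s') ∨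
      (s'.nvar 50 = 0 ∧
        ¬ Matchable I.r (fun i v => (I.input 0).narr 1 i v ≠ 0) fun u => u < v ∧ c u ≠ 0))
      hn1 hn (by simp) (by simp [auctionInsert, auctionStep, auctionPick])
      (by simp [auctionInsert, auctionStep, auctionPick]) (fun i s v h => h) ?_ ?_
      (by omega) ?_
    · refine Or.inl ⟨h50, h55, ?_⟩
      unfold AuctionInv
      rw [h55]
      refine (Auction.init.congr_fun (fun i hi => (h0 i hi).1) (fun i hi => (h0 i hi).2)).congr_set
        fun u => ?_
      simp
    · intro v s' hv hF hx h
      refine ends_auctionInsert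
        ((hF.nvar 1 (by simp [auctionInsert, auctionStep, auctionPick])).trans hr1) hr
        ((hF.narr 1 (by simp [auctionInsert, auctionStep, auctionPick])).trans hf1)
        ((hF.nvar 51 (by simp [auctionInsert, auctionStep, auctionPick])).trans h51)
        ((hF.nvar 52 (by simp [auctionInsert, auctionStep, auctionPick])).trans h52) hx
        (fun u => ?_) h
      rw [hF.narr 4 (by simp [auctionInsert, auctionStep, auctionPick]), hc1]
    · intro s' hF h
      rw [← matchable_iff_indep hI]
      rcases h with ⟨h1, h2, h3⟩ | ⟨h1, h2⟩
      · unfold AuctionInv at h3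
        rw [h2] at h3
        exact ⟨fun _ => h3.matchable, fun _ => h1⟩
      · exact ⟨fun h => by omega, fun h => absurd h h2⟩

/-! ### The invariant of the greedy first-fit filling. -/

namespace CoverInstance

variable {I : CoverInstance}

/-- The weighted degree. -/
noncomputable def wdeg (I : CoverInstance) (v : Fin I.n) : ℝ := ∑ u, I.wmat v u

theorem Described.framed {p : Prog} {s s' : RamState} (h : I.Described s) (hF : Framed p s s')
    (h0 : p.Keeps (.nvar 0)) (h1 : p.Keeps (.nvar 1)) (h2 : p.Keeps (.narr 1))
    (h3 : p.Keeps (.narr 2)) : I.Described s' :=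
  ⟨(hF.nvar 0 h0).trans h.n_eq, (hF.nvar 1 h1).trans h.r_eq, (hF.narr 1 h2).trans h.fam_eq,
    (hF.narr 2 h3).trans h.bound_eq⟩

theorem input_weight (ε : ℝ) (u v : Fin I.n) : (I.input ε).rarr 0 u v = I.wmat u v := by
  simp [input, wmat]

/-- Disjoint independent sets ("buckets"; `bk v = j + 1` if `v` is in the bucket `j < t`) that
are filled by first fit in the order of decreasing degree; `vis` marks the visited vertices. -/
structure Buckets (I : CoverInstance) (t : ℕ) (bk vis : ℕ → ℕ) : Prop where
  unvisited : ∀ v : Fin I.n, vis v = 0 → bk v = 0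
  le : ∀ v : Fin I.n, bk v ≤ t
  indep : ∀ j < t, I.M.Indep {v | bk v = j + 1}
  order : ∀ u v : Fin I.n, vis u ≠ 0 → vis v = 0 → I.wdeg v ≤ I.wdeg u
  greedy : ∀ v : Fin I.n, vis v ≠ 0 → bk v = 0 → ∀ j < t,
    ¬ I.M.Indep (insert v {u | bk u = j + 1 ∧ I.wdeg v ≤ I.wdeg u})

theorem Buckets.init {t : ℕ} {bk vis : ℕ → ℕ} (hbk : ∀ v, bk v = 0) (hvis : ∀ v, vis v = 0) :
    I.Buckets t bk vis where
  unvisited v _ := hbk v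
  le v := by rw [hbk]; exact Nat.zero_le _
  indep j _ := by
    have : {v : Fin I.n | bk v = j + 1} = ∅ := by ext v; simp [hbk]
    rw [this]; exact I.M.empty_indep
  order u v h := absurd (hvis u) h
  greedy v h := absurd (hvis v) h

/-- The state of the first-fit search for a bucket of the vertex `v`, after `m` attempts. -/
def Placed (I : CoverInstance) (bk bk' : ℕ → ℕ) (v : Fin I.n) (m : ℕ) : Prop :=
  ((∀ u : Fin I.n, bk' u = bk u) ∧
    ∀ j < m, ¬ I.M.Indep (insert v {u : Fin I.n | bk u = j + 1})) ∨
  ∃ j < m, I.M.Indep (insert v {u : Fin I.n | bk u = j + 1}) ∧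
    ∀ u : Fin I.n, bk' u = if u = v then j + 1 else bk u

/-- When a vertex is rejected, all members of the buckets have been visited before it and so have at
least its degree; the degree condition in `greedy` then excludes nobody. Afterwards the buckets only
grow, which preserves dependence. -/
theorem Buckets.place {t : ℕ} {bk vis bk' vis' : ℕ → ℕ} (h : I.Buckets t bk vis) {v : Fin I.n}
    (hv : vis v = 0) (hmax : ∀ u : Fin I.n, vis u = 0 → I.wdeg u ≤ I.wdeg v)
    (hvis : ∀ u : Fin I.n, vis' u = if u = v then 1 else vis u) (hp : I.Placed bk bk' v t) :
    I.Buckets t bk' vis' := by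
  have hbv : bk v = 0 := h.unvisited v hv
  have horder : ∀ u w : Fin I.n, vis' u ≠ 0 → vis' w = 0 → I.wdeg w ≤ I.wdeg u := by
    intro u w hu hw
    rw [hvis] at hu hw
    split_ifs at hw with hwv
    split_ifs at hu with huv
    · rw [huv]; exact hmax w hw
    · exact h.order u w hu hw
  rcases hp with ⟨hbk, hno⟩ | ⟨j, hj, hind, hbk⟩
  · refine ⟨fun u hu => ?_, fun u => ?_, fun j hj => ?_, horder, fun u hu hu0 j hj => ?_⟩
    · rw [hvis] at hu
      split_ifs at hu
      rw [hbk]; exact h.unvisited u hu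
    · rw [hbk]; exact h.le u
    · simp only [hbk]; exact h.indep j hj
    · simp only [hbk] at hu0 ⊢
      by_cases huv : u = v
      · subst huv
        intro hI
        refine hno j hj (hI.subset (Set.insert_subset_insert fun w hw => ⟨hw, ?_⟩))
        refine h.order w u (fun hw0 => ?_) hv
        have h1 := h.unvisited w hw0
        have h2 : bk w = j + 1 := hw
        omega
      · rw [hvis, if_neg huv] at hu
        exact h.greedy u hu hu0 j hj
  · refine ⟨fun u hu => ?_, fun u => ?_, fun i hi => ?_, horder, fun u hu hu0 i hi hI => ?_⟩
    · rw [hvis] at hu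
      split_ifs at hu with huv
      rw [hbk, if_neg huv]; exact h.unvisited u hu
    · rw [hbk]; split_ifs
      · omega
      · exact h.le u
    · by_cases hij : i = j
      · subst hij
        refine hind.subset fun u hu => ?_
        have h1 : bk' u = i + 1 := hu
        rw [hbk] at h1
        split_ifs at h1 with huv
        · exact Or.inl huv
        · exact Or.inr h1
      · refine (h.indep i hi).subset fun u hu => ?_
        have h1 : bk' u = i + 1 := hu
        rw [hbk] at h1
        split_ifs at h1 with huv
        · omega
        · exact h1
    · have huv : u ≠ v := by
        rintro rfl
        rw [hbk, if_pos rfl] at hu0; omega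
      rw [hvis, if_neg huv] at hu
      rw [hbk, if_neg huv] at hu0
      refine h.greedy u hu hu0 i hi (hI.subset (Set.insert_subset_insert fun w hw => ?_))
      have hw' : bk w = i + 1 ∧ I.wdeg u ≤ I.wdeg w := hw
      refine ⟨?_, hw'.2⟩
      rw [hbk, if_neg]
      · exact hw'.1
      · rintro rfl; omega

end CoverInstance

/-! ### The kernelization program and its correctness. -/

/-- Computes the weighted degrees. -/
def degreeProg : Prog :=
  .upTo 2 0 (.seq (.setRA 1 (.var 2) (.const 0) .zero) (.upTo 3 0
    (.setRA 1 (.var 2) (.const 0) (.add (.get 1 (.var 2) (.const 0)) (.get 0 (.var 2) (.var 3))))))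

/-- Computes the number of buckets. -/
def countProg : Prog :=
  .seq (.setN 4 (.const 0)) (.seq (.setR 1 (.var 0)) (.upTo 2 0
    (.seq (.ite (.rle (.var 1) .one) (.setN 4 (.add (.var 4) (.const 1))) .skip)
      (.setR 1 (.add (.var 1) (.var 0))))))

/-- Finds an unvisited vertex of maximum degree. -/
def maxProg : Prog :=
  .seq (.setN 5 (.const 0)) (.upTo 3 0
    (.ite (.conj (.neq (.get 6 (.var 3) (.const 0)) (.const 0))
        (.disj (.neq (.var 5) (.const 0)) (.rle (.get 1 (.sub (.var 5) (.const 1)) (.const 0))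
          (.get 1 (.var 3) (.const 0)))))
      (.setN 5 (.add (.var 3) (.const 1))) .skip))

/-- Writes the bucket `7`, together with the vertex `6`, into the natural array `4`. -/
def bucketProg : Prog :=
  .upTo 3 0 (.ite (.disj (.neq (.get 5 (.var 3) (.const 0)) (.add (.var 7) (.const 1)))
      (.neq (.var 3) (.var 6)))
    (.setNA 4 (.var 3) (.const 0) (.const 1)) (.setNA 4 (.var 3) (.const 0) (.const 0)))

/-- Puts the vertex `6` into the bucket `7` if it has not been placed and fits in there. -/
def tryProg (orc : Prog) : Prog :=
  .ite (.neq (.get 5 (.var 6) (.const 0)) (.const 0))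
    (.seq bucketProg (.seq orc (.ite (.neq (.var 50) (.const 1))
      (.setNA 5 (.var 6) (.const 0) (.add (.var 7) (.const 1))) .skip))) .skip

/-- Visits the next vertex. -/
def visitProg (orc : Prog) : Prog :=
  .seq maxProg (.seq (.setN 6 (.sub (.var 5) (.const 1)))
    (.seq (.setNA 6 (.var 6) (.const 0) (.const 1)) (.upTo 7 4 (tryProg orc))))

/-- Fills the buckets. -/
def fillProg (orc : Prog) : Prog :=
  .seq degreeProg (.seq countProg (.upTo 8 0 (visitProg orc)))

/-- The kernelization algorithm. -/
def kernelProg (orc : Prog) : Prog :=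
  .seq (fillProg orc) (.upTo 2 0 (.setNA 3 (.var 2) (.const 0) (.get 5 (.var 2) (.const 0))))

section Kernel

variable {I : CoverInstance} {N : ℕ}

theorem ends_degreeProg {s : RamState} {ε : ℝ} (hn : s.nvar 0 = I.n) (hN : I.n ≤ N)
    (hW : s.rarr 0 = (I.input ε).rarr 0) :
    Ends degreeProg s (N * (N * 30 + 40) + 10) fun s' => ∀ v : Fin I.n,
      s'.rarr 1 v 0 = I.wdeg v := by
  refine Ends.upTo (T := N * 30 + 20) (fun m s' => ∀ v : Fin I.n, v.val < m →
      s'.rarr 1 v 0 = I.wdeg v) hn hN (by simp) (by simp) (by simp) (fun i s v h => h) (by simp)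
    ?_ (by nlinarith) (fun s' _ h v => h v v.2)
  intro v s' hv hF hx h
  have hn' : s'.nvar 0 = I.n := (hF.nvar 0 (by simp)).trans hn
  have hW' : s'.rarr 0 = (I.input ε).rarr 0 := (hF.rarr 0 (by simp)).trans hW
  refine Ends.setRA_seq (by simp) (Ends.upTo (T := 20) (fun m s'' =>
      (∀ u : Fin I.n, u.val < v → s''.rarr 1 u 0 = I.wdeg u) ∧
      s''.rarr 1 v 0 = ∑ u ∈ Finset.range m, s'.rarr 0 v u)
    (by simpa using hn') hN (by simp) (by simp) (by simp) (fun i s v h => h) ?_ ?_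
    (by simp; omega) ?_)
  · refine ⟨fun u hu => ?_, by simp [hx]⟩
    have : u.val ≠ v := by omega
    simp [hx, this, h u hu]
  · intro u s'' hu hF' hx' ⟨h1, h2⟩
    have e2 : s''.nvar 2 = v := by
      have := hF'.nvar 2 (by simp)
      simpa [hx] using this
    have e0 : s''.rarr 0 = s'.rarr 0 := by
      have := hF'.rarr 0 (by simp)
      simpa using this
    refine Ends.setRA (by simp) ⟨fun w hw => ?_, ?_⟩
    · have : w.val ≠ v := by omega
      simp [e2, this, h1 w hw]
    · simp [e2, hx', h2, e0, Finset.sum_range_succ]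
  · intro s'' _ ⟨h1, h2⟩ w hw
    rcases Nat.lt_succ_iff_lt_or_eq.1 hw with hw | hw
    · exact h1 w hw
    · rw [hw, h2, hW', Finset.sum_range]
      refine Finset.sum_congr rfl fun u _ => ?_
      rw [← input_weight ε w u, hw]

/-- In the absence of division, the multiples ε, 2ε, …, nε are compared with 1, and the counter
becomes min(n, ⌊1/ε⌋). The cap `n` keeps the time polynomial for tiny ε. -/
theorem ends_countProg {s : RamState} {ε : ℝ} (hn : s.nvar 0 = I.n) (hN : I.n ≤ N)
    (hε : s.rvar 0 = ε) (hε0 : 0 < ε) :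
    Ends countProg s (N * 40 + 20) fun s' => s'.nvar 4 ≤ I.n ∧ s'.nvar 4 * ε ≤ 1 ∧
      (s'.nvar 4 < I.n → 1 < (s'.nvar 4 + 1) * ε) := by
  refine Ends.setN_seq (by simp) (Ends.setR_seq (by simp) (Ends.upTo (T := 30) (fun m s' =>
      s'.rvar 1 = (m + 1) * ε ∧ s'.nvar 4 ≤ m ∧ s'.nvar 4 * ε ≤ 1 ∧
      (s'.nvar 4 < m → 1 < (s'.nvar 4 + 1) * ε))
    (by simpa using hn) hN (by simp) (by simp) (by simp) (fun i s v h => h) (by simp [hε])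
    ?_ (by simp; omega) (fun s' _ h => h.2)))
  intro m s' hm hF hx ⟨h1, h2, h3, h4⟩
  have e0 : s'.rvar 0 = ε := by
    have := hF.rvar 0 (by simp)
    simpa [hε] using this
  refine Ends.seq 20 (by omega) (Ends.ite (by simp) (fun hb => Ends.setN (by simp) ?_)
    (fun hb => Ends.skip (by simp) ?_))
  · simp [h1] at hb
    -- If this multiple of ε is at most 1, so were all earlier ones, and the counter has never
    -- lagged behind.
    have heq : s'.nvar 4 = m := by
      by_contra hne
      have hlt : s'.nvar 4 < m := by omega
      have h5 := h4 hlt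
      have h6 : ((s'.nvar 4 : ℝ) + 1) ≤ m + 1 := by
        have : (s'.nvar 4 : ℝ) ≤ m := by exact_mod_cast h2
        linarith
      nlinarith [mul_le_mul_of_nonneg_right h6 hε0.le]
    refine Ends.setR (by simp) ?_
    simp [h1, e0, heq]
    exact ⟨by ring, hb⟩
  · simp [h1] at hb
    refine Ends.setR (by simp) ?_
    simp [h1, e0]
    refine ⟨by ring, by omega, h3, fun h5 => ?_⟩
    rcases h5.lt_or_eq with h6 | h6
    · exact h4 h6
    · rw [h6]; exact hb

theorem ends_maxProg {s : RamState} (hn : s.nvar 0 = I.n) (hN : I.n ≤ N)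
    (hd : ∀ v : Fin I.n, s.rarr 1 v 0 = I.wdeg v) (hex : ∃ v : Fin I.n, s.narr 6 v 0 = 0) :
    Ends maxProg s (N * 50 + 20) fun s' => ∃ v : Fin I.n, s'.nvar 5 = v + 1 ∧ s.narr 6 v 0 = 0 ∧
      ∀ u : Fin I.n, s.narr 6 u 0 = 0 → I.wdeg u ≤ I.wdeg v := by
  refine Ends.setN_seq (by simp) (Ends.upTo (T := 40) (fun m s' =>
      (s'.nvar 5 = 0 ∧ ∀ u : Fin I.n, u.val < m → s.narr 6 u 0 ≠ 0) ∨
      ∃ v : Fin I.n, s'.nvar 5 = v + 1 ∧ s.narr 6 v 0 = 0 ∧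
        ∀ u : Fin I.n, u.val < m → s.narr 6 u 0 = 0 → I.wdeg u ≤ I.wdeg v)
    (by simpa using hn) hN (by simp) (by simp) (by simp) (fun i s v h => h) (by simp)
    ?_ (by simp; omega) ?_)
  · intro m s' hm hF hx h
    have e6 : s'.narr 6 = s.narr 6 := hF.narr 6 (by simp)
    have e1 : s'.rarr 1 = s.rarr 1 := hF.rarr 1 (by simp)
    have hdm : s.rarr 1 m 0 = I.wdeg ⟨m, hm⟩ := hd ⟨m, hm⟩
    refine Ends.ite (by simp) (fun hb => Ends.setN (by simp) ?_) (fun hb => Ends.skip (by simp) ?_)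
    · simp [hx, e6, e1, hdm] at hb
      refine Or.inr ⟨⟨m, hm⟩, by simp [hx], hb.1, fun u hu hu0 => ?_⟩
      rcases Nat.lt_succ_iff_lt_or_eq.1 hu with hu | hu
      · rcases h with ⟨_, h⟩ | ⟨v, hv, _, h⟩
        · exact absurd hu0 (h u hu)
        · have h1 := h u hu hu0
          rw [hv, Nat.add_sub_cancel, hd] at hb
          rcases hb.2 with h2 | h2
          · omega
          · exact h1.trans h2
      · have : u = ⟨m, hm⟩ := Fin.ext hu
        rw [this]
    · simp [hx, e6, e1, hdm] at hb
      rcases h with ⟨h5, h⟩ | ⟨v, hv, hv0, h⟩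
      · refine Or.inl ⟨h5, fun u hu => ?_⟩
        rcases Nat.lt_succ_iff_lt_or_eq.1 hu with hu | hu
        · exact h u hu
        · intro h0
          rw [hu] at h0
          exact (hb h0).1 h5
      · refine Or.inr ⟨v, hv, hv0, fun u hu hu0 => ?_⟩
        rcases Nat.lt_succ_iff_lt_or_eq.1 hu with hu | hu
        · exact h u hu hu0
        · have : u = ⟨m, hm⟩ := Fin.ext hu
          rw [hu] at hu0
          have h2 := (hb hu0).2
          rw [hv, Nat.add_sub_cancel, hd] at h2
          rw [this]; exact h2.le
  · intro s' _ h
    rcases h with ⟨_, h⟩ | ⟨v, hv, hv0, h⟩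
    · obtain ⟨v, hv⟩ := hex
      exact absurd hv (h v v.2)
    · exact ⟨v, hv, hv0, fun u hu => h u u.2 hu⟩

theorem ends_bucketProg {s : RamState} (hn : s.nvar 0 = I.n) (hN : I.n ≤ N) :
    Ends bucketProg s (N * 50 + 20) fun s' => ∀ u : Fin I.n,
      s'.narr 4 u 0 ≠ 0 ↔ s.narr 5 u 0 = s.nvar 7 + 1 ∨ u.val = s.nvar 6 := by
  refine Ends.upTo (T := 40) (fun m s' => ∀ u : Fin I.n, u.val < m →
      (s'.narr 4 u 0 ≠ 0 ↔ s.narr 5 u 0 = s.nvar 7 + 1 ∨ u.val = s.nvar 6))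
    hn hN (by simp) (by simp) (by simp) (fun i s v h => h) (by simp)
    ?_ (by omega) (fun s' _ h u => h u u.2)
  intro m s' hm hF hx h
  have e5 : s'.narr 5 = s.narr 5 := hF.narr 5 (by simp)
  have e6 : s'.nvar 6 = s.nvar 6 := hF.nvar 6 (by simp)
  have e7 : s'.nvar 7 = s.nvar 7 := hF.nvar 7 (by simp)
  refine Ends.ite (by simp) (fun hb => Ends.setNA (by simp) ?_)
    (fun hb => Ends.setNA (by simp) ?_) <;> simp [hx, e5, e6, e7] at hb <;> intro u hu <;>
    rcases Nat.lt_succ_iff_lt_or_eq.1 hu with hu | hu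
  · have : u.val ≠ m := by omega
    simpa [hx, this] using h u hu
  · simp [hx, hu]; omega
  · have : u.val ≠ m := by omega
    simpa [hx, this] using h u hu
  · simp [hx, hu]; omega

end Kernel

section Kernel

variable {I : CoverInstance} {N T : ℕ} {orc : Prog}

theorem ends_tryProg (hO : I.IsOracle orc T) {s : RamState} (hs : I.Described s) (hN : I.n ≤ N)
    {v : Fin I.n} {m : ℕ} {bk : ℕ → ℕ} (hv : s.nvar 6 = v) (hm : s.nvar 7 = m) (hbv : bk v = 0)
    (h : I.Placed bk (fun u => s.narr 5 u 0) v m) :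
    Ends (tryProg orc) s (T + N * 50 + 70) fun s' =>
      I.Placed bk (fun u => s'.narr 5 u 0) v (m + 1) := by
  refine Ends.ite (by simp) (fun hb => ?_) (fun hb => Ends.skip (by simp) ?_)
  · simp [hv] at hb
    rcases h with ⟨h1, h2⟩ | ⟨j, hj, _, h2⟩
    swap
    · have := h2 v
      simp [hb] at this
    have h1' : ∀ u : Fin I.n, s.narr 5 u 0 = bk u := h1
    refine Ends.seq (N * 50 + 20) (by simp; omega)
      ((ends_bucketProg hs.n_eq hN).mono le_rfl fun s1 hF1 h4 => ?_)
    refine Ends.seq T (by simp; omega) ((hO.spec s1 (hs.framed hF1 (by simp [bucketProg])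
      (by simp [bucketProg]) (by simp [bucketProg]) (by simp [bucketProg]))).mono le_rfl
      fun s2 hF2 h50 => ?_)
    have hset : (I.ofFun (fun v => s1.narr 4 v 0) : Set (Fin I.n)) =
        insert v {u : Fin I.n | bk u = m + 1} := by
      ext u
      have := h4 u
      rw [hv, hm, h1' u, Fin.val_inj] at this
      simp [this, or_comm]
    rw [hset] at h50
    have e5 : s2.narr 5 = s.narr 5 := (hF2.narr 5 (hO.keeps_narr 5 (by norm_num))).trans
      (hF1.narr 5 (by simp [bucketProg]))
    have e6 : s2.nvar 6 = v := ((hF2.nvar 6 (hO.keeps_nvar 6 (by norm_num))).trans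
      (hF1.nvar 6 (by simp [bucketProg]))).trans hv
    have e7 : s2.nvar 7 = m := ((hF2.nvar 7 (hO.keeps_nvar 7 (by norm_num))).trans
      (hF1.nvar 7 (by simp [bucketProg]))).trans hm
    refine Ends.ite (by simp; omega) (fun hb => Ends.setNA (by simp; omega) ?_)
      (fun hb => Ends.skip (by simp; omega) ?_)
    · simp at hb
      refine Or.inr ⟨m, by omega, h50.1 hb, fun u => ?_⟩
      simp [e6, e7, e5, Fin.val_inj, h1']
    · simp at hb
      refine Or.inl ⟨fun u => by rw [e5]; exact h1 u, fun j hj => ?_⟩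
      rcases Nat.lt_succ_iff_lt_or_eq.1 hj with hj | rfl
      · exact h2 j hj
      · exact fun h => hb (h50.2 h)
  · simp [hv] at hb
    rcases h with ⟨h1, h2⟩ | ⟨j, hj, h1, h2⟩
    · exact absurd ((h1 v).trans hbv) hb
    · exact Or.inr ⟨j, by omega, h1, h2⟩

theorem ends_visitProg (hO : I.IsOracle orc T) {s : RamState} (hs : I.Described s) (hN : I.n ≤ N)
    (hd : ∀ v : Fin I.n, s.rarr 1 v 0 = I.wdeg v) (hex : ∃ v : Fin I.n, s.narr 6 v 0 = 0) {t : ℕ}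
    (ht : s.nvar 4 = t) (htN : t ≤ N)
    (hB : I.Buckets t (fun v => s.narr 5 v 0) (fun v => s.narr 6 v 0)) :
    Ends (visitProg orc) s (N * 50 + N * (T + N * 50 + 70 + 9) + 60) fun s' =>
      I.Buckets t (fun v => s'.narr 5 v 0) (fun v => s'.narr 6 v 0) ∧
      ∃ v : Fin I.n, s.narr 6 v 0 = 0 ∧ ∀ u : Fin I.n, s'.narr 6 u 0 =
        if u = v then 1 else s.narr 6 u 0 := by
  refine Ends.seq (N * 50 + 20) (by omega) ((ends_maxProg hs.n_eq hN hd hex).mono le_rfl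
    fun s1 hF1 ⟨v, hv, hv0, hmax⟩ => ?_)
  have hs1 := hs.framed hF1 (by simp [maxProg]) (by simp [maxProg]) (by simp [maxProg])
    (by simp [maxProg])
  have e5 : s1.narr 5 = s.narr 5 := hF1.narr 5 (by simp [maxProg])
  have e6 : s1.narr 6 = s.narr 6 := hF1.narr 6 (by simp [maxProg])
  have e4 : s1.nvar 4 = t := (hF1.nvar 4 (by simp [maxProg])).trans ht
  have hbv : s.narr 5 v 0 = 0 := hB.unvisited v hv0
  refine Ends.setN_seq (by simp; omega) (Ends.setNA_seq (by simp; omega)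
    (Ends.upTo (T := T + N * 50 + 70) (fun m s' =>
      I.Placed (fun u => s.narr 5 u 0) (fun u => s'.narr 5 u 0) v m) (by simpa using e4) htN
      (by simp) ?_ ?_ (fun i s v h => h) ?_ ?_ (by simp; omega) ?_))
  · simp [tryProg, bucketProg, hO.keeps_nvar]
  · simp [tryProg, bucketProg, hO.keeps_nvar]
  · exact Or.inl ⟨fun u => by simp [e5], fun j hj => by omega⟩
  · intro m s' hm hF hx h
    have k (x : ℕ) (hx : x < 50 ∧ x ≠ 3 ∧ x ≠ 7) :
        (Prog.upTo 7 4 (tryProg orc)).Keeps (.nvar x) := by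
      simp [tryProg, bucketProg, hO.keeps_nvar x hx.1, hx.2]
    have k' (x : ℕ) (hx : x < 20 ∧ x ≠ 4 ∧ x ≠ 5) :
        (Prog.upTo 7 4 (tryProg orc)).Keeps (.narr x) := by
      simp [tryProg, bucketProg, hO.keeps_narr x hx.1, hx.2]
    have g0 := hF.nvar 0 (k 0 (by simp))
    have g1 := hF.nvar 1 (k 1 (by simp))
    have g6 := hF.nvar 6 (k 6 (by simp))
    have g2 := hF.narr 1 (k' 1 (by simp))
    have g3 := hF.narr 2 (k' 2 (by simp))
    simp [hv] at g0 g1 g2 g3 g6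
    exact ends_tryProg hO ⟨g0.trans hs1.n_eq, g1.trans hs1.r_eq, g2.trans hs1.fam_eq,
      g3.trans hs1.bound_eq⟩ hN g6 hx hbv h
  · intro s' hF h
    have g6 := hF.narr 6 (by simp [tryProg, bucketProg, hO.keeps_narr])
    have hvis : ∀ u : Fin I.n, s'.narr 6 u 0 = if u = v then 1 else s.narr 6 u 0 := by
      intro u
      rw [g6]
      simp [hv, e6, Fin.val_inj]
    exact ⟨hB.place hv0 hmax hvis h, v, hv0, hvis⟩

/-- What the kernelization algorithm computes: the number `t` of buckets and the buckets. -/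
structure IsFilled (I : CoverInstance) (ε : ℝ) (t : ℕ) (bk : ℕ → ℕ) : Prop where
  t_le : t ≤ I.n
  t_mul : t * ε ≤ 1
  lt_t : t < I.n → 1 < (t + 1) * ε
  le : ∀ v : Fin I.n, bk v ≤ t
  indep : ∀ j < t, I.M.Indep {v | bk v = j + 1}
  greedy : ∀ v : Fin I.n, bk v = 0 → ∀ j < t,
    ¬ I.M.Indep (insert v {u | bk u = j + 1 ∧ I.wdeg v ≤ I.wdeg u})

theorem ends_fillProg (hO : I.IsOracle orc T) (hN : I.n ≤ N) {ε : ℝ} (hε : 0 < ε) :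
    Ends (fillProg orc) (I.input ε) (N * (N * 30 + 40) + N * 40 + 30 +
      (N * (N * 50 + N * (T + N * 50 + 70 + 9) + 60 + 9) + 7)) fun s' =>
      IsFilled I ε (s'.nvar 4) (fun v => s'.narr 5 v 0) := by
  refine Ends.seq (N * (N * 30 + 40) + 10) (by omega) ((ends_degreeProg (by simp [input]) hN
    rfl).mono le_rfl fun s1 hF1 hd => ?_)
  refine Ends.seq (N * 40 + 20) (by omega) ((ends_countProg (I := I) (ε := ε)
    ((hF1.nvar 0 (by simp [degreeProg])).trans (by simp [input])) hN
    ((hF1.rvar 0 (by simp [degreeProg])).trans (by simp [input])) hε).mono le_rfl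
    fun s2 hF2 ht => ?_)
  have hs2 : I.Described s2 := by
    constructor
    · rw [hF2.nvar 0 (by simp [countProg]), hF1.nvar 0 (by simp [degreeProg])]; simp [input]
    · rw [hF2.nvar 1 (by simp [countProg]), hF1.nvar 1 (by simp [degreeProg])]; simp [input]
    · rw [hF2.narr 1 (by simp [countProg]), hF1.narr 1 (by simp [degreeProg])]; rfl
    · rw [hF2.narr 2 (by simp [countProg]), hF1.narr 2 (by simp [degreeProg])]; rfl
  have hd2 : s2.rarr 1 = s1.rarr 1 := hF2.rarr 1 (by simp [countProg])
  have k (x : ℕ) (hx : x < 50 ∧ x ≠ 3 ∧ x ≠ 5 ∧ x ≠ 6 ∧ x ≠ 7 ∧ x ≠ 8) :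
      (Prog.upTo 8 0 (visitProg orc)).Keeps (.nvar x) := by
    simp [visitProg, maxProg, tryProg, bucketProg, hO.keeps_nvar x hx.1, hx.2]
  have k' (x : ℕ) (hx : x < 20 ∧ x ≠ 4 ∧ x ≠ 5 ∧ x ≠ 6) :
      (Prog.upTo 8 0 (visitProg orc)).Keeps (.narr x) := by
    simp [visitProg, maxProg, tryProg, bucketProg, hO.keeps_narr x hx.1, hx.2]
  -- Counting the visited vertices guarantees an unvisited one in each round, and that none is left
  -- after `n` rounds.
  refine Ends.upTo (T := N * 50 + N * (T + N * 50 + 70 + 9) + 60) (fun m s' =>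
    I.Buckets (s2.nvar 4) (fun v => s'.narr 5 v 0) (fun v => s'.narr 6 v 0) ∧
    (Finset.univ.filter fun v : Fin I.n => s'.narr 6 v 0 ≠ 0).card = m)
    hs2.n_eq hN (by simp) ?_ ?_ (fun i s v h => h) ?_ ?_ (by omega) ?_
  · simp [visitProg, maxProg, tryProg, bucketProg, hO.keeps_nvar]
  · simp [visitProg, maxProg, tryProg, bucketProg, hO.keeps_nvar]
  · have e5 : s2.narr 5 = fun _ _ => 0 := by
      rw [hF2.narr 5 (by simp [countProg]), hF1.narr 5 (by simp [degreeProg])]; rfl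
    have e6 : s2.narr 6 = fun _ _ => 0 := by
      rw [hF2.narr 6 (by simp [countProg]), hF1.narr 6 (by simp [degreeProg])]; rfl
    exact ⟨Buckets.init (fun v => by rw [e5]) (fun v => by rw [e6]), by simp [e6]⟩
  · intro m s' hm hF hx ⟨hB, hcard⟩
    have hex : ∃ v : Fin I.n, s'.narr 6 v 0 = 0 := by
      by_contra! hne
      rw [Finset.filter_true_of_mem fun v _ => hne v, Finset.card_univ, Fintype.card_fin] at hcard
      omega
    have h4 : s'.nvar 4 = s2.nvar 4 := hF.nvar 4 (k 4 (by simp))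
    have hrd : s'.rarr 1 = s2.rarr 1 := hF.rarr 1 (by
      simp [visitProg, maxProg, tryProg, bucketProg, hO.keeps_rarr])
    refine (ends_visitProg hO (hs2.framed hF (k 0 (by simp)) (k 1 (by simp)) (k' 1 (by simp))
      (k' 2 (by simp))) hN (fun v => by rw [hrd, hd2, hd]) hex h4 (by omega) hB).mono le_rfl
      fun s'' _ ⟨hB', v, hv0, hvis⟩ => ⟨hB', ?_⟩
    rw [← hcard]
    have : (Finset.univ.filter fun u : Fin I.n => s''.narr 6 u 0 ≠ 0) =
        insert v (Finset.univ.filter fun u : Fin I.n => s'.narr 6 u 0 ≠ 0) := by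
      ext u
      simp only [Finset.mem_filter, Finset.mem_univ, true_and, Finset.mem_insert, hvis]
      split_ifs with h <;> simp [h]
    rw [this, Finset.card_insert_of_notMem (by simp [hv0])]
  · intro s' hF ⟨hB, hcard⟩
    have h4 : s'.nvar 4 = s2.nvar 4 := hF.nvar 4 (k 4 (by simp))
    rw [h4]
    have hall : ∀ v : Fin I.n, s'.narr 6 v 0 ≠ 0 := by
      have := Finset.eq_univ_of_card _ (hcard.trans (Fintype.card_fin I.n).symm)
      intro v
      have hv := Finset.mem_univ v
      rw [← this] at hv
      exact (Finset.mem_filter.1 hv).2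
    exact ⟨ht.1, ht.2.1, ht.2.2, hB.le, hB.indep, fun v hv => hB.greedy v (hall v) hv⟩

theorem ends_copyBuckets {s : RamState} (hn : s.nvar 0 = I.n) (hN : I.n ≤ N) :
    Ends (.upTo 2 0 (.setNA 3 (.var 2) (.const 0) (.get 5 (.var 2) (.const 0)))) s
      (N * 20 + 10) fun s' => I.output s' = I.ofFun fun v => s.narr 5 v 0 := by
  refine Ends.upTo (T := 10) (fun m s' => ∀ v : Fin I.n, v.val < m →
      s'.narr 3 v 0 = s.narr 5 v 0)
    hn hN (by simp) (by simp) (by simp) (fun i s v h => h) (by simp) ?_ (by omega) ?_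
  · intro m s' hm hF hx h
    have e5 : s'.narr 5 = s.narr 5 := hF.narr 5 (by simp)
    refine Ends.setNA (by simp) fun v hv => ?_
    rcases Nat.lt_succ_iff_lt_or_eq.1 hv with hv | hv
    · have : v.val ≠ m := by omega
      simp [hx, this, h v hv]
    · simp [hx, hv, e5]
  · intro s' _ h
    ext v
    simp [output, h v v.2]

end Kernel

/-! ### Listing the independent subsets of the kernel and choosing the best one. -/

namespace CoverInstance

open Classical in
/-- The independent subsets of `A` all of whose elements are smaller than `m`. -/
noncomputable def indepSubsets (I : CoverInstance) (A : Finset (Fin I.n)) (m : ℕ) :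
    Finset (Finset (Fin I.n)) :=
  Finset.univ.filter fun S => S ⊆ A ∧ (∀ v ∈ S, v.val < m) ∧ I.M.Indep (S : Set (Fin I.n))

theorem mem_indepSubsets {I : CoverInstance} {A S : Finset (Fin I.n)} {m : ℕ} :
    S ∈ I.indepSubsets A m ↔
      S ⊆ A ∧ (∀ v ∈ S, v.val < m) ∧ I.M.Indep (S : Set (Fin I.n)) := by
  classical
  simp [indepSubsets]

theorem indepSubsets_mono {I : CoverInstance} {A : Finset (Fin I.n)} {m m' : ℕ} (h : m ≤ m') :
    I.indepSubsets A m ⊆ I.indepSubsets A m' := by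
  intro S hS
  rw [mem_indepSubsets] at hS ⊢
  exact ⟨hS.1, fun v hv => (hS.2.1 v hv).trans_le h, hS.2.2⟩

theorem indepSubsets_zero {I : CoverInstance} {A : Finset (Fin I.n)} :
    I.indepSubsets A 0 = {∅} := by
  ext S
  rw [mem_indepSubsets, Finset.mem_singleton]
  constructor
  · rintro ⟨_, h, _⟩
    exact Finset.eq_empty_of_forall_notMem fun v hv => absurd (h v hv) (Nat.not_lt_zero _)
  · rintro rfl
    simp

/-- The first `len` columns of the natural array `7` list the members of `G`, each once. -/
def IsListing (I : CoverInstance) (s : RamState) (len : ℕ) (G : Finset (Finset (Fin I.n))) : Prop :=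
  (Finset.range len).image (fun j => I.ofFun fun u => s.narr 7 u j) = G ∧ G.card = len

end CoverInstance

/-- Appends the set in column `12` together with the vertex `10` to the list, if independent. -/
def extendProg (orc : Prog) : Prog :=
  .seq (.upTo 3 0 (.setNA 4 (.var 3) (.const 0) (.get 7 (.var 3) (.var 12))))
    (.seq (.setNA 4 (.var 10) (.const 0) (.const 1))
      (.seq orc (.ite (.neq (.var 50) (.const 1))
        (.seq (.upTo 3 0 (.setNA 7 (.var 3) (.var 9) (.get 4 (.var 3) (.const 0))))
          (.setN 9 (.add (.var 9) (.const 1)))) .skip)))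

/-- IsListing the independent subsets of the union of the buckets. -/
def listProg (orc : Prog) : Prog :=
  .seq (.setN 9 (.const 1)) (.upTo 10 0
    (.ite (.nlt (.const 0) (.get 5 (.var 10) (.const 0)))
      (.seq (.setN 11 (.var 9)) (.upTo 12 11 (extendProg orc))) .skip))

/-- Computes (twice) the weight covered by the set in column `12`. -/
def coverProg : Prog :=
  .seq (.setR 3 .zero) (.upTo 3 0 (.upTo 2 0
    (.ite (.disj (.nlt (.const 0) (.get 7 (.var 3) (.var 12)))
        (.nlt (.const 0) (.get 7 (.var 2) (.var 12))))
      (.setR 3 (.add (.var 3) (.get 0 (.var 3) (.var 2)))) .skip)))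

/-- Outputs the best listed set. -/
def bestProg : Prog :=
  .seq (.setR 2 .zero) (.upTo 12 9 (.seq coverProg (.ite (.rle (.var 2) (.var 3))
    (.seq (.setR 2 (.var 3))
      (.upTo 3 0 (.setNA 3 (.var 3) (.const 0) (.get 7 (.var 3) (.var 12))))) .skip)))

/-- The approximation algorithm. -/
def solveProg (orc : Prog) : Prog :=
  .seq (fillProg orc) (.ite (.nle (.var 4) (.const 1))
    (.upTo 2 0 (.setNA 3 (.var 2) (.const 0) (.get 5 (.var 2) (.const 0))))
    (.seq (listProg orc) bestProg))

section Solve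

variable {I : CoverInstance} {N K T : ℕ} {orc : Prog}

/-- The earlier columns are stated to be unchanged because the caller is still running through them
while new ones are appended. -/
theorem ends_extendProg (hO : I.IsOracle orc T) {s : RamState} (hs : I.Described s) (hN : I.n ≤ N)
    {v : Fin I.n} {j len : ℕ} {S : Finset (Fin I.n)} {G : Finset (Finset (Fin I.n))}
    (hv : s.nvar 10 = v) (hj : s.nvar 12 = j) (hlen : s.nvar 9 = len)
    (hS : I.ofFun (fun u => s.narr 7 u j) = S) (hL : I.IsListing s len G) (hG : insert v S ∉ G) :
    Ends (extendProg orc) s (T + N * 50 + 70) fun s' =>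
      (∀ u i, i < len → s'.narr 7 u i = s.narr 7 u i) ∧
      (I.M.Indep (↑(insert v S) : Set (Fin I.n)) ∧ s'.nvar 9 = len + 1 ∧
          I.IsListing s' (len + 1) (insert (insert v S) G) ∨
        ¬ I.M.Indep (↑(insert v S) : Set (Fin I.n)) ∧ s'.nvar 9 = len ∧ I.IsListing s' len G) := by
  refine Ends.seq (N * 20 + 7) (by omega) (Ends.upTo (T := 11) (fun m s' => ∀ u : Fin I.n,
      u.val < m → s'.narr 4 u 0 = s.narr 7 u j)
    hs.n_eq hN (by simp) (by simp) (by simp) (fun i s v h => h) (by simp) ?_ (by omega) ?_)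
  · intro m s' hm hF hx h
    have e7 : s'.narr 7 = s.narr 7 := hF.narr 7 (by simp)
    have e12 : s'.nvar 12 = j := (hF.nvar 12 (by simp)).trans hj
    refine Ends.setNA (by simp) fun v hv => ?_
    rcases Nat.lt_succ_iff_lt_or_eq.1 hv with hv | hv
    · have : v.val ≠ m := by omega
      simp [hx, this, h v hv]
    · simp [hx, hv, e7, e12]
  · intro s1 hF1 h1
    have hs1 := hs.framed hF1 (by simp) (by simp) (by simp) (by simp)
    have e10 : s1.nvar 10 = v := (hF1.nvar 10 (by simp)).trans hv
    have e9 : s1.nvar 9 = len := (hF1.nvar 9 (by simp)).trans hlen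
    have e7 : s1.narr 7 = s.narr 7 := hF1.narr 7 (by simp)
    refine Ends.setNA_seq (by simp; omega) (Ends.seq T (by simp; omega)
      ((hO.spec _ ⟨by simpa using hs1.n_eq, by simpa using hs1.r_eq, by simpa using hs1.fam_eq,
        by simpa using hs1.bound_eq⟩).mono le_rfl fun s2 hF2 h50 => ?_))
    have hset : (I.ofFun fun u => (s1.setNArr 4 ((NExp.var 10).eval s1) ((NExp.const 0).eval s1)
        ((NExp.const 1).eval s1)).narr 4 u 0) = insert v S := by
      ext u
      rw [← hS]
      by_cases huv : u = v
      · simp [e10, huv]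
      · have : u.val ≠ v.val := fun h => huv (Fin.ext h)
        simp [e10, huv, this, h1 u u.2]
    have f4 := hF2.narr 4 (hO.keeps_narr 4 (by norm_num))
    rw [← f4] at hset h50
    rw [hset] at h50
    have f9 := hF2.nvar 9 (hO.keeps_nvar 9 (by norm_num))
    have f7 := hF2.narr 7 (hO.keeps_narr 7 (by norm_num))
    have f0 := hF2.nvar 0 (hO.keeps_nvar 0 (by norm_num))
    simp [e9] at f9
    simp [e7] at f7
    simp [hs1.n_eq] at f0
    refine Ends.ite (by simp; omega) (fun hb => ?_) (fun hb => Ends.skip (by simp; omega) ?_)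
    · simp at hb
      refine Ends.seq (N * 20 + 7) (by simp; omega) (Ends.upTo (T := 11) (fun m s' =>
          (∀ u i, i < len → s'.narr 7 u i = s.narr 7 u i) ∧
          ∀ u : Fin I.n, u.val < m → s'.narr 7 u len = s2.narr 4 u 0)
        f0 hN (by simp) (by simp) (by simp) (fun i s v h => h) (by simp [f7]) ?_ (by omega) ?_)
      · intro m s' hm hF hx ⟨h, h'⟩
        have g4 : s'.narr 4 = s2.narr 4 := hF.narr 4 (by simp)
        have g9 : s'.nvar 9 = len := (hF.nvar 9 (by simp)).trans f9
        refine Ends.setNA (by simp) ⟨fun u i hi => ?_, fun u hu => ?_⟩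
        · have : i ≠ len := by omega
          simp [hx, g9, this, h u i hi]
        · rcases Nat.lt_succ_iff_lt_or_eq.1 hu with hu | hu
          · have : u.val ≠ m := by omega
            simp [hx, this, h' u hu]
          · simp [hx, hu, g4, g9]
      · intro s3 hF3 ⟨h3, h3'⟩
        have g9 : s3.nvar 9 = len := (hF3.nvar 9 (by simp)).trans f9
        refine Ends.setN (by simp; omega) ⟨by simpa using h3, Or.inl ⟨h50.1 hb, by simp [g9], ?_⟩⟩
        refine ⟨?_, by rw [Finset.card_insert_of_notMem hG, hL.2]⟩
        rw [Finset.range_add_one, Finset.image_insert]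
        congr 1
        · rw [← hset]
          ext u
          simp [h3' u u.2]
        · rw [← hL.1]
          refine Finset.image_congr fun i hi => ?_
          have hi' : i < len := by simpa using hi
          simp [h3 _ i hi']
    · simp at hb
      refine ⟨fun u i _ => by rw [f7], Or.inr ⟨fun h => hb (h50.2 h), f9, ?_⟩⟩
      unfold IsListing
      rw [f7]
      exact hL

/-- Subsets of independent sets are independent, so each independent set with largest element `v`
arises by adding `v` to exactly one set listed earlier. The list only grows, so it never exceeds its
final length, and each vertex causes at most `K` calls of the oracle. -/
theorem ends_listProg (hO : I.IsOracle orc T) {s : RamState} (hs : I.Described s) (hN : I.n ≤ N)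
    {A : Finset (Fin I.n)} (hA : I.ofFun (fun v => s.narr 5 v 0) = A) (h7 : s.narr 7 = fun _ _ => 0)
    (hK : (I.indepSubsets A I.n).card ≤ K) :
    Ends (listProg orc) s (N * (K * (T + N * 50 + 70 + 9) + 7 + 40 + 9) + 17) fun s' =>
      s'.nvar 9 ≤ K ∧ I.IsListing s' (s'.nvar 9) (I.indepSubsets A I.n) := by
  have k (x : ℕ) (hx : x < 50 ∧ x ≠ 3 ∧ x ≠ 9 ∧ x ≠ 12 ∧ x ≠ 11) :
      (Prog.seq (.setN 11 (.var 9)) (.upTo 12 11 (extendProg orc))).Keeps (.nvar x) := by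
    simp [extendProg, hO.keeps_nvar x hx.1, hx.2]
  have k' (x : ℕ) (hx : x < 20 ∧ x ≠ 4 ∧ x ≠ 7) :
      (Prog.seq (.setN 11 (.var 9)) (.upTo 12 11 (extendProg orc))).Keeps (.narr x) := by
    simp [extendProg, hO.keeps_narr x hx.1, hx.2]
  refine Ends.setN_seq (by simp) (Ends.upTo (T := K * (T + N * 50 + 70 + 9) + 7 + 40) (fun m s' =>
      I.IsListing s' (s'.nvar 9) (I.indepSubsets A m))
    (by simpa using hs.n_eq) hN (by simp) (by simp [extendProg, hO.keeps_nvar])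
    (by simp [extendProg, hO.keeps_nvar]) (fun i s v h => h) ?_ ?_ (by simp)
    (fun s' _ h => ⟨h.2 ▸ hK, h⟩))
  -- Column 0 of the blank array `7` already represents the empty set, which is why the length
  -- starts at 1.
  · rw [indepSubsets_zero]
    unfold IsListing
    simp [h7, ofFun]
  intro m s' hm hF hx hL
  have e0 : s'.nvar 0 = I.n := by
    have := hF.nvar 0 (by simp [extendProg, hO.keeps_nvar])
    simpa [hs.n_eq] using this
  have e1 : s'.nvar 1 = I.r := by
    have := hF.nvar 1 (by simp [extendProg, hO.keeps_nvar])
    simpa [hs.r_eq] using this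
  have e2 : s'.narr 1 = (I.input 0).narr 1 := by
    have := hF.narr 1 (by simp [extendProg, hO.keeps_narr])
    simpa [hs.fam_eq] using this
  have e3 : s'.narr 2 = (I.input 0).narr 2 := by
    have := hF.narr 2 (by simp [extendProg, hO.keeps_narr])
    simpa [hs.bound_eq] using this
  have e5 : s'.narr 5 = s.narr 5 := by
    have := hF.narr 5 (by simp [extendProg, hO.keeps_narr])
    simpa using this
  have hmA : (⟨m, hm⟩ : Fin I.n) ∈ A ↔ s.narr 5 m 0 ≠ 0 := by rw [← hA]; simp
  refine Ends.ite (by simp) (fun hb => ?_) (fun hb => Ends.skip (by simp) ?_)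
  · simp [hx, e5] at hb
    set v : Fin I.n := ⟨m, hm⟩ with hv
    have hvA : v ∈ A := hmA.2 (by omega)
    set old := s'.nvar 9 with hold
    set L : ℕ → Finset (Fin I.n) := fun j => I.ofFun fun u => s'.narr 7 u j with hLdef
    have hLmem : ∀ j < old, L j ∈ I.indepSubsets A m := by
      intro j hj
      rw [← hL.1]
      exact Finset.mem_image_of_mem _ (Finset.mem_range.2 hj)
    have hvL : ∀ j < old, v ∉ L j := fun j hj h =>
      absurd ((mem_indepSubsets.1 (hLmem j hj)).2.1 v h) (lt_irrefl _)
    have hinj : Set.InjOn L (Finset.range old) := by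
      refine Finset.card_image_iff.1 ?_
      rw [hL.1, hL.2, Finset.card_range]
    classical
    -- `G j` is the family that should be listed once the first `j` old columns have been tried with
    -- `v`.
    set G : ℕ → Finset (Finset (Fin I.n)) := fun j => I.indepSubsets A m ∪
      ((Finset.range j).image fun i => insert v (L i)).filter fun S =>
        I.M.Indep (S : Set (Fin I.n)) with hG
    have hGm : ∀ j S, S ∈ G j ↔ S ∈ I.indepSubsets A m ∨
        (∃ i < j, insert v (L i) = S) ∧ I.M.Indep (S : Set (Fin I.n)) := by
      intro j S
      simp [hG]
    have hGold : G old = I.indepSubsets A (m + 1) := by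
      ext S
      rw [hGm]
      constructor
      · rintro (h | ⟨⟨i, hi, rfl⟩, h⟩)
        · exact indepSubsets_mono (Nat.le_succ m) h
        · have := mem_indepSubsets.1 (hLmem i hi)
          rw [mem_indepSubsets]
          refine ⟨Finset.insert_subset hvA this.1, fun u hu => ?_, h⟩
          rcases Finset.mem_insert.1 hu with rfl | hu
          · exact Nat.lt_succ_self _
          · exact (this.2.1 u hu).trans (Nat.lt_succ_self _)
      · intro h
        have h' := mem_indepSubsets.1 h
        by_cases hvS : v ∈ S
        · have : S.erase v ∈ I.indepSubsets A m := by
            rw [mem_indepSubsets]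
            refine ⟨(Finset.erase_subset _ _).trans h'.1, fun u hu => ?_,
              h'.2.2.subset (by simp)⟩
            have h1 := h'.2.1 u (Finset.mem_of_mem_erase hu)
            have h2 : u.val ≠ m := fun h => (Finset.ne_of_mem_erase hu) (Fin.ext h)
            omega
          rw [← hL.1] at this
          obtain ⟨i, hi, hiS⟩ := Finset.mem_image.1 this
          refine Or.inr ⟨⟨i, Finset.mem_range.1 hi, ?_⟩, h'.2.2⟩
          change insert v (I.ofFun fun u => s'.narr 7 u i) = S
          rw [hiS, Finset.insert_erase hvS]
        · refine Or.inl (mem_indepSubsets.2 ⟨h'.1, fun u hu => ?_, h'.2.2⟩)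
          have h1 := h'.2.1 u hu
          have h2 : u.val ≠ m := fun h => hvS ((Fin.ext h : u = v) ▸ hu)
          omega
    have holdK : old ≤ K := by
      rw [← hL.2]
      exact (Finset.card_le_card (indepSubsets_mono hm.le)).trans hK
    -- The old length is frozen in the variable `11`, so that sets appended for `v` are not tried
    -- with `v` again.
    refine Ends.setN_seq (by simp) (Ends.upTo (T := T + N * 50 + 70) (fun j s'' =>
      (∀ u i, i < old → s''.narr 7 u i = s'.narr 7 u i) ∧ old ≤ s''.nvar 9 ∧
        I.IsListing s'' (s''.nvar 9) (G j)) (m := old) (by simp [hold]) holdK (by simp)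
      (by simp [extendProg, hO.keeps_nvar]) (by simp [extendProg, hO.keeps_nvar])
      (fun i s v h => h) ?_ ?_ (by simp) (fun s'' _ h => hGold ▸ h.2.2))
    · refine ⟨by simp, by simp [hold], ?_⟩
      have : G 0 = I.indepSubsets A m := by simp [hG]
      rw [this]
      exact hL
    · intro j s'' hj hF' hx' ⟨h1, h2, h3⟩
      have g0 := hF'.nvar 0 (by simp [extendProg, hO.keeps_nvar])
      have g1 := hF'.nvar 1 (by simp [extendProg, hO.keeps_nvar])
      have g2 := hF'.narr 1 (by simp [extendProg, hO.keeps_narr])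
      have g3 := hF'.narr 2 (by simp [extendProg, hO.keeps_narr])
      have g10 := hF'.nvar 10 (by simp [extendProg, hO.keeps_nvar])
      simp [e0, e1, e2, e3, hx] at g0 g1 g2 g3 g10
      have hLj : (I.ofFun fun u => s''.narr 7 u j) = L j := by
        ext u; simp [hLdef, h1 _ j hj]
      -- Sets containing `v` do not occur among the old ones, and distinct old sets remain distinct
      -- after inserting `v`, since none of them contains it.
      have hnot : insert v (L j) ∉ G j := by
        rw [hGm]
        rintro (h | ⟨⟨i, hi, h⟩, _⟩)
        · exact absurd ((mem_indepSubsets.1 h).2.1 v (Finset.mem_insert_self _ _)) (lt_irrefl _)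
        · have h4 : L i = L j := by
            rw [← Finset.erase_insert (hvL i (by omega)), h, Finset.erase_insert (hvL j hj)]
          have := hinj (by simpa using hi.trans hj) (by simpa using hj) h4
          omega
      refine (ends_extendProg hO ⟨g0, g1, g2, g3⟩ hN g10 hx' rfl hLj h3 hnot).mono le_rfl
        fun s3 _ ⟨h4, h5⟩ => ⟨fun u i hi => (h4 u i (hi.trans_le h2)).trans (h1 u i hi), ?_⟩
      rcases h5 with ⟨h5, h6, h7⟩ | ⟨h5, h6, h7⟩
      · refine ⟨by omega, ?_⟩
        have : G (j + 1) = insert (insert v (L j)) (G j) := by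
          ext S
          rw [Finset.mem_insert, hGm, hGm]
          constructor
          · rintro (h | ⟨⟨i, hi, h⟩, h'⟩)
            · exact Or.inr (Or.inl h)
            · rcases Nat.lt_succ_iff_lt_or_eq.1 hi with hi | rfl
              · exact Or.inr (Or.inr ⟨⟨i, hi, h⟩, h'⟩)
              · exact Or.inl h.symm
          · rintro (rfl | h | ⟨⟨i, hi, h⟩, h'⟩)
            · exact Or.inr ⟨⟨j, by omega, rfl⟩, h5⟩
            · exact Or.inl h
            · exact Or.inr ⟨⟨i, by omega, h⟩, h'⟩
        rw [this, h6]
        exact h7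
      · refine ⟨by omega, ?_⟩
        have : G (j + 1) = G j := by
          ext S
          rw [hGm, hGm]
          constructor
          · rintro (h | ⟨⟨i, hi, h⟩, h'⟩)
            · exact Or.inl h
            · rcases Nat.lt_succ_iff_lt_or_eq.1 hi with hi | rfl
              · exact Or.inr ⟨⟨i, hi, h⟩, h'⟩
              · exact absurd (h ▸ h') h5
          · rintro (h | ⟨⟨i, hi, h⟩, h'⟩)
            · exact Or.inl h
            · exact Or.inr ⟨⟨i, by omega, h⟩, h'⟩
        rw [this, h6]
        exact h7
  · simp [hx, e5] at hb
    have : I.indepSubsets A (m + 1) = I.indepSubsets A m := by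
      refine (Finset.Subset.antisymm (fun S hS => ?_) (indepSubsets_mono (Nat.le_succ m)))
      rw [mem_indepSubsets] at hS ⊢
      refine ⟨hS.1, fun u hu => ?_, hS.2.2⟩
      have h1 := hS.2.1 u hu
      have h2 : u.val ≠ m := fun h => by
        have : (⟨m, hm⟩ : Fin I.n) ∈ A := by
          have h3 : u = ⟨m, hm⟩ := Fin.ext h
          exact h3 ▸ hS.1 hu
        exact hmA.1 this hb
      omega
    rw [this]
    exact hL

/-- Summing over ordered pairs yields twice the coverage, which ranks the candidates equally well.
-/
theorem ends_coverProg {s : RamState} {ε : ℝ} (hn : s.nvar 0 = I.n) (hN : I.n ≤ N)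
    (hW : s.rarr 0 = (I.input ε).rarr 0) {j : ℕ} (hj : s.nvar 12 = j) :
    Ends coverProg s (N * (N * 50 + 16) + 10) fun s' => s'.rvar 3 =
      pairCover I.wmat (I.ofFun fun u => s.narr 7 u j : Set (Fin I.n)) := by
  classical
  set f : ℕ → ℕ → ℝ := fun u v =>
    if s.narr 7 u j ≠ 0 ∨ s.narr 7 v j ≠ 0 then s.rarr 0 u v else 0 with hf
  refine Ends.setR_seq (by simp) (Ends.upTo (T := N * 50 + 7) (fun m s' =>
      s'.rvar 3 = ∑ u ∈ Finset.range m, ∑ v ∈ Finset.range I.n, f u v)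
    (by simpa using hn) hN (by simp) (by simp) (by simp) (fun i s v h => h) (by simp) ?_
    (by simp) ?_)
  · intro u s1 hu hF1 hx1 h1
    have e0 : s1.nvar 0 = I.n := by
      have := hF1.nvar 0 (by simp)
      simpa [hn] using this
    refine Ends.upTo (T := 41) (fun m s' => s'.rvar 3 =
        (∑ u ∈ Finset.range u, ∑ v ∈ Finset.range I.n, f u v) + ∑ v ∈ Finset.range m, f u v)
      e0 hN (by simp) (by simp) (by simp) (fun i s v h => h) (by simpa using h1) ?_ (by omega) ?_
    · intro v s2 hv hF2 hx2 h2
      have g3 : s2.nvar 3 = u := (hF2.nvar 3 (by simp)).trans hx1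
      have g12 : s2.nvar 12 = j := by
        have := hF1.nvar 12 (by simp)
        rw [hF2.nvar 12 (by simp)]
        simpa [hj] using this
      have g7 : s2.narr 7 = s.narr 7 := by
        have := hF1.narr 7 (by simp)
        rw [hF2.narr 7 (by simp)]
        simpa using this
      have g0 : s2.rarr 0 = s.rarr 0 := by
        have := hF1.rarr 0 (by simp)
        rw [hF2.rarr 0 (by simp)]
        simpa using this
      refine Ends.ite (by simp) (fun hb => Ends.setR (by simp) ?_)
        (fun hb => Ends.skip (by simp) ?_)
      · simp [g3, hx2, g12, g7, Nat.pos_iff_ne_zero] at hb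
        have : f u v = s.rarr 0 u v := by
          rw [hf]; exact if_pos hb
        simp [h2, Finset.sum_range_succ, g3, hx2, g0, this, add_assoc]
      · simp [g3, hx2, g12, g7] at hb
        have : f u v = 0 := by
          rw [hf]; exact if_neg (by tauto)
        simp [h2, Finset.sum_range_succ, this]
    · intro s2 _ h2
      rw [h2, Finset.sum_range_succ]
  · intro s' _ h
    rw [h, Finset.sum_range]
    unfold pairCover
    refine Finset.sum_congr rfl fun u _ => ?_
    rw [Finset.sum_range]
    refine Finset.sum_congr rfl fun v _ => ?_
    rw [hf]
    simp only [hW, input_weight, Finset.mem_coe, mem_ofFun]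

theorem ends_bestProg {s : RamState} {ε : ℝ} (hn : s.nvar 0 = I.n) (hN : I.n ≤ N)
    (hW : s.rarr 0 = (I.input ε).rarr 0) (h3 : s.narr 3 = fun _ _ => 0) {len : ℕ}
    {G : Finset (Finset (Fin I.n))} (hlen : s.nvar 9 = len) (hK : len ≤ K) (hL : I.IsListing s len G)
    (hG : ∅ ∈ G) :
    Ends bestProg s (K * (N * (N * 50 + 16) + 10 + N * 20 + 20 + 9) + 10) fun s' =>
      I.output s' ∈ G ∧ ∀ S ∈ G,
        pairCover I.wmat (S : Set (Fin I.n)) ≤ pairCover I.wmat (I.output s' : Set (Fin I.n)) := by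
  refine Ends.setR_seq (by simp) (Ends.upTo (T := N * (N * 50 + 16) + 10 + N * 20 + 20) (fun m s' =>
      I.output s' ∈ G ∧ s'.rvar 2 ≤ pairCover I.wmat (I.output s' : Set (Fin I.n)) ∧
      ∀ j < m, pairCover I.wmat (I.ofFun fun u => s.narr 7 u j : Set (Fin I.n)) ≤ s'.rvar 2)
    (by simpa using hlen) hK (by simp) (by simp [coverProg]) (by simp [coverProg])
    (fun i s v h => h) ?_ ?_ (by simp) ?_)
  -- The blank output array stands for the empty set, a listed set whose coverage is the initial
  -- record 0.
  · have : I.output s = ∅ := by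
      ext v; simp [output, h3]
    refine ⟨?_, ?_, fun j hj => absurd hj (Nat.not_lt_zero _)⟩
    · change I.output s ∈ G
      rwa [this]
    · simp
      change 0 ≤ pairCover I.wmat (I.output s : Set (Fin I.n))
      rw [this]
      simp [pairCover]
  · intro j s1 hj hF1 hx1 ⟨h1, h2, h4⟩
    have e0 : s1.nvar 0 = I.n := by
      have := hF1.nvar 0 (by simp [coverProg])
      simpa [hn] using this
    have eW : s1.rarr 0 = (I.input ε).rarr 0 := by
      have := hF1.rarr 0 (by simp [coverProg])
      simpa [hW] using this
    have e7 : s1.narr 7 = s.narr 7 := by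
      have := hF1.narr 7 (by simp [coverProg])
      simpa using this
    refine Ends.seq (N * (N * 50 + 16) + 10) (by omega) ((ends_coverProg e0 hN eW hx1).mono le_rfl
      fun s2 hF2 h5 => ?_)
    rw [e7] at h5
    have f2 : s2.rvar 2 = s1.rvar 2 := hF2.rvar 2 (by simp [coverProg])
    have f7 : s2.narr 7 = s.narr 7 := (hF2.narr 7 (by simp [coverProg])).trans e7
    have f3 : s2.narr 3 = s1.narr 3 := hF2.narr 3 (by simp [coverProg])
    have f12 : s2.nvar 12 = j := (hF2.nvar 12 (by simp [coverProg])).trans hx1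
    have f0 : s2.nvar 0 = I.n := (hF2.nvar 0 (by simp [coverProg])).trans e0
    refine Ends.ite (by simp; omega) (fun hb => ?_) (fun hb => Ends.skip (by simp; omega) ?_)
    · simp [f2] at hb
      refine Ends.setR_seq (by simp; omega) (Ends.upTo (T := 11) (fun m s' =>
          ∀ v : Fin I.n, v.val < m → s'.narr 3 v 0 = s.narr 7 v j)
        (by simpa using f0) hN (by simp) (by simp) (by simp) (fun i s v h => h) (by simp) ?_
        (by simp; omega) ?_)
      · intro m s3 hm hF3 hx3 h
        have k7 : s3.narr 7 = s.narr 7 := by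
          have := hF3.narr 7 (by simp)
          simpa [f7] using this
        have k12 : s3.nvar 12 = j := by
          have := hF3.nvar 12 (by simp)
          simpa [f12] using this
        refine Ends.setNA (by simp) fun v hv => ?_
        rcases Nat.lt_succ_iff_lt_or_eq.1 hv with hv | hv
        · have : v.val ≠ m := by omega
          simp [hx3, this, h v hv]
        · simp [hx3, hv, k7, k12]
      · intro s3 hF3 h
        have k2 : s3.rvar 2 = s2.rvar 3 := by
          have := hF3.rvar 2 (by simp)
          simpa using this
        have hout : I.output s3 = I.ofFun fun u => s.narr 7 u j := by
          ext v; simp [output, h v v.2]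
        refine ⟨?_, ?_, fun i hi => ?_⟩
        · rw [hout, ← hL.1]
          exact Finset.mem_image_of_mem (fun j => I.ofFun fun u => s.narr 7 u j)
            (Finset.mem_range.2 hj)
        · rw [k2, h5, hout]
        · rw [k2]
          rcases Nat.lt_succ_iff_lt_or_eq.1 hi with hi | rfl
          · exact (h4 i hi).trans hb
          · exact h5.ge
    · simp [f2] at hb
      have hout : I.output s2 = I.output s1 := by
        unfold output
        rw [f3]
      rw [hout, f2]
      refine ⟨h1, h2, fun i hi => ?_⟩
      rcases Nat.lt_succ_iff_lt_or_eq.1 hi with hi | rfl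
      · exact h4 i hi
      · exact h5 ▸ hb.le
  · intro s' _ ⟨h1, h2, h4⟩
    refine ⟨h1, fun S hS => ?_⟩
    rw [← hL.1] at hS
    obtain ⟨j, hj, rfl⟩ := Finset.mem_image.1 hS
    exact (h4 j (Finset.mem_range.1 hj)).trans h2

end Solve

/-! ### Approximation guarantee, kernel size and running times. -/

section Combine

variable {I : CoverInstance}

theorem card_le_rank_of_indep {S : Finset (Fin I.n)} (h : I.M.Indep (S : Set (Fin I.n))) :
    S.card ≤ I.rank := by
  have h1 := h.encard_le_eRank
  rw [Set.encard_coe_eq_coe_finsetCard] at h1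
  have h2 : I.M.eRank ≠ ⊤ := by
    obtain ⟨B, hB⟩ := I.M.exists_isBase
    rw [← hB.encard_eq_eRank]
    exact (Set.toFinite B).encard_lt_top.ne
  have := ENat.toNat_le_toNat h1 h2
  rwa [ENat.toNat_natCast] at this

theorem cover_mono {S S' : Finset (Fin I.n)} (h : S ⊆ S') : I.cover S ≤ I.cover S' := by
  classical
  unfold cover
  refine Finset.sum_le_sum_of_subset_of_nonneg (fun e he => ?_) fun e he _ => ?_
  · simp only [Finset.mem_filter, Finset.mem_univ, true_and] at he ⊢
    obtain ⟨h1, v, hv, hve⟩ := he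
    exact ⟨h1, v, h hv, hve⟩
  · simp only [Finset.mem_filter, Finset.mem_univ, true_and] at he
    exact I.weight_nonneg e he.1

theorem cover_nonneg (S : Finset (Fin I.n)) : 0 ≤ I.cover S := by
  classical
  refine Finset.sum_nonneg fun e he => ?_
  simp only [Finset.mem_filter, Finset.mem_univ, true_and] at he
  exact I.weight_nonneg e he.1

theorem card_filter_bucket_le {t : ℕ} {bk : ℕ → ℕ} {ε : ℝ} (h : IsFilled I ε t bk) {j : ℕ}
    (hj : j < t) : (Finset.univ.filter fun v : Fin I.n => bk v = j + 1).card ≤ I.rank := by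
  refine card_le_rank_of_indep ?_
  have := h.indep j hj
  simpa using this

theorem IsFilled.card_le {t : ℕ} {bk : ℕ → ℕ} {ε : ℝ} (h : IsFilled I ε t bk) :
    (I.ofFun bk).card ≤ t * I.rank := by
  classical
  have hsub : I.ofFun bk ⊆ (Finset.range t).biUnion fun j =>
      Finset.univ.filter fun v : Fin I.n => bk v = j + 1 := by
    intro v hv
    rw [mem_ofFun] at hv
    have := h.le v
    rw [Finset.mem_biUnion]
    exact ⟨bk v - 1, Finset.mem_range.2 (by omega), by simp; omega⟩
  refine (Finset.card_le_card hsub).trans (Finset.card_biUnion_le.trans ?_)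
  refine (Finset.sum_le_card_nsmul _ _ I.rank fun j hj =>
    card_filter_bucket_le h (Finset.mem_range.1 hj)).trans ?_
  simp

/-- Some optimal solution exists. -/
theorem exists_optimal (I : CoverInstance) : ∃ O : Finset (Fin I.n),
    I.M.Indep (O : Set (Fin I.n)) ∧
      ∀ S : Finset (Fin I.n), I.M.Indep (S : Set (Fin I.n)) → I.cover S ≤ I.cover O := by
  classical
  obtain ⟨O, hO, hmax⟩ := Finset.exists_max_image
    (Finset.univ.filter fun S : Finset (Fin I.n) => I.M.Indep (S : Set (Fin I.n)))
    I.cover ⟨∅, by simp⟩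
  exact ⟨O, by simpa using hO, fun S hS => hmax S (by simpa using hS)⟩

/-- The union of the buckets contains an approximate solution. -/
theorem IsFilled.exists_approx {t : ℕ} {bk : ℕ → ℕ} {ε : ℝ} (hε : 0 < ε)
    (h : IsFilled I ε t bk) : ∃ S ⊆ I.ofFun bk, I.IsApproxSolution ε S := by
  classical
  obtain ⟨O, hO, hmax⟩ := exists_optimal I
  suffices ∃ S ⊆ I.ofFun bk, I.M.Indep (S : Set (Fin I.n)) ∧
      (1 - ε) * I.cover O ≤ I.cover S by
    obtain ⟨S, hS, hSi, hle⟩ := this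
    -- Comparison with one optimal set suffices: for ε ≤ 1 the factor 1 - ε preserves inequalities,
    -- and for ε > 1 the left side is nonpositive.
    by_cases hε1 : ε ≤ 1
    · exact ⟨S, hS, hSi, fun P hP =>
        (mul_le_mul_of_nonneg_left (hmax P hP) (by linarith)).trans hle⟩
    · refine ⟨S, hS, hSi, fun P _ => le_trans ?_ (cover_nonneg S)⟩
      exact mul_nonpos_of_nonpos_of_nonneg (by linarith) (cover_nonneg P)
  rcases h.t_le.lt_or_eq with hlt | heq
  · rcases Nat.eq_zero_or_pos t with rfl | ht
    -- Without buckets ε > 1, and the empty set is good enough.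
    · have := h.lt_t hlt
      simp only [Nat.cast_zero, zero_add, one_mul] at this
      refine ⟨∅, by simp, by simp, le_trans ?_ (cover_nonneg _)⟩
      exact mul_nonpos_of_nonpos_of_nonneg (by linarith) (cover_nonneg O)
    · obtain ⟨S, hS, hSi, hle⟩ := I.M.exists_approx I.wmat_symm I.wmat_nonneg I.wmat_self ht
        h.t_mul (h.lt_t hlt) (fun j => Finset.univ.filter fun v : Fin I.n => bk v = j + 1)
        (I.ofFun bk) (fun j _ v hv => by simp at hv; simp [hv])
        (fun j hj => by simpa using h.indep j hj)
        (fun i _ j _ hij => Finset.disjoint_left.2 fun v hv hv' => by simp at hv hv'; omega)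
        (fun v hv j hj => by simpa [wdeg] using h.greedy v (by simpa using hv) j hj) O hO
      rw [pairCover_eq, pairCover_eq] at hle
      exact ⟨S, hS, hSi, by linarith⟩
  -- If t = n, the kernel contains all of `O`: an element `o` outside it would fit into any empty
  -- bucket, so all `n` disjoint buckets are nonempty and use up all `n` vertices, including `o`.
  · refine ⟨O, fun o ho => ?_, hO, by nlinarith [cover_nonneg O]⟩
    rw [mem_ofFun]
    intro ho0
    have hex : ∀ j : Fin I.n, ∃ u : Fin I.n, bk u = j.val + 1 := by
      intro j
      by_contra! hne
      refine h.greedy o ho0 j (heq ▸ j.2) (hO.subset ?_)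
      rintro u (rfl | hu)
      · exact ho
      · exact absurd hu.1 (hne u)
    choose f hf using hex
    have hinj : Function.Injective f := fun i j hij => by
      have h1 := hf i
      rw [hij, hf j] at h1
      exact Fin.ext (by omega)
    obtain ⟨j, hj⟩ := (Finite.injective_iff_surjective.1 hinj) o
    have := hf j
    rw [hj, ho0] at this
    omega

theorem IsFilled.card_indepSubsets_le {t : ℕ} {bk : ℕ → ℕ} {ε : ℝ} (h : IsFilled I ε t bk)
    (hε : 0 < ε) (ht : 2 ≤ t) : (I.indepSubsets (I.ofFun bk) I.n).card ≤
      ⌊(max 1 (1 / ε)) ^ (3 * I.rank)⌋₊ := by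
  classical
  refine Nat.le_floor ?_
  have hsub : I.indepSubsets (I.ofFun bk) I.n ⊆
      (I.ofFun bk).powerset.filter fun S => S.card ≤ I.rank := by
    intro S hS
    rw [mem_indepSubsets] at hS
    rw [Finset.mem_filter, Finset.mem_powerset]
    exact ⟨hS.1, card_le_rank_of_indep hS.2.2⟩
  have h1 : ((I.indepSubsets (I.ofFun bk) I.n).card : ℝ) ≤
      (((I.ofFun bk).powerset.filter fun S => S.card ≤ I.rank).card : ℝ) := by
    exact_mod_cast Finset.card_le_card hsub
  refine h1.trans ((card_small_subsets_le (I.ofFun bk) ht h.card_le).trans ?_)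
  refine pow_le_pow_left₀ t.cast_nonneg (le_trans ?_ (le_max_right _ _)) _
  rw [le_div_iff₀ hε]
  exact h.t_mul

/-- Both programs begin with the same run of `fillProg`, so the same `t` and `bk` describe both
outputs; this is what places the solution inside the kernel. -/
theorem exists_kernel_solve {N K T : ℕ} {orc : Prog} (hO : I.IsOracle orc T) (hN : I.n ≤ N)
    {ε : ℝ} (hε : 0 < ε)
    (hK : ∀ t bk, IsFilled I ε t bk → 2 ≤ t → (I.indepSubsets (I.ofFun bk) I.n).card ≤ K) :
    ∃ t bk, IsFilled I ε t bk ∧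
      Ends (kernelProg orc) (I.input ε) (N * (N * 30 + 40) + N * 40 + 30 +
        (N * (N * 50 + N * (T + N * 50 + 70 + 9) + 60 + 9) + 7) + (N * 20 + 10))
        (fun s' => I.output s' = I.ofFun bk) ∧
      Ends (solveProg orc) (I.input ε) (N * (N * 30 + 40) + N * 40 + 30 +
        (N * (N * 50 + N * (T + N * 50 + 70 + 9) + 60 + 9) + 7) + (4 + (N * 20 + 10) +
          (N * (K * (T + N * 50 + 70 + 9) + 7 + 40 + 9) + 17) +
          (K * (N * (N * 50 + 16) + 10 + N * 20 + 20 + 9) + 10)))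
        (fun s' => t ≤ 1 ∧ I.output s' = I.ofFun bk ∨
          2 ≤ t ∧ I.output s' ∈ I.indepSubsets (I.ofFun bk) I.n ∧
            ∀ S ∈ I.indepSubsets (I.ofFun bk) I.n, pairCover I.wmat (S : Set (Fin I.n)) ≤
              pairCover I.wmat (I.output s' : Set (Fin I.n))) := by
  obtain ⟨s1, t1, hex, hle, hf⟩ := ends_fillProg hO hN hε
  have hF := hex.framed
  have k (x : ℕ) (hx : x < 2) : (fillProg orc).Keeps (.nvar x) := by
    have h50 : x < 50 := by omega
    have h : x ≠ 2 ∧ x ≠ 3 ∧ x ≠ 4 ∧ x ≠ 5 ∧ x ≠ 6 ∧ x ≠ 7 ∧ x ≠ 8 := by omega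
    simp [fillProg, degreeProg, countProg, visitProg, maxProg, tryProg, bucketProg,
      hO.keeps_nvar x h50, h]
  have k' (x : ℕ) (hx : x < 20 ∧ x ≠ 4 ∧ x ≠ 5 ∧ x ≠ 6) : (fillProg orc).Keeps (.narr x) := by
    simp [fillProg, degreeProg, countProg, visitProg, maxProg, tryProg, bucketProg,
      hO.keeps_narr x hx.1, hx.2]
  have hs1 : I.Described s1 := by
    constructor
    · rw [hF.nvar 0 (k 0 (by simp))]; simp [input]
    · rw [hF.nvar 1 (k 1 (by simp))]; simp [input]
    · rw [hF.narr 1 (k' 1 (by simp))]; rfl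
    · rw [hF.narr 2 (k' 2 (by simp))]; rfl
  have h7 : s1.narr 7 = fun _ _ => 0 := by rw [hF.narr 7 (k' 7 (by simp))]; rfl
  have h3 : s1.narr 3 = fun _ _ => 0 := by rw [hF.narr 3 (k' 3 (by simp))]; rfl
  have hW : s1.rarr 0 = (I.input ε).rarr 0 := hF.rarr 0 (by
    simp [fillProg, degreeProg, countProg, visitProg, maxProg, tryProg, bucketProg,
      hO.keeps_rarr])
  refine ⟨_, _, hf, ?_, ?_⟩
  · refine Ends.seq _ (Nat.le_add_right _ _) ⟨s1, t1, hex, hle, ?_⟩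
    exact (ends_copyBuckets hs1.n_eq hN).time (by omega)
  · refine Ends.seq _ (Nat.le_add_right _ _) ⟨s1, t1, hex, hle, ?_⟩
    rw [Nat.add_sub_cancel_left]
    refine Ends.ite (by simp; omega) (fun hb => ?_) (fun hb => ?_)
    · simp at hb
      exact (ends_copyBuckets hs1.n_eq hN).mono (by simp; omega)
        fun s' _ h => Or.inl ⟨hb, h⟩
    · simp at hb
      refine Ends.seq (N * (K * (T + N * 50 + 70 + 9) + 7 + 40 + 9) + 17) (by simp; omega)
        ((ends_listProg hO hs1 hN rfl h7 (hK _ _ hf hb)).mono le_rfl fun s2 hF2 ⟨g1, g2⟩ => ?_)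
      refine (ends_bestProg (ε := ε) ((hF2.nvar 0 ?_).trans hs1.n_eq) hN ((hF2.rarr 0 ?_).trans hW)
        ((hF2.narr 3 ?_).trans h3) rfl g1 g2 ?_).mono (by simp; omega)
        fun s' _ h => Or.inr ⟨hb, h⟩
      · simp [listProg, extendProg, hO.keeps_nvar]
      · simp [listProg, extendProg, hO.keeps_rarr]
      · simp [listProg, extendProg, hO.keeps_narr]
      · rw [mem_indepSubsets]; simp

/-- The two algorithms are correct, whatever independence oracle they use. -/
theorem exists_kernel_approx {N T : ℕ} {orc : Prog} (hO : I.IsOracle orc T) (hN : I.n ≤ N)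
    (hN1 : 1 ≤ N) (hT : T ≤ 1000 * N ^ 4) {ε : ℝ} (hε : 0 < ε) :
    ∃ V' S : Finset (Fin I.n),
      Computes (kernelProg orc) I ε V' (10000 * (N : ℝ) ^ 6) ∧
      (V'.card : ℝ) ≤ I.rank / ε ∧ S ⊆ V' ∧ I.IsApproxSolution ε S ∧
      Computes (solveProg orc) I ε S
        (10000 * (max 1 (1 / ε)) ^ (3 * I.rank) * (N : ℝ) ^ 6) := by
  set K := ⌊(max 1 (1 / ε)) ^ (3 * I.rank)⌋₊ with hKdef
  have hK0 : (1 : ℝ) ≤ (max 1 (1 / ε)) ^ (3 * I.rank) := one_le_pow₀ (le_max_left _ _)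
  have hK1 : 1 ≤ K := Nat.le_floor (by simpa using hK0)
  have hKle : (K : ℝ) ≤ (max 1 (1 / ε)) ^ (3 * I.rank) := Nat.floor_le (by linarith)
  obtain ⟨t, bk, hf, hk, hs⟩ := exists_kernel_solve hO hN hε (K := K)
    fun t bk hf ht => hf.card_indepSubsets_le hε ht
  obtain ⟨s1, t1, he1, ht1, ho1⟩ := hk
  obtain ⟨s2, t2, he2, ht2, ho2⟩ := hs
  have p0 : 1 ≤ N ^ 6 := Nat.one_le_pow _ _ hN1
  have p1 : N ≤ N ^ 6 := Nat.le_self_pow (by norm_num) N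
  have p2 : N ^ 2 ≤ N ^ 6 := Nat.pow_le_pow_right hN1 (by norm_num)
  have p3 : N ^ 3 ≤ N ^ 6 := Nat.pow_le_pow_right hN1 (by norm_num)
  have pT : N ^ 2 * T ≤ 1000 * N ^ 6 := by
    calc N ^ 2 * T ≤ N ^ 2 * (1000 * N ^ 4) := Nat.mul_le_mul_left _ hT
      _ = 1000 * N ^ 6 := by ring
  have pT' : N * T ≤ 1000 * N ^ 6 := by
    refine le_trans (Nat.mul_le_mul_right T ?_) pT
    exact Nat.le_self_pow (by norm_num) N
  have b1 : t1 ≤ 2000 * N ^ 6 := by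
    refine ht1.trans ?_
    ring_nf at p0 p1 p2 p3 pT ⊢
    linarith
  have b2 : t2 ≤ 10000 * (K * N ^ 6) := by
    refine ht2.trans ?_
    have q0 : N ^ 6 ≤ K * N ^ 6 := Nat.le_mul_of_pos_left _ hK1
    have q1 : K ≤ K * N ^ 6 := Nat.le_mul_of_pos_right _ p0
    have q2 := Nat.mul_le_mul_left K p1
    have q3 := Nat.mul_le_mul_left K p2
    have q4 := Nat.mul_le_mul_left K p3
    have q5 := Nat.mul_le_mul_left K pT'
    ring_nf at p0 p1 p2 p3 pT pT' q0 q1 q2 q3 q4 q5 ⊢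
    linarith
  have hcard : ((I.ofFun bk).card : ℝ) ≤ I.rank / ε := by
    rw [le_div_iff₀ hε]
    have h1 : ((I.ofFun bk).card : ℝ) ≤ t * I.rank := by exact_mod_cast hf.card_le
    calc ((I.ofFun bk).card : ℝ) * ε ≤ t * I.rank * ε := mul_le_mul_of_nonneg_right h1 hε.le
      _ = (t * ε) * I.rank := by ring
      _ ≤ 1 * I.rank := mul_le_mul_of_nonneg_right hf.t_mul I.rank.cast_nonneg
      _ = I.rank := one_mul _
  obtain ⟨S, hS, hSa⟩ := hf.exists_approx hε
  refine ⟨I.ofFun bk, I.output s2, ⟨s1, t1, he1, ho1, ?_⟩, hcard, ?_, ?_, ⟨s2, t2, he2, rfl, ?_⟩⟩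
  · have : (t1 : ℝ) ≤ 2000 * (N : ℝ) ^ 6 := by exact_mod_cast b1
    have h6 : (0 : ℝ) ≤ (N : ℝ) ^ 6 := by positivity
    linarith
  · rcases ho2 with ⟨_, h⟩ | ⟨_, h, _⟩
    · rw [h]
    · exact (mem_indepSubsets.1 h).1
  -- With at most one bucket the whole kernel is independent and covers at least as much as any set
  -- inside it. Enumeration would be too slow here: for ε = 1 the allowed factor is 1, but a bucket
  -- may have 2^k subsets.
  · rcases ho2 with ⟨h1, h⟩ | ⟨_, h, hbest⟩
    · rw [h]
      refine ⟨?_, fun O hO' => (hSa.2 O hO').trans (cover_mono hS)⟩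
      rcases Nat.le_one_iff_eq_zero_or_eq_one.1 h1 with rfl | rfl
      · have : I.ofFun bk = ∅ := by
          ext v
          have := hf.le v
          simp; omega
        rw [this]; simp
      · refine (hf.indep 0 (by norm_num)).subset fun v hv => ?_
        have h2 := hf.le v
        have h3 : bk v ≠ 0 := mem_ofFun.1 hv
        change bk v = 0 + 1
        omega
    · refine ⟨(mem_indepSubsets.1 h).2.2, fun O hO' => (hSa.2 O hO').trans ?_⟩
      have := hbest S (mem_indepSubsets.2 ⟨hS, fun v _ => v.2, hSa.1⟩)
      rw [pairCover_eq, pairCover_eq] at this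
      linarith
  · have h2 : (t2 : ℝ) ≤ 10000 * ((K : ℝ) * (N : ℝ) ^ 6) := by exact_mod_cast b2
    refine h2.trans ?_
    rw [← mul_assoc]
    refine mul_le_mul_of_nonneg_right ?_ (by positivity)
    exact mul_le_mul_of_nonneg_left hKle (by norm_num)

theorem CoverInstance.Computes.mono {p : Prog} {ε : ℝ} {S : Finset (Fin I.n)} {T T' : ℝ}
    (h : Computes p I ε S T) (hT : T ≤ T') : Computes p I ε S T' := by
  obtain ⟨s, t, h1, h2, h3⟩ := h
  exact ⟨s, t, h1, h2, h3.trans hT⟩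

theorem exists_kernel_approx_laminar (hI : I.IsLaminar) {ε : ℝ} (hε : 0 < ε) {C : ℕ}
    (hC : 640000 ≤ C) :
    ∃ V' S : Finset (Fin I.n),
      Computes (kernelProg boundsOracle) I ε V' (C * ((I.n : ℝ) + 1) ^ C) ∧
      (V'.card : ℝ) ≤ I.rank / ε ∧ S ⊆ V' ∧ I.IsApproxSolution ε S ∧
      Computes (solveProg boundsOracle) I ε S
        (C * (max 1 (1 / ε)) ^ (C * I.rank) * ((I.n : ℝ) + 1) ^ C) := by
  have hr := hI.r_le
  set N := I.n + I.r + 1 with hN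
  have hN1 : 1 ≤ N := by omega
  have hT : N * (N * 50 + 60) + 20 ≤ 1000 * N ^ 4 := by
    have p0 : 1 ≤ N ^ 4 := Nat.one_le_pow _ _ hN1
    have p1 : N ≤ N ^ 4 := Nat.le_self_pow (by norm_num) N
    have p2 : N ^ 2 ≤ N ^ 4 := Nat.pow_le_pow_right hN1 (by norm_num)
    ring_nf at p2 ⊢
    linarith
  obtain ⟨V', S, h1, h2, h3, h4, h5⟩ := exists_kernel_approx
    (isOracle_boundsOracle hI.2.2 (N := N) (by omega) (by omega)) (by omega) hN1 hT hε
  -- The sixth power of this bound gives the constant 640000 = 10000 · 2⁶ and the exponent 12.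
  have hNle : (N : ℝ) ≤ 2 * ((I.n : ℝ) + 1) ^ 2 := by
    have : N ≤ 2 * (I.n + 1) ^ 2 := by nlinarith
    exact_mod_cast this
  have hx : (1 : ℝ) ≤ (I.n : ℝ) + 1 := by
    have : (0 : ℝ) ≤ I.n := I.n.cast_nonneg
    linarith
  have hCr : (640000 : ℝ) ≤ C := by exact_mod_cast hC
  have hpow : 10000 * (N : ℝ) ^ 6 ≤ C * ((I.n : ℝ) + 1) ^ C := by
    calc 10000 * (N : ℝ) ^ 6 ≤ 10000 * (2 * ((I.n : ℝ) + 1) ^ 2) ^ 6 := by gcongr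
      _ = 640000 * ((I.n : ℝ) + 1) ^ 12 := by ring
      _ ≤ C * ((I.n : ℝ) + 1) ^ C := by
        refine mul_le_mul hCr (pow_le_pow_right₀ hx (by omega)) (by positivity) (by positivity)
  refine ⟨V', S, h1.mono hpow, h2, h3, h4, h5.mono ?_⟩
  have hb : (max 1 (1 / ε)) ^ (3 * I.rank) ≤ (max 1 (1 / ε)) ^ (C * I.rank) :=
    pow_le_pow_right₀ (le_max_left _ _) (Nat.mul_le_mul_right _ (by omega))
  have hb0 : 0 ≤ (max 1 (1 / ε)) ^ (3 * I.rank) := by positivity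
  calc 10000 * (max 1 (1 / ε)) ^ (3 * I.rank) * (N : ℝ) ^ 6
      = (max 1 (1 / ε)) ^ (3 * I.rank) * (10000 * (N : ℝ) ^ 6) := by ring
    _ ≤ (max 1 (1 / ε)) ^ (C * I.rank) * (C * ((I.n : ℝ) + 1) ^ C) :=
        mul_le_mul hb hpow (by positivity) (hb0.trans hb)
    _ = C * (max 1 (1 / ε)) ^ (C * I.rank) * ((I.n : ℝ) + 1) ^ C := by ring

theorem exists_kernel_approx_transversal (hI : I.IsTransversal) {ε : ℝ} (hε : 0 < ε) {C : ℕ}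
    (hC : 640000 ≤ C) :
    ∃ V' S : Finset (Fin I.n),
      Computes (kernelProg transversalOracle) I ε V' (C * ((I.n : ℝ) + I.r + 1) ^ C) ∧
      (V'.card : ℝ) ≤ I.rank / ε ∧ S ⊆ V' ∧ I.IsApproxSolution ε S ∧
      Computes (solveProg transversalOracle) I ε S
        (C * (1 / ε + I.rank) ^ (C * I.rank) * ((I.n : ℝ) + I.r + 1) ^ C) := by
  set N := I.n + I.r + 1 with hN
  have hN1 : 1 ≤ N := by omega
  have hT : (N * 80 + 80) + (N * ((N * (N + 2) + 1) * (N * 50 + 99) + 60 + 9) + 7) ≤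
      1000 * N ^ 4 := by
    have p0 : 1 ≤ N ^ 4 := Nat.one_le_pow _ _ hN1
    have p1 : N ≤ N ^ 4 := Nat.le_self_pow (by norm_num) N
    have p2 : N ^ 2 ≤ N ^ 4 := Nat.pow_le_pow_right hN1 (by norm_num)
    have p3 : N ^ 3 ≤ N ^ 4 := Nat.pow_le_pow_right hN1 (by norm_num)
    ring_nf at p2 p3 ⊢
    linarith
  obtain ⟨V', S, h1, h2, h3, h4, h5⟩ := exists_kernel_approx
    (isOracle_transversalOracle hI (N := N) (by omega) (by omega)) (by omega) hN1 hT hε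
  have hNeq : (N : ℝ) = (I.n : ℝ) + I.r + 1 := by rw [hN]; push_cast; ring
  rw [hNeq] at h1 h5
  have hx : (1 : ℝ) ≤ (I.n : ℝ) + I.r + 1 := by rw [← hNeq]; exact_mod_cast hN1
  have hCr : (640000 : ℝ) ≤ C := by exact_mod_cast hC
  have hpow : 10000 * ((I.n : ℝ) + I.r + 1) ^ 6 ≤ C * ((I.n : ℝ) + I.r + 1) ^ C :=
    mul_le_mul (by linarith) (pow_le_pow_right₀ hx (by omega)) (by positivity) (by positivity)
  refine ⟨V', S, h1.mono hpow, h2, h3, h4, h5.mono ?_⟩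
  have hε' : 0 < 1 / ε := by positivity
  -- For rank 0 both powers are 1, although 1/ε may be less than 1; for positive rank the base on
  -- the right is the larger one and is at least 1.
  have hb : (max 1 (1 / ε)) ^ (3 * I.rank) ≤ (1 / ε + I.rank) ^ (C * I.rank) := by
    rcases Nat.eq_zero_or_pos I.rank with hk | hk
    · simp [hk]
    · have hk' : (1 : ℝ) ≤ I.rank := by exact_mod_cast hk
      have hmax : max 1 (1 / ε) ≤ 1 / ε + I.rank := max_le (by linarith) (by linarith)
      exact (pow_le_pow_left₀ (by positivity) hmax _).trans
        (pow_le_pow_right₀ (by linarith) (Nat.mul_le_mul_right _ (by omega)))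
  have hb0 : 0 ≤ (max 1 (1 / ε)) ^ (3 * I.rank) := by positivity
  calc 10000 * (max 1 (1 / ε)) ^ (3 * I.rank) * ((I.n : ℝ) + I.r + 1) ^ 6
      = (max 1 (1 / ε)) ^ (3 * I.rank) * (10000 * ((I.n : ℝ) + I.r + 1) ^ 6) := by ring
    _ ≤ (1 / ε + I.rank) ^ (C * I.rank) * (C * ((I.n : ℝ) + I.r + 1) ^ C) :=
        mul_le_mul hb hpow (by positivity) (hb0.trans hb)
    _ = C * (1 / ε + I.rank) ^ (C * I.rank) * ((I.n : ℝ) + I.r + 1) ^ C := by ring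

end Combine

theorem theorem1 :
    -- partition matroids
    (∃ (kernel solve : Prog) (C : ℕ), ∀ I : CoverInstance, I.IsPartition → ∀ ε : ℝ, 0 < ε →
      ∃ V' S : Finset (Fin I.n),
        CoverInstance.Computes kernel I ε V' (C * ((I.n : ℝ) + 1) ^ C) ∧
        (V'.card : ℝ) ≤ I.rank / ε ∧
        S ⊆ V' ∧ I.IsApproxSolution ε S ∧
        CoverInstance.Computes solve I ε S
          (C * (max 1 (1 / ε)) ^ (C * I.rank) * ((I.n : ℝ) + 1) ^ C)) ∧
    -- laminar matroids
    (∃ (kernel solve : Prog) (C : ℕ), ∀ I : CoverInstance, I.IsLaminar → ∀ ε : ℝ, 0 < ε →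
      ∃ V' S : Finset (Fin I.n),
        CoverInstance.Computes kernel I ε V' (C * ((I.n : ℝ) + 1) ^ C) ∧
        (V'.card : ℝ) ≤ 2 * I.rank / ε ∧
        S ⊆ V' ∧ I.IsApproxSolution ε S ∧
        CoverInstance.Computes solve I ε S
          (C * (max 1 (1 / ε)) ^ (C * I.rank) * ((I.n : ℝ) + 1) ^ C)) ∧
    -- transversal matroids
    (∃ (kernel solve : Prog) (C : ℕ), ∀ I : CoverInstance, I.IsTransversal → ∀ ε : ℝ, 0 < ε →
      ∃ V' S : Finset (Fin I.n),
        CoverInstance.Computes kernel I ε V' (C * ((I.n : ℝ) + I.r + 1) ^ C) ∧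
        (V'.card : ℝ) ≤ I.rank / ε + I.rank * ((I.rank : ℝ) - 1) ∧
        S ⊆ V' ∧ I.IsApproxSolution ε S ∧
        CoverInstance.Computes solve I ε S
          (C * (1 / ε + I.rank) ^ (C * I.rank) * ((I.n : ℝ) + I.r + 1) ^ C)) := by
  -- Partition matroids are treated as laminar ones. The kernel size k/ε obtained in all cases is at
  -- most 2k/ε, and at most k/ε + k(k - 1) because k is an integer.
  refine ⟨⟨kernelProg boundsOracle, solveProg boundsOracle, 640000, fun I hI ε hε =>
      exists_kernel_approx_laminar hI.isLaminar hε le_rfl⟩,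
    ⟨kernelProg boundsOracle, solveProg boundsOracle, 640000, fun I hI ε hε => ?_⟩,
    ⟨kernelProg transversalOracle, solveProg transversalOracle, 640000, fun I hI ε hε => ?_⟩⟩
  · obtain ⟨V', S, h1, h2, h3⟩ := exists_kernel_approx_laminar hI hε le_rfl
    refine ⟨V', S, h1, h2.trans ?_, h3⟩
    have : (0 : ℝ) ≤ I.rank := I.rank.cast_nonneg
    gcongr
    linarith
  · obtain ⟨V', S, h1, h2, h3⟩ := exists_kernel_approx_transversal hI hε le_rfl
    refine ⟨V', S, h1, h2.trans ?_, h3⟩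
    have : (0 : ℝ) ≤ I.rank * ((I.rank : ℝ) - 1) := by
      rcases Nat.eq_zero_or_pos I.rank with hk | hk
      · simp [hk]
      · have : (1 : ℝ) ≤ I.rank := by exact_mod_cast hk
        exact mul_nonneg (by linarith) (by linarith)
    linarith
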